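/- Let $n\ge 2$, $d=n+1$, and let $\mathcal H$ be a non-degenerate symmetric bilinear form of signature $(d+1,1)$ on $\mathbb R^{d+2}$, with linear coordinates $(w,t)\in\mathbb R^{d+1}\times\mathbb R$ in which $\mathcal H=|w|^2-t^2$. Let $\mathcal N_+=\{p:\mathcal H(p,p)=0,\ t(p)>0\}$ be the forward null cone and $\pi:\mathcal N_+\to S^d$, $(w,t)\mapsto w/t$. A scale is a smooth section $s:S^d\to\mathcal N_+$ of $\pi$; it determines the metric $g_s=s^*\mathcal H$ on $S^d$. The standard tractor bundle $\mathcal T$ of $S^d$ is the quotient of $T\mathbb R^{d+2}|_{\mathcal N_+}$ by the action of $\mathbb R_+$ taking $(p,u)$ to $(rp,\,r^{-1}(ru))$, with the connection induced by the parallel transport of $\mathbb R^{d+2}$. Let $I$ be a covector on $\mathbb R^{d+2}$ with $\mathcal H^{-1}(I,I)=1$, put $\sigma=I_AX^A$, and let $C,\,C_+,\,\Sigma\subset S^d$ be the images under $\pi$ of the subsets $\sigma\ge0$, $\sigma>0$, $\sigma=0$ of $\mathcal N_+$. Then: 1. Every non-zero null vector lies in $\mathcal N_+$ or $-\mathcal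 N_+$, $\pi$ is onto with the rays of $\mathcal N_+$ as fibres, and the metrics $g_s$ are exactly the metrics in the conformal class of the round metric of $S^d$. 2. The constant section $I$ (regarded as a vector field by means of $\mathcal H$) descends to a unique section of $\mathcal T$, and this section is parallel. In each scale $s$ it is represented by the triple $(\sigma\circ s,\ d(\sigma\circ s),\ I(Y))$, where $Y$ is the null vector field along $s$ with $\mathcal H(Y,s)=1$ and $\mathcal H(Y,ds)=0$, and this triple is parallel for the normal tractor connection of $g_s$, $$\nabla_a(\sigma,\mu_b,\rho)=(\nabla_a\sigma-\mu_a,\ \nabla_a\mu_b+g_{ab}\rho+P_{ab}\sigma,\ \nabla_a\rho-P_{ac}\mu^c),$$ where $P$ is the Schouten tensor. 3. $C$ has the structure of a smooth $d$-manifold with boundary, with its subspace topology, for which the inclusion into $S^d$ is a smooth immersion; its boundary is $\Sigma$ and its interior is $C_+$. For every scale $s$, with $x=\sigma\circ s$ and $g=g_s|_C$, $(C,g,x)$ is a Poincaré–Einstein space: $C$ is compact, $x\ge0$ is a smooth defining function for $\partial C$ with $|dx|_g=1$ along $\partial C$, and $g_+=x^{-2}g$ satisfies $\operatorname{Ric}(g_+)=-n\,g_+$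 on $C_+$. The metric $g_+$ has constant sectional curvature $-1$, is independent of $s$, and $(C_+,g_+)$ is isometric to the hyperboloid model of hyperbolic $d$-space. There is a conformal diffeomorphism of $S^d$ onto the round $S^d$ that carries $C_+$ to an open hemisphere and $\Sigma$ to its boundary equator $S^n$. 4. There is a linear isometry of $\mathbb R^{d,1}$ onto $\ker I$ such that restriction to $\ker I$ is an isomorphism of the isotropy group of $I$ in $SO(\mathcal H)\cong SO(d+1,1)$ onto $SO(d,1)$; under it the elements that preserve $\mathcal N_+$ correspond to the elements of $SO(d,1)$ that preserve the forward null cone of $\mathbb R^{d,1}$. The elements of the isotropy group that preserve $\mathcal N_+$ act on $C_+$ through $\pi$, and this action is transitive. -/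

import Mathlib

open scoped Manifold ContDiff

noncomputable section

namespace PEModel

/-! ### Riemannian geometry in charts

A (possibly only locally smooth) metric on a `d`-manifold, perhaps with boundary, is treated as a
family `g` of functions on pairs of tangent vectors.  Curvature quantities at `p` are computed
from the coefficients of `g` in the preferred chart at `p`.  Derivatives are taken within the range
of the model with corners (which is everything if there is no boundary).  -/

section Coordinates

variable {d : ℕ}

/-- `∂ᵢ f` at `y`, derivatives being taken within `U`. -/
def pd (U : Set (EuclideanSpace ℝ (Fin d))) (f : EuclideanSpace ℝ (Fin d) → ℝ)
    (y : EuclideanSpace ℝ (Fin d)) (i : Fin d) : ℝ :=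
  fderivWithin ℝ f U y (EuclideanSpace.single i 1)

/-- Christoffel symbols `Γᵏᵢⱼ` of the metric with coefficient matrix `G`. -/
def christoffel (U : Set (EuclideanSpace ℝ (Fin d)))
    (G : EuclideanSpace ℝ (Fin d) → Matrix (Fin d) (Fin d) ℝ)
    (y : EuclideanSpace ℝ (Fin d)) (k i j : Fin d) : ℝ :=
  (1 / 2 : ℝ) * ∑ l, (G y)⁻¹ k l *
    (pd U (fun z => G z j l) y i + pd U (fun z => G z i l) y j - pd U (fun z => G z i j) y l)

/-- The curvature `R_{ab}{}^c{}_e`, with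
`(∇_a ∇_b - ∇_b ∇_a) V^c = R_{ab}{}^c{}_e V^e`. -/
def curvature (U : Set (EuclideanSpace ℝ (Fin d)))
    (G : EuclideanSpace ℝ (Fin d) → Matrix (Fin d) (Fin d) ℝ)
    (y : EuclideanSpace ℝ (Fin d)) (a b c e : Fin d) : ℝ :=
  pd U (fun z => christoffel U G z c b e) y a - pd U (fun z => christoffel U G z c a e) y b
    + ∑ f, (christoffel U G y c a f * christoffel U G y f b e
        - christoffel U G y c b f * christoffel U G y f a e)

/-- The Ricci tensor `Ric_{ab} = R_{ca}{}^c{}_b`. -/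
def ricci (U : Set (EuclideanSpace ℝ (Fin d)))
    (G : EuclideanSpace ℝ (Fin d) → Matrix (Fin d) (Fin d) ℝ)
    (y : EuclideanSpace ℝ (Fin d)) (a b : Fin d) : ℝ :=
  ∑ c, curvature U G y c a c b

/-- The metric trace `J` of the Schouten tensor, that is `Scal / (2 (d - 1))`. -/
def schoutenTrace (U : Set (EuclideanSpace ℝ (Fin d)))
    (G : EuclideanSpace ℝ (Fin d) → Matrix (Fin d) (Fin d) ℝ)
    (y : EuclideanSpace ℝ (Fin d)) : ℝ :=
  (∑ a, ∑ b, (G y)⁻¹ a b * ricci U G y a b) / (2 * ((d : ℝ) - 1))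

/-- The Schouten tensor `P`, determined by `Ric = (d - 2) P + J g` (for `3 ≤ d`). -/
def schouten (U : Set (EuclideanSpace ℝ (Fin d)))
    (G : EuclideanSpace ℝ (Fin d) → Matrix (Fin d) (Fin d) ℝ)
    (y : EuclideanSpace ℝ (Fin d)) (a b : Fin d) : ℝ :=
  (ricci U G y a b - schoutenTrace U G y * G y a b) / ((d : ℝ) - 2)

end Coordinates

section Manifolds

variable {d : ℕ} {H : Type*} [TopologicalSpace H]
  (I : ModelWithCorners ℝ (EuclideanSpace ℝ (Fin d)) H)
  {M : Type*} [TopologicalSpace M] [ChartedSpace H M]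

/-- The coordinate vector field `∂/∂yⁱ` of the preferred chart at `p`, at the point with
coordinates `y`. -/
def coordVec (p : M) (y : EuclideanSpace ℝ (Fin d)) (i : Fin d) :
    TangentSpace I ((extChartAt I p).symm y) :=
  mfderivWithin 𝓘(ℝ, EuclideanSpace ℝ (Fin d)) I (extChartAt I p).symm (Set.range I) y
    (EuclideanSpace.single i (1 : ℝ) : EuclideanSpace ℝ (Fin d))

/-- Coefficients of `g` in the preferred chart at `p`. -/
def gram (g : ∀ x : M, TangentSpace I x → TangentSpace I x → ℝ) (p : M)
    (y : EuclideanSpace ℝ (Fin d)) : Matrix (Fin d) (Fin d) ℝ :=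
  Matrix.of fun i j => g _ (coordVec I p y i) (coordVec I p y j)

/-- `Ric(g) = c g` at the point `p`. -/
def IsEinsteinAt (g : ∀ x : M, TangentSpace I x → TangentSpace I x → ℝ) (c : ℝ) (p : M) : Prop :=
  ∀ a b, ricci (Set.range I) (gram I g p) (extChartAt I p p) a b
    = c * gram I g p (extChartAt I p p) a b

/-- All sectional curvatures of `g` at `p` equal `κ`, that is
`R_{abce} = κ (g_{ac} g_{be} - g_{bc} g_{ae})`. -/
def HasConstantCurvatureAt (g : ∀ x : M, TangentSpace I x → TangentSpace I x → ℝ) (κ : ℝ)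
    (p : M) : Prop :=
  ∀ a b c e, ∑ f, gram I g p (extChartAt I p p) c f *
      curvature (Set.range I) (gram I g p) (extChartAt I p p) a b f e
    = κ * (gram I g p (extChartAt I p p) a c * gram I g p (extChartAt I p p) b e
        - gram I g p (extChartAt I p p) b c * gram I g p (extChartAt I p p) a e)

/-- The triple `(σ, μ_a, ρ)`, which represents a section of the standard tractor bundle in the
scale `g`, is parallel for the normal tractor connection
`∇_a (σ, μ_b, ρ) = (∇_a σ - μ_a, ∇_a μ_b + g_{ab} ρ + P_{ab} σ, ∇_a ρ - P_{ac} μ^c)`. -/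
structure IsParallelTriple (g : ∀ x : M, TangentSpace I x → TangentSpace I x → ℝ)
    (σ : M → ℝ) (μ : ∀ x : M, TangentSpace I x → ℝ) (ρ : M → ℝ) : Prop where
  smooth_top : ContMDiff I 𝓘(ℝ, ℝ) ∞ σ
  smooth_bottom : ContMDiff I 𝓘(ℝ, ℝ) ∞ ρ
  top : ∀ p v, mvfderiv I σ p v - μ p v = 0
  middle : ∀ (p : M) (a b : Fin d),
    pd (Set.range I) (fun y => μ _ (coordVec I p y b)) (extChartAt I p p) a
      - ∑ k, christoffel (Set.range I) (gram I g p) (extChartAt I p p) k a b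
          * μ _ (coordVec I p (extChartAt I p p) k)
      + gram I g p (extChartAt I p p) a b * ρ p
      + schouten (Set.range I) (gram I g p) (extChartAt I p p) a b * σ p = 0
  bottom : ∀ (p : M) (a : Fin d),
    pd (Set.range I) (fun y => ρ ((extChartAt I p).symm y)) (extChartAt I p p) a
      - ∑ c, ∑ e, schouten (Set.range I) (gram I g p) (extChartAt I p p) a c
          * (gram I g p (extChartAt I p p))⁻¹ c e
          * μ _ (coordVec I p (extChartAt I p p) e) = 0

end Manifolds

section PoincareEinstein

variable {n : ℕ} {M : Type*} [TopologicalSpace M]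
  [ChartedSpace (EuclideanHalfSpace (n + 1)) M] [IsManifold (𝓡∂ (n + 1)) ∞ M]

/-- The rescaled tensor `x⁻² g`, of interest only where `x ≠ 0`. -/
def rescaled
    (g : Bundle.ContMDiffRiemannianMetric (𝓡∂ (n + 1)) ∞ (EuclideanSpace ℝ (Fin (n + 1)))
      (fun p : M => TangentSpace (𝓡∂ (n + 1)) p)) (x : M → ℝ) :
    ∀ p : M, TangentSpace (𝓡∂ (n + 1)) p → TangentSpace (𝓡∂ (n + 1)) p → ℝ :=
  fun p u v => (x p ^ 2)⁻¹ * g.inner p u v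

/-- `(M, g, x)` is a Poincaré–Einstein structure: `M` is a compact `(n+1)`-manifold with boundary,
`x` is a defining function for the boundary with `|dx|_g = 1` along it, and the interior metric
`g₊ = x⁻² g` satisfies `Ric(g₊) = - n g₊`. -/
structure IsPoincareEinstein
    (g : Bundle.ContMDiffRiemannianMetric (𝓡∂ (n + 1)) ∞ (EuclideanSpace ℝ (Fin (n + 1)))
      (fun p : M => TangentSpace (𝓡∂ (n + 1)) p)) (x : M → ℝ) : Prop where
  compact : CompactSpace M
  hausdorff : T2Space M
  smooth : ContMDiff (𝓡∂ (n + 1)) 𝓘(ℝ, ℝ) ∞ x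
  nonneg : ∀ p, 0 ≤ x p
  zero_iff : ∀ p, x p = 0 ↔ p ∈ (𝓡∂ (n + 1)).boundary M
  deriv_ne : ∀ p ∈ (𝓡∂ (n + 1)).boundary M, mvfderiv (𝓡∂ (n + 1)) x p ≠ 0
  unit_deriv : ∀ p ∈ (𝓡∂ (n + 1)).boundary M, ∃ w : TangentSpace (𝓡∂ (n + 1)) p,
    (∀ v, g.inner p w v = mvfderiv (𝓡∂ (n + 1)) x p v) ∧ mvfderiv (𝓡∂ (n + 1)) x p w = 1
  einstein : ∀ p ∈ (𝓡∂ (n + 1)).interior M,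
    IsEinsteinAt (𝓡∂ (n + 1)) (rescaled g x) (-(n : ℝ)) p

end PoincareEinstein

/-! ### Lorentzian vector spaces and their special orthogonal groups -/

/-- The standard form of signature `(m, 1)` on `ℝᵐ × ℝ`. -/
def minkowski (m : ℕ) : LinearMap.BilinForm ℝ (EuclideanSpace ℝ (Fin m) × ℝ) :=
  LinearMap.mk₂ ℝ (fun u v => inner ℝ u.1 v.1 - u.2 * v.2)
    (by intros; simp [inner_add_left]; ring)
    (by intros; simp [inner_smul_left]; ring)
    (by intros; simp [inner_add_right]; ring)
    (by intros; simp [inner_smul_right]; ring)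

/-- The standard forward null cone in `ℝᵐ × ℝ`. -/
def stdCone (m : ℕ) : Set (EuclideanSpace ℝ (Fin m) × ℝ) :=
  {w | minkowski m w w = 0 ∧ 0 < w.2}

/-- Hyperbolic `m`-space: the forward sheet of the hyperboloid `⟨w, w⟩ = -1` in `ℝᵐ × ℝ`. -/
def hyperboloid (m : ℕ) : Set (EuclideanSpace ℝ (Fin m) × ℝ) :=
  {w | minkowski m w w = -1 ∧ 0 < w.2}

section Groups

variable {V : Type*} [AddCommGroup V] [Module ℝ V]

/-- The special orthogonal group of a bilinear form. -/
def SO (B : LinearMap.BilinForm ℝ V) : Subgroup (V ≃ₗ[ℝ] V) where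
  carrier := {φ | (∀ u v, B (φ u) (φ v) = B u v) ∧ LinearEquiv.det φ = 1}
  mul_mem' := by
    rintro φ ψ ⟨h₁, h₂⟩ ⟨h₃, h₄⟩
    refine ⟨fun u v => ?_, by rw [map_mul, h₂, h₄, one_mul]⟩
    rw [LinearEquiv.mul_apply, LinearEquiv.mul_apply, h₁, h₃]
  one_mem' := ⟨fun _ _ => rfl, map_one _⟩
  inv_mem' := by
    rintro φ ⟨h₁, h₂⟩
    refine ⟨fun u v => ?_, by rw [map_inv, h₂, inv_one]⟩
    rw [← h₁ (φ⁻¹ u) (φ⁻¹ v), ← LinearEquiv.mul_apply, ← LinearEquiv.mul_apply, mul_inv_cancel]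
    rfl

/-- Linear automorphisms that map the set `N` onto itself. -/
def preserving (N : Set V) : Subgroup (V ≃ₗ[ℝ] V) where
  carrier := {φ | ∀ p, φ p ∈ N ↔ p ∈ N}
  mul_mem' := by
    intro φ ψ h₁ h₂ p
    rw [LinearEquiv.mul_apply, h₁, h₂]
  one_mem' := fun _ => Iff.rfl
  inv_mem' := by
    intro φ h p
    rw [← h (φ⁻¹ p), ← LinearEquiv.mul_apply, mul_inv_cancel]
    rfl

/-- Linear automorphisms that fix the covector `ξ`. -/
def fixing (ξ : Module.Dual ℝ V) : Subgroup (V ≃ₗ[ℝ] V) where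
  carrier := {φ | ∀ v, ξ (φ v) = ξ v}
  mul_mem' := by
    intro φ ψ h₁ h₂ v
    rw [LinearEquiv.mul_apply, h₁, h₂]
  one_mem' := fun _ => rfl
  inv_mem' := by
    intro φ h v
    rw [← h (φ⁻¹ v), ← LinearEquiv.mul_apply, mul_inv_cancel]
    rfl

end Groups

/-! ### The conformal sphere and its tractor bundle -/

/-- The sphere `Sᵐ`. -/
abbrev Sph (m : ℕ) : Type := Metric.sphere (0 : EuclideanSpace ℝ (Fin (m + 1))) 1

/-- The round metric of `Sᵐ`. -/
def roundMetric (m : ℕ) (x : Sph m) (u v : TangentSpace (𝓡 m) x) : ℝ :=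
  inner ℝ (mvfderiv (𝓡 m) ((↑) : Sph m → EuclideanSpace ℝ (Fin (m + 1))) x u)
    (mvfderiv (𝓡 m) ((↑) : Sph m → EuclideanSpace ℝ (Fin (m + 1))) x v)

/-- With `d = n + 1`, linear coordinates on `ℝ^{d+2}` in which the bilinear form `H` is the standard
one of signature `(d + 1, 1)`.  They exist if and only if `H` is symmetric of this signature; the
last coordinate also singles out the forward half of the null cone. -/
structure LorentzFrame (n : ℕ) (H : LinearMap.BilinForm ℝ (EuclideanSpace ℝ (Fin (n + 3)))) where
  toEquiv : EuclideanSpace ℝ (Fin (n + 3)) ≃ₗ[ℝ] EuclideanSpace ℝ (Fin (n + 2)) × ℝ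
  isometry : ∀ u v, H u v = minkowski (n + 2) (toEquiv u) (toEquiv v)

namespace LorentzFrame

variable {n : ℕ} {H : LinearMap.BilinForm ℝ (EuclideanSpace ℝ (Fin (n + 3)))}
  (L : LorentzFrame n H)

/-- The forward null cone `𝒩₊`. -/
def cone : Set (EuclideanSpace ℝ (Fin (n + 3))) :=
  {p | H p p = 0 ∧ 0 < (L.toEquiv p).2}

/-- The projection `π : 𝒩₊ → S^d`, `(w, t) ↦ w / t`, whose fibres are the rays of the cone. -/
def proj (p : L.cone) : Sph (n + 1) :=
  ⟨(L.toEquiv p).2⁻¹ • (L.toEquiv p).1, by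
    obtain ⟨p, h, ht⟩ := p
    have h' : ‖(L.toEquiv p).1‖ ^ 2 = (L.toEquiv p).2 ^ 2 := by
      have := h
      rw [L.isometry] at this
      simp only [minkowski, LinearMap.mk₂_apply, real_inner_self_eq_norm_sq] at this
      nlinarith
    have h2 : ‖(L.toEquiv p).1‖ = (L.toEquiv p).2 := by
      rwa [sq_eq_sq₀ (norm_nonneg _) ht.le] at h'
    rw [mem_sphere_zero_iff_norm, norm_smul, norm_inv, Real.norm_of_nonneg ht.le]
    change (L.toEquiv p).2⁻¹ * ‖(L.toEquiv p).1‖ = 1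
    rw [h2, inv_mul_cancel₀ ht.ne']⟩

/-- The point of the cone over `x` with last coordinate `1`. -/
def lift (x : Sph (n + 1)) : EuclideanSpace ℝ (Fin (n + 3)) :=
  L.toEquiv.symm ((x : EuclideanSpace ℝ (Fin (n + 2))), 1)

/-- A scale: a smooth section `s` of `π : 𝒩₊ → S^d`. -/
structure IsScale (s : Sph (n + 1) → EuclideanSpace ℝ (Fin (n + 3))) : Prop where
  smooth : ContMDiff (𝓡 (n + 1)) 𝓘(ℝ, EuclideanSpace ℝ (Fin (n + 3))) ∞ s
  section_proj : ∀ x, ∃ h : s x ∈ L.cone, L.proj ⟨s x, h⟩ = x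

/-- The metric on `S^d` that a scale `s` determines: `g(u, v) = H(u', v')`, where `u'`, `v'` are
the lifts of `u`, `v` to `s x` which are tangent to the image of `s`. -/
def scaleMetric (H : LinearMap.BilinForm ℝ (EuclideanSpace ℝ (Fin (n + 3))))
    (s : Sph (n + 1) → EuclideanSpace ℝ (Fin (n + 3)))
    (x : Sph (n + 1)) (u v : TangentSpace (𝓡 (n + 1)) x) : ℝ :=
  H (mvfderiv (𝓡 (n + 1)) s x u) (mvfderiv (𝓡 (n + 1)) s x v)

/-- The orbit relation of the action `t⁻¹ ρᵗ_*` of `ℝ₊` on `Tℝ^{d+2}` over the cone, where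
`ρᵗ(p) = t p` and `ρᵗ_* u = t u`. -/
def tractorSetoid : Setoid (L.cone × EuclideanSpace ℝ (Fin (n + 3))) where
  r a b := ∃ t : ℝ, 0 < t ∧ (b.1 : EuclideanSpace ℝ (Fin (n + 3))) = t • a.1 ∧
    b.2 = t⁻¹ • (t • a.2)
  iseqv := by
    refine ⟨fun a => ⟨1, one_pos, by simp, by simp⟩, ?_, ?_⟩
    · rintro a b ⟨t, ht, h₁, h₂⟩
      refine ⟨t⁻¹, inv_pos.2 ht, ?_, ?_⟩
      · rw [h₁, smul_smul, inv_mul_cancel₀ ht.ne', one_smul]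
      · rw [h₂]
        simp [smul_smul, ht.ne']
    · rintro a b c ⟨t, ht, h₁, h₂⟩ ⟨r, hr, h₃, h₄⟩
      refine ⟨r * t, mul_pos hr ht, ?_, ?_⟩
      · rw [h₃, h₁, smul_smul]
      · rw [h₄, h₂]
        rw [inv_smul_smul₀ hr.ne', inv_smul_smul₀ ht.ne', inv_smul_smul₀ (mul_pos hr ht).ne']

/-- The total space of the standard tractor bundle `𝒯` of the sphere. -/
def TractorBundle : Type := Quotient L.tractorSetoid

/-- The class in `𝒯` of the vector `u` at the point `p` of the cone. -/
def tractorMk (p : L.cone) (u : EuclideanSpace ℝ (Fin (n + 3))) : L.TractorBundle :=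
  Quotient.mk L.tractorSetoid (p, u)

/-- The bundle projection `𝒯 → S^d`. -/
def base : L.TractorBundle → Sph (n + 1) :=
  Quotient.lift (fun a : L.cone × EuclideanSpace ℝ (Fin (n + 3)) => L.proj a.1) (by
    rintro a b ⟨t, ht, h₁, -⟩
    apply Subtype.ext
    simp only [proj]
    rw [h₁, map_smul, Prod.smul_fst, Prod.smul_snd, smul_smul, smul_eq_mul, mul_inv, mul_assoc,
      mul_comm, mul_assoc, mul_inv_cancel₀ ht.ne', mul_one])

open scoped Classical in
/-- The vector field along the scale `s` that represents a section `S` of `𝒯`. -/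
def along (s : Sph (n + 1) → EuclideanSpace ℝ (Fin (n + 3))) (S : Sph (n + 1) → L.TractorBundle)
    (x : Sph (n + 1)) : EuclideanSpace ℝ (Fin (n + 3)) :=
  if h : ∃ (hs : s x ∈ L.cone) (u : EuclideanSpace ℝ (Fin (n + 3))),
    S x = L.tractorMk ⟨s x, hs⟩ u then h.choose_spec.choose else 0

/-- `S` is a smooth section of `𝒯`, and is parallel for the connection that the parallel transport
of `ℝ^{d+2}` induces: the representing vector field along any scale has zero derivative. -/
structure IsParallelSection (S : Sph (n + 1) → L.TractorBundle) : Prop where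
  isSection : ∀ x, L.base (S x) = x
  smooth : ∀ s, L.IsScale s →
    ContMDiff (𝓡 (n + 1)) 𝓘(ℝ, EuclideanSpace ℝ (Fin (n + 3))) ∞ (L.along s S)
  parallel : ∀ s, L.IsScale s → ∀ (x : Sph (n + 1)) (v : TangentSpace (𝓡 (n + 1)) x),
    mvfderiv (𝓡 (n + 1)) (L.along s S) x v = 0

/-- The cap `C`, where `σ = I_A X^A ≥ 0` (the sign of `σ` is constant along rays). -/
def cap (ξ : Module.Dual ℝ (EuclideanSpace ℝ (Fin (n + 3)))) : Set (Sph (n + 1)) :=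
  {x | 0 ≤ ξ (L.lift x)}

/-- The open cap `C₊`, where `σ > 0`. -/
def openCap (ξ : Module.Dual ℝ (EuclideanSpace ℝ (Fin (n + 3)))) : Set (Sph (n + 1)) :=
  {x | 0 < ξ (L.lift x)}

/-- The zero set `Σ` of `σ`. -/
def zeroSet (ξ : Module.Dual ℝ (EuclideanSpace ℝ (Fin (n + 3)))) : Set (Sph (n + 1)) :=
  {x | ξ (L.lift x) = 0}

end LorentzFrame

/-- `H⁻¹(ξ, ξ)`, the square length of a covector. -/
def covectorNormSq {n : ℕ} (H : LinearMap.BilinForm ℝ (EuclideanSpace ℝ (Fin (n + 3))))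
    (hH : H.Nondegenerate) (ξ : Module.Dual ℝ (EuclideanSpace ℝ (Fin (n + 3)))) : ℝ :=
  H ((H.toDual hH).symm ξ) ((H.toDual hH).symm ξ)

end PEModel

end

/-! Let `F` map an open set of `ℝ^d` into the null cone as an immersion, with induced metric `G`,
and let `Y` be the complementary null field: `H(Y,F) = 1` and `H(Y,∂ᵢF) = 0`. Then `F`, `Y`, `∂ᵢF`
frame the ambient space, and pairing with the frame gives the structure equations `∂ᵢ∂ⱼF = Γᵏᵢⱼ ∂ₖF
- Gᵢⱼ Y - Πᵢⱼ F` and `∂ᵢY = Πᵢᵏ ∂ₖF` (`IsNullLift.second_eq`, `IsNullLift.dirDeriv_normal_eq`). The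
ambient space is flat, so partial derivatives commute, and comparing third derivatives expresses the
curvature of `G` through `G` and `Π` (`IsNullLift.curvature_eq`). Its trace is `Ric = (d-2) Π + (tr
Π) G`, hence `Π` is the Schouten tensor once `d ≥ 3`. A constant covector applied to the structure
equations gives exactly the equations of a parallel tractor triple.

The Poincaré–Einstein metric is read off the section of the cone on which `σ = 1`. With `I` now
denoting the vector dual to the covector, `Y = I - F/2` on that section, because `H(I,I) = H(I,F) =
1`. As `I` is constant, `∂Y = -∂F/2`, so `Π = -G/2`, and the Gauss equation yields curvature `-1`
and `Ric = -(d-1) G = -n G`. Rescaling a section `F` of the cone by a function `a` multiplies its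
metric by `a²`, since `H(F,F) = H(F,∂F) = 0`. The section with `σ = 1` is `σ⁻¹ s` for every scale
`s`, so its metric is `σ⁻² g_s`, whatever `s` is.

The global statements come from a Lorentz frame adapted to the covector: a rotation and a boost,
both preserving the forward cone, make `σ` the first coordinate (`exists_isAdapted`). Stereographic
projection in such a frame displays the cone as a paraboloid with flat induced metric and `σ` as the
coordinate `y 0`. The cap becomes a half-space, smooth up to its boundary, and `g₊` becomes `|dy|² /
(y 0)²`. Dropping the first coordinate maps the section `σ = 1` isometrically onto the hyperboloid.
Comparing the spheres of rays in the two frames gives the conformal map onto the hemisphere. The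
isotropy group is block diagonal in adapted coordinates, and its orthochronous part is transitive
because products of two timelike reflections are transitive on the hyperboloid. -/

namespace PEModel

/-! ### Directional derivatives of vector-valued functions -/

section DirDeriv

variable {d : ℕ} {W : Type*} [NormedAddCommGroup W] [NormedSpace ℝ W]

/-- The partial derivative `∂ᵢ f` at `y` of a vector-valued function. -/
noncomputable def dirDeriv (f : EuclideanSpace ℝ (Fin d) → W) (y : EuclideanSpace ℝ (Fin d))
    (i : Fin d) : W :=
  fderiv ℝ f y (EuclideanSpace.single i 1)

lemma dirDeriv_congr {f g : EuclideanSpace ℝ (Fin d) → W} {O : Set (EuclideanSpace ℝ (Fin d))}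
    (hO : IsOpen O) (h : ∀ y ∈ O, f y = g y) {y : EuclideanSpace ℝ (Fin d)} (hy : y ∈ O)
    (i : Fin d) : dirDeriv f y i = dirDeriv g y i := by
  have : f =ᶠ[nhds y] g := Filter.eventually_of_mem (hO.mem_nhds hy) h
  rw [dirDeriv, dirDeriv, this.fderiv_eq]

lemma dirDeriv_const (c : W) (y : EuclideanSpace ℝ (Fin d)) (i : Fin d) :
    dirDeriv (fun _ => c) y i = 0 := by
  simp [dirDeriv]

lemma dirDeriv_sub {f g : EuclideanSpace ℝ (Fin d) → W} {y : EuclideanSpace ℝ (Fin d)}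
    (hf : DifferentiableAt ℝ f y) (hg : DifferentiableAt ℝ g y) (i : Fin d) :
    dirDeriv (fun z => f z - g z) y i = dirDeriv f y i - dirDeriv g y i := by
  simp [dirDeriv, fderiv_fun_sub hf hg]

lemma dirDeriv_smul {a : EuclideanSpace ℝ (Fin d) → ℝ} {f : EuclideanSpace ℝ (Fin d) → W}
    {y : EuclideanSpace ℝ (Fin d)} (ha : DifferentiableAt ℝ a y) (hf : DifferentiableAt ℝ f y)
    (i : Fin d) :
    dirDeriv (fun z => a z • f z) y i = dirDeriv a y i • f y + a y • dirDeriv f y i := by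
  simp [dirDeriv, fderiv_fun_smul ha hf, add_comm]

lemma dirDeriv_sum {ι : Type*} {u : Finset ι} {f : ι → EuclideanSpace ℝ (Fin d) → W}
    {y : EuclideanSpace ℝ (Fin d)} (hf : ∀ k ∈ u, DifferentiableAt ℝ (f k) y) (i : Fin d) :
    dirDeriv (fun z => ∑ k ∈ u, f k z) y i = ∑ k ∈ u, dirDeriv (f k) y i := by
  simp [dirDeriv, fderiv_fun_sum hf]

lemma dirDeriv_bilin [FiniteDimensional ℝ W] (H : LinearMap.BilinForm ℝ W)
    {f g : EuclideanSpace ℝ (Fin d) → W} {y : EuclideanSpace ℝ (Fin d)}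
    (hf : DifferentiableAt ℝ f y) (hg : DifferentiableAt ℝ g y) (i : Fin d) :
    dirDeriv (fun z => H (f z) (g z)) y i = H (dirDeriv f y i) (g y) + H (f y) (dirDeriv g y i) := by
  have := (H.toContinuousBilinearMap).hasFDerivAt_of_bilinear hf.hasFDerivAt hg.hasFDerivAt
  simp only [LinearMap.toContinuousBilinearMap_apply] at this
  simp [dirDeriv, this.fderiv, add_comm]

lemma dirDeriv_linear [FiniteDimensional ℝ W] (ξ : Module.Dual ℝ W)
    {f : EuclideanSpace ℝ (Fin d) → W} {y : EuclideanSpace ℝ (Fin d)}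
    (hf : DifferentiableAt ℝ f y) (i : Fin d) :
    dirDeriv (fun z => ξ (f z)) y i = ξ (dirDeriv f y i) := by
  have := (LinearMap.toContinuousLinearMap ξ).hasFDerivAt.comp y hf.hasFDerivAt
  have h2 : (fun z => ξ (f z)) = (LinearMap.toContinuousLinearMap ξ) ∘ f := rfl
  rw [dirDeriv, h2, this.fderiv]
  rfl

lemma dirDeriv_contDiffOn {f : EuclideanSpace ℝ (Fin d) → W} {O : Set (EuclideanSpace ℝ (Fin d))}
    (hO : IsOpen O) (hf : ContDiffOn ℝ ∞ f O) (i : Fin d) :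
    ContDiffOn ℝ ∞ (fun y => dirDeriv f y i) O :=
  (hf.fderiv_of_isOpen hO (by simp)).clm_apply contDiffOn_const

lemma differentiableAt_of_contDiffOn {f : EuclideanSpace ℝ (Fin d) → W}
    {O : Set (EuclideanSpace ℝ (Fin d))} (hO : IsOpen O) (hf : ContDiffOn ℝ ∞ f O)
    {y : EuclideanSpace ℝ (Fin d)} (hy : y ∈ O) : DifferentiableAt ℝ f y :=
  (hf.contDiffAt (hO.mem_nhds hy)).differentiableAt (by simp)

lemma dirDeriv_comm {f : EuclideanSpace ℝ (Fin d) → W} {O : Set (EuclideanSpace ℝ (Fin d))}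
    (hO : IsOpen O) (hf : ContDiffOn ℝ ∞ f O) {y : EuclideanSpace ℝ (Fin d)} (hy : y ∈ O)
    (i j : Fin d) :
    dirDeriv (fun z => dirDeriv f z j) y i = dirDeriv (fun z => dirDeriv f z i) y j := by
  have h := (hf.contDiffAt (hO.mem_nhds hy)).isSymmSndFDerivAt
    (by rw [minSmoothness_of_isRCLikeNormedField]; exact WithTop.coe_le_coe.2 le_top)
  have hd : DifferentiableAt ℝ (fderiv ℝ f) y :=
    differentiableAt_of_contDiffOn hO (hf.fderiv_of_isOpen hO (by simp)) hy
  have key : ∀ i j : Fin d, dirDeriv (fun z => dirDeriv f z j) y i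
      = fderiv ℝ (fderiv ℝ f) y (EuclideanSpace.single i 1) (EuclideanSpace.single j 1) := by
    intro i j
    simp only [dirDeriv]
    rw [fderiv_clm_apply hd (by fun_prop)]
    simp
  rw [key, key]
  exact h _ _

lemma pd_eq_dirDeriv {U O : Set (EuclideanSpace ℝ (Fin d))} (hO : IsOpen O) (hU : O ⊆ U)
    {f g : EuclideanSpace ℝ (Fin d) → ℝ} (h : ∀ y ∈ O, f y = g y)
    {y : EuclideanSpace ℝ (Fin d)} (hy : y ∈ O) (i : Fin d) : pd U f y i = dirDeriv g y i := by
  rw [pd, fderivWithin_of_mem_nhds (Filter.mem_of_superset (hO.mem_nhds hy) hU)]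
  exact dirDeriv_congr hO h hy i

lemma contDiffOn_bilin [FiniteDimensional ℝ W] (H : LinearMap.BilinForm ℝ W)
    {f g : EuclideanSpace ℝ (Fin d) → W} {O : Set (EuclideanSpace ℝ (Fin d))}
    (hf : ContDiffOn ℝ ∞ f O) (hg : ContDiffOn ℝ ∞ g O) :
    ContDiffOn ℝ ∞ (fun z => H (f z) (g z)) O :=
  (H.toContinuousBilinearMap.isBoundedBilinearMap.contDiff (n := ∞)).comp_contDiffOn (hf.prodMk hg)

/-- Cramer's rule: entries of the inverse are quotients of determinants, and these are polynomials
in the entries. -/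
lemma contDiffOn_matrix_inv {G : EuclideanSpace ℝ (Fin d) → Matrix (Fin d) (Fin d) ℝ}
    {O : Set (EuclideanSpace ℝ (Fin d))} (hG : ∀ i j, ContDiffOn ℝ ∞ (fun z => G z i j) O)
    (hu : ∀ z ∈ O, IsUnit (G z).det) (i j : Fin d) :
    ContDiffOn ℝ ∞ (fun z => (G z)⁻¹ i j) O := by
  have hdet : ∀ A : EuclideanSpace ℝ (Fin d) → Matrix (Fin d) (Fin d) ℝ,
      (∀ i j, ContDiffOn ℝ ∞ (fun z => A z i j) O) → ContDiffOn ℝ ∞ (fun z => (A z).det) O := by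
    intro A hA
    simp only [Matrix.det_apply']
    exact ContDiffOn.sum fun σ _ => contDiffOn_const.mul (contDiffOn_prod fun i _ => hA _ _)
  have : ∀ z, (G z)⁻¹ i j = (G z).det⁻¹ * ((G z).updateRow j (Pi.single i 1)).det := by
    intro z
    simp [Matrix.inv_def, Matrix.adjugate_apply]
  simp only [this]
  refine ContDiffOn.mul ((hdet _ hG).inv fun z hz => (hu z hz).ne_zero) (hdet _ fun k l => ?_)
  by_cases hk : k = j
  · subst hk
    simpa using contDiffOn_const
  · simpa [Matrix.updateRow_ne hk] using hG k l

end DirDeriv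

/-! ### Immersions into the null cone -/

section NullLift

variable {d : ℕ} {V : Type*} [NormedAddCommGroup V] [NormedSpace ℝ V] [FiniteDimensional ℝ V]

/-- An immersion `F` of the open set `O` into the null cone of `H`, together with the
complementary null field `Y` along `F`; the induced metric is `G`. -/
structure IsNullLift (H : LinearMap.BilinForm ℝ V) (O : Set (EuclideanSpace ℝ (Fin d)))
    (G : EuclideanSpace ℝ (Fin d) → Matrix (Fin d) (Fin d) ℝ)
    (F Y : EuclideanSpace ℝ (Fin d) → V) : Prop where
  symm : ∀ u v, H u v = H v u
  finrank : Module.finrank ℝ V = d + 2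
  isOpen : IsOpen O
  smooth : ContDiffOn ℝ ∞ F O
  smooth' : ContDiffOn ℝ ∞ Y O
  null : ∀ y ∈ O, H (F y) (F y) = 0
  null' : ∀ y ∈ O, H (Y y) (Y y) = 0
  pairing : ∀ y ∈ O, H (Y y) (F y) = 1
  normal : ∀ y ∈ O, ∀ i, H (Y y) (dirDeriv F y i) = 0
  metric : ∀ y ∈ O, ∀ i j, G y i j = H (dirDeriv F y i) (dirDeriv F y j)
  isUnit_det : ∀ y ∈ O, IsUnit (G y).det

namespace IsNullLift

variable {H : LinearMap.BilinForm ℝ V} {O : Set (EuclideanSpace ℝ (Fin d))}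
  {G : EuclideanSpace ℝ (Fin d) → Matrix (Fin d) (Fin d) ℝ}
  {F Y : EuclideanSpace ℝ (Fin d) → V} (h : IsNullLift H O G F Y)
  {y : EuclideanSpace ℝ (Fin d)} (hy : y ∈ O)

include h

section Pointwise

include hy

omit [FiniteDimensional ℝ V] in
lemma diff : DifferentiableAt ℝ F y := differentiableAt_of_contDiffOn h.isOpen h.smooth hy

omit [FiniteDimensional ℝ V] in
lemma diff' : DifferentiableAt ℝ Y y := differentiableAt_of_contDiffOn h.isOpen h.smooth' hy

omit [FiniteDimensional ℝ V] in
lemma diff_dirDeriv (i : Fin d) : DifferentiableAt ℝ (fun z => dirDeriv F z i) y :=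
  differentiableAt_of_contDiffOn h.isOpen (dirDeriv_contDiffOn h.isOpen h.smooth i) hy

/-- This and the next three relations come from differentiating the constant products `H(F,F)`,
`H(Y,Y)`, `H(Y,F)` and `H(∂ⱼF,F)`. -/
lemma dirDeriv_null (i : Fin d) : H (dirDeriv F y i) (F y) = 0 := by
  have h1 := dirDeriv_bilin H (h.diff hy) (h.diff hy) i
  rw [dirDeriv_congr h.isOpen h.null hy, dirDeriv_const, h.symm (F y)] at h1
  linarith

lemma dirDeriv_null' (i : Fin d) : H (dirDeriv Y y i) (Y y) = 0 := by
  have h1 := dirDeriv_bilin H (h.diff' hy) (h.diff' hy) i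
  rw [dirDeriv_congr h.isOpen h.null' hy, dirDeriv_const, h.symm (Y y)] at h1
  linarith

lemma dirDeriv_pairing (i : Fin d) : H (dirDeriv Y y i) (F y) = 0 := by
  have h1 := dirDeriv_bilin H (h.diff' hy) (h.diff hy) i
  rw [dirDeriv_congr h.isOpen h.pairing hy, dirDeriv_const, h.normal y hy] at h1
  linarith

lemma second_null (i j : Fin d) : H (dirDeriv (fun z => dirDeriv F z j) y i) (F y) = -G y i j := by
  have h1 := dirDeriv_bilin H (h.diff_dirDeriv hy j) (h.diff hy) i
  rw [dirDeriv_congr h.isOpen (fun z hz => h.dirDeriv_null hz j) hy, dirDeriv_const,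
    h.symm (dirDeriv F y j) (dirDeriv F y i), ← h.metric y hy] at h1
  linarith

omit [FiniteDimensional ℝ V] in
lemma second_comm (i j : Fin d) :
    dirDeriv (fun z => dirDeriv F z j) y i = dirDeriv (fun z => dirDeriv F z i) y j :=
  dirDeriv_comm h.isOpen h.smooth hy i j

omit [FiniteDimensional ℝ V] in
lemma metric_symm (i j : Fin d) : G y i j = G y j i := by
  rw [h.metric y hy, h.metric y hy, h.symm]

omit [FiniteDimensional ℝ V] in
lemma inv_mul_apply (i j : Fin d) :
    ∑ k, (G y)⁻¹ i k * G y k j = if i = j then 1 else 0 := by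
  rw [← Matrix.mul_apply, Matrix.nonsing_inv_mul _ (h.isUnit_det y hy), Matrix.one_apply]

omit [FiniteDimensional ℝ V] in
lemma mul_inv_apply (i j : Fin d) :
    ∑ k, G y i k * (G y)⁻¹ k j = if i = j then 1 else 0 := by
  rw [← Matrix.mul_apply, Matrix.mul_nonsing_inv _ (h.isUnit_det y hy), Matrix.one_apply]

omit [FiniteDimensional ℝ V] in
lemma sum_inv_mul : ∑ i, ∑ j, (G y)⁻¹ i j * G y i j = d := by
  have : ∀ i, ∑ j, (G y)⁻¹ i j * G y i j = 1 := fun i => by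
    have := h.inv_mul_apply hy i i
    rw [if_pos rfl] at this
    rw [← this]
    exact Finset.sum_congr rfl fun m _ => by rw [h.metric_symm hy i m]
  simp [this]

/-- Pairing with the frame `F`, `Y`, `∂ᵢF` is a linear map onto a space of dimension `d + 2`, so it
is injective by dimension count. The nondegeneracy of `H` is not assumed. All vector identities
below are proved by testing against this frame. -/
lemma eq_zero_of_orthogonal {w : V} (h1 : H w (F y) = 0) (h2 : H w (Y y) = 0)
    (h3 : ∀ i, H w (dirDeriv F y i) = 0) : w = 0 := by
  let Λ : V →ₗ[ℝ] ℝ × ℝ × (Fin d → ℝ) :=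
    ((H.flip (F y)).prod ((H.flip (Y y)).prod (LinearMap.pi fun i => H.flip (dirDeriv F y i))))
  have hrank : Module.finrank ℝ V = Module.finrank ℝ (ℝ × ℝ × (Fin d → ℝ)) := by
    simp [h.finrank]; ring
  have hsurj : Function.Surjective Λ := by
    rintro ⟨a, b, c⟩
    -- `F` and `Y` are null and dual to each other, so the product prescribed with one is the
    -- coefficient of the other; `G⁻¹` raises the index of `c`.
    refine ⟨b • F y + a • Y y + ∑ i, (∑ j, (G y)⁻¹ i j * c j) • dirDeriv F y i, ?_⟩
    refine Prod.ext ?_ (Prod.ext ?_ (funext fun k => ?_))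
    · simp [Λ, h.null y hy, h.pairing y hy, h.dirDeriv_null hy]
    · simp [Λ, h.null' y hy, h.symm (F y) (Y y), h.pairing y hy, h.symm _ (Y y), h.normal y hy]
    · change H (b • F y + a • Y y + ∑ i, (∑ j, (G y)⁻¹ i j * c j) • dirDeriv F y i)
        (dirDeriv F y k) = c k
      simp only [map_add, map_sum, map_smul, LinearMap.add_apply, LinearMap.smul_apply, smul_eq_mul,
        LinearMap.sum_apply, h.normal y hy, h.symm (F y), h.dirDeriv_null hy, ← h.metric y hy]
      simp only [mul_zero, zero_add, Finset.sum_mul]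
      rw [Finset.sum_comm]
      have : ∀ j, ∑ i, (G y)⁻¹ i j * c j * G y i k = c j * ∑ i, G y k i * (G y)⁻¹ i j := by
        intro j
        rw [Finset.mul_sum]
        exact Finset.sum_congr rfl fun i _ => by rw [h.metric_symm hy k i]; ring
      simp only [this, h.mul_inv_apply hy]
      simp
  have hinj := (LinearMap.injective_iff_surjective_of_finrank_eq_finrank hrank).2 hsurj
  apply hinj
  rw [map_zero]
  exact Prod.ext h1 (Prod.ext h2 (funext h3))

end Pointwise

variable {U : Set (EuclideanSpace ℝ (Fin d))} (hU : O ⊆ U)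

include hU hy in
-- Each derivative of `G` is a sum of two second-derivative terms. In the Christoffel combination
-- all but two equal ones cancel, by symmetry of `∂ᵢ∂ⱼF`.
lemma christoffel_eq (k i j : Fin d) : christoffel U G y k i j
    = ∑ l, (G y)⁻¹ k l * H (dirDeriv (fun z => dirDeriv F z j) y i) (dirDeriv F y l) := by
  have key : ∀ i j l, pd U (fun z => G z j l) y i
      = H (dirDeriv (fun z => dirDeriv F z j) y i) (dirDeriv F y l)
        + H (dirDeriv F y j) (dirDeriv (fun z => dirDeriv F z l) y i) := fun i j l => by
    rw [pd_eq_dirDeriv h.isOpen hU (fun z hz => h.metric z hz j l) hy,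
      dirDeriv_bilin H (h.diff_dirDeriv hy j) (h.diff_dirDeriv hy l)]
  rw [christoffel, Finset.mul_sum]
  refine Finset.sum_congr rfl fun l _ => ?_
  rw [key, key, key, h.second_comm hy j i, h.second_comm hy l i, h.second_comm hy l j,
    h.symm (dirDeriv F y j), h.symm (dirDeriv F y i)]
  ring

/-- The tensor `Πᵢⱼ = -H(∂ᵢ∂ⱼF, Y)`. -/
noncomputable def secondForm (_ : IsNullLift H O G F Y) (z : EuclideanSpace ℝ (Fin d))
    (i j : Fin d) : ℝ :=
  -H (dirDeriv (fun z => dirDeriv F z j) z i) (Y z)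

include hy in
-- Differentiate `H(Y,∂ⱼF) = 0`.
lemma secondForm_eq (i j : Fin d) :
    h.secondForm y i j = H (dirDeriv Y y i) (dirDeriv F y j) := by
  have h1 := dirDeriv_bilin H (h.diff' hy) (h.diff_dirDeriv hy j) i
  rw [dirDeriv_congr h.isOpen (fun z hz => h.normal z hz j) hy, dirDeriv_const,
    h.symm (Y y)] at h1
  rw [secondForm]
  linarith

include hy in
-- The Gauss formula. The pairing with `F` determines the coefficient of `Y`, the pairing with `Y`
-- that of `F`, and the tangential part is the Levi-Civita connection of `G`.
lemma second_eq (hU : O ⊆ U) (i j : Fin d) : dirDeriv (fun z => dirDeriv F z j) y i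
    = ∑ k, christoffel U G y k i j • dirDeriv F y k - G y i j • Y y
      - h.secondForm y i j • F y := by
  rw [← sub_eq_zero]
  apply h.eq_zero_of_orthogonal hy
  · simp [h.second_null hy, h.dirDeriv_null hy, h.pairing y hy, h.null y hy]
  · simp [secondForm, h.null' y hy, h.symm _ (Y y), h.normal y hy, h.pairing y hy]
  · intro m
    simp only [map_sub, map_sum, map_smul, LinearMap.sub_apply, LinearMap.sum_apply,
      LinearMap.smul_apply, smul_eq_mul, h.normal y hy, h.symm (F y), h.dirDeriv_null hy,
      ← h.metric y hy, h.christoffel_eq hy hU, Finset.sum_mul]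
    rw [Finset.sum_comm]
    have : ∀ l, ∑ k, (G y)⁻¹ k l * H (dirDeriv (fun z => dirDeriv F z j) y i) (dirDeriv F y l)
          * G y k m
        = H (dirDeriv (fun z => dirDeriv F z j) y i) (dirDeriv F y l)
          * ∑ k, G y m k * (G y)⁻¹ k l := by
      intro l
      rw [Finset.mul_sum]
      exact Finset.sum_congr rfl fun k _ => by rw [h.metric_symm hy m k]; ring
    simp only [this, h.mul_inv_apply hy]
    simp

include hy in
-- The Weingarten formula. There is no component along `F` or `Y`, because `H(Y,Y)` and `H(Y,F)` are
-- constant.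
lemma dirDeriv_normal_eq (i : Fin d) : dirDeriv Y y i
    = ∑ k, (∑ l, h.secondForm y i l * (G y)⁻¹ l k) • dirDeriv F y k := by
  rw [← sub_eq_zero]
  apply h.eq_zero_of_orthogonal hy
  · simp [h.dirDeriv_pairing hy, h.dirDeriv_null hy]
  · simp [h.dirDeriv_null' hy, h.symm _ (Y y), h.normal y hy]
  · intro m
    simp only [map_sub, map_sum, map_smul, LinearMap.sub_apply, LinearMap.sum_apply,
      LinearMap.smul_apply, smul_eq_mul, ← h.metric y hy, ← h.secondForm_eq hy, Finset.sum_mul]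
    rw [Finset.sum_comm]
    simp only [mul_assoc, ← Finset.mul_sum, h.inv_mul_apply hy]
    simp

lemma contDiffOn_metric (i j : Fin d) : ContDiffOn ℝ ∞ (fun z => G z i j) O :=
  (contDiffOn_bilin H (dirDeriv_contDiffOn h.isOpen h.smooth i)
    (dirDeriv_contDiffOn h.isOpen h.smooth j)).congr fun z hz => h.metric z hz i j

lemma contDiffOn_inv (i j : Fin d) : ContDiffOn ℝ ∞ (fun z => (G z)⁻¹ i j) O :=
  contDiffOn_matrix_inv h.contDiffOn_metric h.isUnit_det i j

include hU in
lemma contDiffOn_christoffel (k i j : Fin d) :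
    ContDiffOn ℝ ∞ (fun z => christoffel U G z k i j) O := by
  refine ContDiffOn.congr ?_ fun z hz => h.christoffel_eq hz hU k i j
  refine ContDiffOn.sum fun l _ => (h.contDiffOn_inv k l).mul ?_
  exact contDiffOn_bilin H
    (dirDeriv_contDiffOn h.isOpen (dirDeriv_contDiffOn h.isOpen h.smooth j) i)
    (dirDeriv_contDiffOn h.isOpen h.smooth l)

lemma contDiffOn_secondForm (i j : Fin d) : ContDiffOn ℝ ∞ (fun z => h.secondForm z i j) O := by
  refine ContDiffOn.neg ?_
  exact contDiffOn_bilin H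
    (dirDeriv_contDiffOn h.isOpen (dirDeriv_contDiffOn h.isOpen h.smooth j) i) h.smooth'

include hU hy in
lemma sum_metric_christoffel (i j m : Fin d) : ∑ k, G y m k * christoffel U G y k i j
    = H (dirDeriv (fun z => dirDeriv F z j) y i) (dirDeriv F y m) := by
  rw [h.second_eq hy hU]
  simp only [map_sub, map_sum, map_smul, LinearMap.sub_apply, LinearMap.sum_apply,
    LinearMap.smul_apply, smul_eq_mul, h.normal y hy, h.symm (F y), h.dirDeriv_null hy,
    ← h.metric y hy]
  simp only [mul_zero, sub_zero]
  exact Finset.sum_congr rfl fun k _ => by rw [h.metric_symm hy m k]; ring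

include hU hy in
-- Differentiate the Gauss formula once more and keep the tangential part. Terms containing `F` or
-- `Y` undifferentiated drop out; `∂Y` contributes `Π` and `∂F` contributes `G`. The part skew in
-- `a`, `b` is the curvature.
lemma third_eq (a b e m : Fin d) :
    H (dirDeriv (fun z => dirDeriv (fun z => dirDeriv F z e) z b) y a) (dirDeriv F y m)
      = ∑ k, G y m k * pd U (fun z => christoffel U G z k b e) y a
        + ∑ k, G y m k * ∑ f, christoffel U G y k a f * christoffel U G y f b e
        - G y b e * h.secondForm y a m - h.secondForm y b e * G y a m := by
  have hdΓ : ∀ k, DifferentiableAt ℝ (fun z => christoffel U G z k b e) y := fun k =>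
    differentiableAt_of_contDiffOn h.isOpen (h.contDiffOn_christoffel hU k b e) hy
  have hdG : DifferentiableAt ℝ (fun z => G z b e) y :=
    differentiableAt_of_contDiffOn h.isOpen (h.contDiffOn_metric b e) hy
  have hdP : DifferentiableAt ℝ (fun z => h.secondForm z b e) y :=
    differentiableAt_of_contDiffOn h.isOpen (h.contDiffOn_secondForm b e) hy
  have hsum : ∀ k ∈ Finset.univ, DifferentiableAt ℝ
      (fun z => christoffel U G z k b e • dirDeriv F z k) y := fun k _ =>
    (hdΓ k).smul (h.diff_dirDeriv hy k)
  rw [dirDeriv_congr h.isOpen (fun z hz => h.second_eq hz hU b e) hy,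
    dirDeriv_sub ((DifferentiableAt.fun_sum hsum).fun_sub (hdG.fun_smul (h.diff' hy)))
      (hdP.fun_smul (h.diff hy)),
    dirDeriv_sub (DifferentiableAt.fun_sum hsum) (hdG.fun_smul (h.diff' hy)), dirDeriv_sum hsum,
    dirDeriv_smul hdG (h.diff' hy), dirDeriv_smul hdP (h.diff hy)]
  simp only [fun k => dirDeriv_smul (hdΓ k) (h.diff_dirDeriv hy k)]
  simp only [map_sub, map_add, map_sum, map_smul, LinearMap.sub_apply, LinearMap.sum_apply,
    LinearMap.add_apply, LinearMap.smul_apply, smul_eq_mul, h.normal y hy, h.symm (F y),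
    h.dirDeriv_null hy, ← h.metric y hy, ← h.secondForm_eq hy,
    ← h.sum_metric_christoffel hy hU]
  have hpd : ∀ k, pd U (fun z => christoffel U G z k b e) y a
      = dirDeriv (fun z => christoffel U G z k b e) y a := fun k =>
    pd_eq_dirDeriv h.isOpen hU (fun _ _ => rfl) hy a
  have hswap : ∑ k, G y m k * ∑ f, christoffel U G y k a f * christoffel U G y f b e
      = ∑ k, christoffel U G y k b e * ∑ l, G y m l * christoffel U G y l a k := by
    simp only [Finset.mul_sum]
    rw [Finset.sum_comm]
    exact Finset.sum_congr rfl fun k _ => Finset.sum_congr rfl fun l _ => by ring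
  rw [hswap, Finset.sum_add_distrib]
  simp only [hpd, mul_zero, zero_add]
  have : ∀ k, dirDeriv (fun z => christoffel U G z k b e) y a * G y k m
      = G y m k * dirDeriv (fun z => christoffel U G z k b e) y a := fun k => by
    rw [h.metric_symm hy m k]; ring
  simp only [this]

include hU hy in
/-- The Gauss equation. -/
lemma curvature_eq (a b m e : Fin d) : ∑ c, G y m c * curvature U G y a b c e
    = G y b e * h.secondForm y a m + h.secondForm y b e * G y a m
      - G y a e * h.secondForm y b m - h.secondForm y a e * G y b m := by
  have h1 := h.third_eq hy hU a b e m
  have h2 := h.third_eq hy hU b a e m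
  -- Flatness of the ambient space enters here: `∂ₐ` and `∂_b` commute on `∂ₑF`, so the two
  -- expansions agree.
  rw [dirDeriv_comm h.isOpen (dirDeriv_contDiffOn h.isOpen h.smooth e) hy, h2] at h1
  simp only [curvature, mul_add, mul_sub, Finset.sum_add_distrib, Finset.sum_sub_distrib]
  linarith

include hU hy in
lemma curvature_up_eq (a b c e : Fin d) : curvature U G y a b c e
    = ∑ m, (G y)⁻¹ c m * (G y b e * h.secondForm y a m + h.secondForm y b e * G y a m
      - G y a e * h.secondForm y b m - h.secondForm y a e * G y b m) := by
  simp only [← h.curvature_eq hy hU, Finset.mul_sum]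
  rw [Finset.sum_comm]
  simp only [← mul_assoc, ← Finset.sum_mul, h.inv_mul_apply hy]
  simp

include hU hy in
-- The four terms of the Gauss equation have traces `(tr Π) G`, `d Π`, `-Π` and `-Π`.
lemma ricci_eq (a b : Fin d) : ricci U G y a b
    = ((d : ℝ) - 2) * h.secondForm y a b
      + (∑ i, ∑ j, (G y)⁻¹ i j * h.secondForm y i j) * G y a b := by
  have hG : ∀ c b, ∑ m, (G y)⁻¹ c m * G y b m = if c = b then 1 else 0 := fun c b => by
    rw [← h.inv_mul_apply hy]
    exact Finset.sum_congr rfl fun m _ => by rw [h.metric_symm hy b m]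
  have hsplit : ∀ c, curvature U G y c a c b
      = (∑ m, (G y)⁻¹ c m * h.secondForm y c m) * G y a b
        + h.secondForm y a b * (∑ m, (G y)⁻¹ c m * G y c m)
        - (∑ m, (G y)⁻¹ c m * h.secondForm y a m) * G y c b
        - h.secondForm y c b * (∑ m, (G y)⁻¹ c m * G y a m) := by
    intro c
    rw [h.curvature_up_eq hy hU]
    simp only [Finset.sum_mul, Finset.mul_sum, ← Finset.sum_add_distrib, ← Finset.sum_sub_distrib]
    exact Finset.sum_congr rfl fun m _ => by ring
  have h3 : ∑ c, (∑ m, (G y)⁻¹ c m * h.secondForm y a m) * G y c b = h.secondForm y a b := by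
    simp only [Finset.sum_mul]
    rw [Finset.sum_comm]
    have : ∀ m, ∑ c, (G y)⁻¹ c m * h.secondForm y a m * G y c b
        = h.secondForm y a m * ∑ c, G y b c * (G y)⁻¹ c m := by
      intro m
      rw [Finset.mul_sum]
      exact Finset.sum_congr rfl fun c _ => by rw [h.metric_symm hy b c]; ring
    simp only [this, h.mul_inv_apply hy]
    simp
  rw [ricci]
  simp only [hsplit, Finset.sum_add_distrib, Finset.sum_sub_distrib]
  rw [h3]
  simp only [hG, ← Finset.sum_mul]
  simp
  ring

include hU hy in
-- The trace of `ricci_eq` is `(d - 2) tr Π + d tr Π = 2 (d - 1) tr Π`.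
lemma schoutenTrace_eq (hd : 2 ≤ d) : schoutenTrace U G y
    = ∑ i, ∑ j, (G y)⁻¹ i j * h.secondForm y i j := by
  have hd' : (2 : ℝ) ≤ d := by exact_mod_cast hd
  have hG := h.sum_inv_mul hy
  have : ∑ a, ∑ b, (G y)⁻¹ a b * ricci U G y a b
      = 2 * ((d : ℝ) - 1) * ∑ i, ∑ j, (G y)⁻¹ i j * h.secondForm y i j := by
    have h1 : ∀ a b, (G y)⁻¹ a b * ricci U G y a b
        = ((d : ℝ) - 2) * ((G y)⁻¹ a b * h.secondForm y a b)
          + (∑ i, ∑ j, (G y)⁻¹ i j * h.secondForm y i j) * ((G y)⁻¹ a b * G y a b) := fun a b => by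
      rw [h.ricci_eq hy hU]; ring
    simp only [h1, Finset.sum_add_distrib, ← Finset.mul_sum, hG]
    ring
  rw [schoutenTrace, this, mul_div_cancel_left₀]
  have : (d : ℝ) - 1 ≠ 0 := by linarith
  positivity

include hU hy in
-- This identification is why the flat transport of the ambient space is the normal tractor
-- connection. The bound on `d` permits division by `d - 2`.
lemma schouten_eq (hd : 3 ≤ d) (a b : Fin d) : schouten U G y a b = h.secondForm y a b := by
  have hd' : (3 : ℝ) ≤ d := by exact_mod_cast hd
  rw [schouten, h.schoutenTrace_eq hy hU (by omega), h.ricci_eq hy hU, add_sub_cancel_right,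
    mul_div_cancel_left₀]
  linarith

include hU hy in
-- The Gauss formula, evaluated on a constant covector; `bottom_eq` is likewise the Weingarten
-- formula.
lemma middle_eq (hd : 3 ≤ d) (ξ : Module.Dual ℝ V) (a b : Fin d) :
    ξ (dirDeriv (fun z => dirDeriv F z b) y a)
      - ∑ k, christoffel U G y k a b * ξ (dirDeriv F y k)
      + G y a b * ξ (Y y) + schouten U G y a b * ξ (F y) = 0 := by
  rw [h.schouten_eq hy hU hd, h.second_eq hy hU]
  simp only [map_sub, map_sum, map_smul, smul_eq_mul]
  ring

include hU hy in
lemma bottom_eq (hd : 3 ≤ d) (ξ : Module.Dual ℝ V) (a : Fin d) :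
    ξ (dirDeriv Y y a) - ∑ c, ∑ e, schouten U G y a c * (G y)⁻¹ c e * ξ (dirDeriv F y e) = 0 := by
  rw [h.dirDeriv_normal_eq hy, Finset.sum_comm]
  simp [h.schouten_eq hy hU hd, Finset.sum_mul]

include hU hy in
lemma constantCurvature (hP : ∀ i j, h.secondForm y i j = -(1 / 2) * G y i j) (a b c e : Fin d) :
    ∑ f, G y c f * curvature U G y a b f e
      = -1 * (G y a c * G y b e - G y b c * G y a e) := by
  rw [h.curvature_eq hy hU]
  simp only [hP]
  ring

include hU hy in
-- In `ricci_eq` the coefficient becomes `-(d - 2)/2 - d/2 = -(d - 1)`.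
lemma einstein (hP : ∀ i j, h.secondForm y i j = -(1 / 2) * G y i j) (a b : Fin d) :
    ricci U G y a b = -((d : ℝ) - 1) * G y a b := by
  have hG := h.sum_inv_mul hy
  have h1 : ∑ i, ∑ j, (G y)⁻¹ i j * h.secondForm y i j = -(1 / 2) * d := by
    rw [← hG]
    simp only [hP, Finset.mul_sum]
    exact Finset.sum_congr rfl fun i _ => Finset.sum_congr rfl fun j _ => by ring
  rw [h.ricci_eq hy hU, h1, hP]
  ring

include hy in
-- Two candidates for `Y y` differ by a multiple of `F y`, and nullity forces the multiple to
-- vanish. This uniqueness glues null fields that are built chart by chart.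
lemma eq_normal {w : V} (h1 : H w w = 0) (h2 : H w (F y) = 1)
    (h3 : ∀ i, H w (dirDeriv F y i) = 0) : w = Y y := by
  have h4 : w - Y y - H (w - Y y) (Y y) • F y = 0 := by
    apply h.eq_zero_of_orthogonal hy
    · simp [h2, h.pairing y hy, h.null y hy]
    · simp [h.null' y hy, h.symm (F y), h.pairing y hy]
    · simp [h3, h.normal y hy, h.symm (F y), h.dirDeriv_null hy]
  have h5 : w = Y y + H (w - Y y) (Y y) • F y := by
    rw [← sub_eq_zero, ← h4]
    abel
  have h6 : H (w - Y y) (Y y) = 0 := by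
    set c := H (w - Y y) (Y y)
    rw [h5] at h1
    simp only [map_add, map_smul, LinearMap.add_apply, LinearMap.smul_apply, smul_eq_mul,
      h.null y hy, h.null' y hy, h.pairing y hy, h.symm (F y) (Y y)] at h1
    linarith
  rw [h5, h6, zero_smul, add_zero]

end IsNullLift

/-- An immersion into the null cone has a smooth complementary null field, provided that it has
some smooth transversal. -/
lemma exists_isNullLift {H : LinearMap.BilinForm ℝ V} {O : Set (EuclideanSpace ℝ (Fin d))}
    {G : EuclideanSpace ℝ (Fin d) → Matrix (Fin d) (Fin d) ℝ}
    {F Z : EuclideanSpace ℝ (Fin d) → V} (symm : ∀ u v, H u v = H v u)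
    (finrank : Module.finrank ℝ V = d + 2) (isOpen : IsOpen O) (smooth : ContDiffOn ℝ ∞ F O)
    (smoothZ : ContDiffOn ℝ ∞ Z O) (null : ∀ y ∈ O, H (F y) (F y) = 0)
    (pairing : ∀ y ∈ O, H (Z y) (F y) = 1)
    (metric : ∀ y ∈ O, ∀ i j, G y i j = H (dirDeriv F y i) (dirDeriv F y j))
    (isUnit_det : ∀ y ∈ O, IsUnit (G y).det) : ∃ Y, IsNullLift H O G F Y := by
  have hF := dirDeriv_contDiffOn isOpen smooth
  have hG : ∀ i j, ContDiffOn ℝ ∞ (fun z => G z i j) O := fun i j =>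
    (contDiffOn_bilin H (hF i) (hF j)).congr fun z hz => metric z hz i j
  have hFF : ∀ y ∈ O, ∀ i, H (dirDeriv F y i) (F y) = 0 := fun y hy i => by
    have hd := differentiableAt_of_contDiffOn isOpen smooth hy
    have h1 := dirDeriv_bilin H hd hd i
    rw [dirDeriv_congr isOpen null hy, dirDeriv_const, symm (F y)] at h1
    linarith
  -- Coordinates of the tangential part of `Z`; subtracting it makes `W` orthogonal to every `∂ₖF`
  -- without changing the pairing with `F`.
  let c : EuclideanSpace ℝ (Fin d) → Fin d → ℝ := fun y i =>
    ∑ j, (G y)⁻¹ i j * H (Z y) (dirDeriv F y j)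
  have hc : ∀ i, ContDiffOn ℝ ∞ (fun y => c y i) O := fun i =>
    ContDiffOn.sum fun j _ =>
      (contDiffOn_matrix_inv hG isUnit_det i j).mul (contDiffOn_bilin H smoothZ (hF j))
  let W : EuclideanSpace ℝ (Fin d) → V := fun y => Z y - ∑ i, c y i • dirDeriv F y i
  have hW : ContDiffOn ℝ ∞ W O :=
    smoothZ.sub (ContDiffOn.sum fun i _ => (hc i).smul (hF i))
  have hWF : ∀ y ∈ O, H (W y) (F y) = 1 := fun y hy => by
    simp [W, pairing y hy, hFF y hy]
  have hWD : ∀ y ∈ O, ∀ k, H (W y) (dirDeriv F y k) = 0 := fun y hy k => by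
    simp only [W, map_sub, map_sum, map_smul, LinearMap.sub_apply, LinearMap.sum_apply,
      LinearMap.smul_apply, smul_eq_mul, ← metric y hy, c, Finset.sum_mul]
    rw [Finset.sum_comm]
    have h1 : ∀ j, ∑ i, (G y)⁻¹ i j * H (Z y) (dirDeriv F y j) * G y i k
        = H (Z y) (dirDeriv F y j) * (G y * (G y)⁻¹) k j := by
      intro j
      rw [Matrix.mul_apply, Finset.mul_sum]
      refine Finset.sum_congr rfl fun i _ => ?_
      rw [metric y hy i k, symm (dirDeriv F y i), ← metric y hy k i]
      ring
    simp only [h1, Matrix.mul_nonsing_inv _ (isUnit_det y hy)]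
    simp [Matrix.one_apply]
  -- As `H(W,F) = 1` and `F` is null, subtracting `q/2` times `F`, with `q = H(W,W)`, changes the
  -- square by `-q`.
  refine ⟨fun y => W y - (H (W y) (W y) / 2) • F y, symm, finrank, isOpen, smooth,
    hW.sub (((contDiffOn_bilin H hW hW).div_const 2).smul smooth), null, fun y hy => ?_,
    fun y hy => ?_, fun y hy i => ?_, metric, isUnit_det⟩
  · simp only [map_sub, map_smul, LinearMap.sub_apply, LinearMap.smul_apply, smul_eq_mul,
      null y hy, hWF y hy, symm (F y) (W y)]
    ring
  · simp [hWF y hy, null y hy]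
  · simp [hWD y hy, symm (F y), hFF y hy]

end NullLift

end PEModel

namespace PEModel

/-! ### Minkowski space -/

section Minkowski

variable {m : ℕ}

lemma minkowski_apply (u v : EuclideanSpace ℝ (Fin m) × ℝ) :
    minkowski m u v = inner ℝ u.1 v.1 - u.2 * v.2 := rfl

lemma minkowski_symm (u v : EuclideanSpace ℝ (Fin m) × ℝ) :
    minkowski m u v = minkowski m v u := by
  rw [minkowski_apply, minkowski_apply, real_inner_comm, mul_comm]

lemma minkowski_self (u : EuclideanSpace ℝ (Fin m) × ℝ) :
    minkowski m u u = ‖u.1‖ ^ 2 - u.2 ^ 2 := by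
  rw [minkowski_apply, real_inner_self_eq_norm_sq]
  ring

/-- Cauchy–Schwarz on the spatial parts, whose norms are bounded by the time components, strictly so
for `u`. -/
lemma minkowski_neg_of_timelike {u v : EuclideanSpace ℝ (Fin m) × ℝ}
    (hu : minkowski m u u < 0) (hu' : 0 < u.2) (hv : minkowski m v v ≤ 0) (hv' : 0 < v.2) :
    minkowski m u v < 0 := by
  rw [minkowski_self] at hu hv
  have h1 : ‖u.1‖ < u.2 := lt_of_pow_lt_pow_left₀ 2 hu'.le (by linarith)
  have h2 : ‖v.1‖ ≤ v.2 := le_of_sq_le_sq (by linarith) hv'.le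
  have h3 := real_inner_le_norm u.1 v.1
  have h4 : ‖u.1‖ * ‖v.1‖ < u.2 * v.2 :=
    (mul_le_mul_of_nonneg_left h2 (norm_nonneg _)).trans_lt (mul_lt_mul_of_pos_right h1 hv')
  rw [minkowski_apply]
  linarith

/-- The splitting of the first coordinate off Minkowski space. -/
noncomputable def minkowskiSplit (m : ℕ) : (EuclideanSpace ℝ (Fin (m + 1)) × ℝ) ≃ₗ[ℝ]
    ℝ × (EuclideanSpace ℝ (Fin m) × ℝ) where
  toFun p := (p.1 0, (WithLp.toLp 2 fun i => p.1 i.succ, p.2))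
  invFun q := (WithLp.toLp 2 (Fin.cons q.1 q.2.1), q.2.2)
  map_add' _ _ := rfl
  map_smul' _ _ := rfl
  left_inv p := by
    refine Prod.ext ?_ rfl
    ext i
    refine Fin.cases ?_ (fun j => ?_) i <;> simp
  right_inv q := by
    refine Prod.ext (by simp) (Prod.ext ?_ rfl)
    ext i
    simp

lemma minkowskiSplit_fst (p : EuclideanSpace ℝ (Fin (m + 1)) × ℝ) :
    (minkowskiSplit m p).1 = p.1 0 := rfl

lemma minkowskiSplit_time (p : EuclideanSpace ℝ (Fin (m + 1)) × ℝ) :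
    (minkowskiSplit m p).2.2 = p.2 := rfl

lemma minkowski_eq_split (u v : EuclideanSpace ℝ (Fin (m + 1)) × ℝ) : minkowski (m + 1) u v
    = (minkowskiSplit m u).1 * (minkowskiSplit m v).1
      + minkowski m (minkowskiSplit m u).2 (minkowskiSplit m v).2 := by
  have h : inner ℝ u.1 v.1
      = u.1 0 * v.1 0 + inner ℝ (minkowskiSplit m u).2.1 (minkowskiSplit m v).2.1 := by
    simp only [PiLp.inner_apply, Fin.sum_univ_succ, RCLike.inner_apply, conj_trivial]
    rw [mul_comm]
    rfl
  rw [minkowski_apply, minkowski_apply, h, minkowskiSplit_fst, minkowskiSplit_fst,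
    minkowskiSplit_time, minkowskiSplit_time]
  ring

/-- The reflection in the hyperplane orthogonal to a vector `u` with `⟨u, u⟩ = c ≠ 0`. -/
noncomputable def minkowskiReflection (u : EuclideanSpace ℝ (Fin m) × ℝ)
    (hu : minkowski m u u ≠ 0) :
    (EuclideanSpace ℝ (Fin m) × ℝ) ≃ₗ[ℝ] (EuclideanSpace ℝ (Fin m) × ℝ) :=
  Module.reflection (x := u) (f := (2 / minkowski m u u) • minkowski m u)
    (by simp [div_mul_cancel₀ _ hu])

section Reflection

variable {u : EuclideanSpace ℝ (Fin m) × ℝ} (hu : minkowski m u u ≠ 0)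

lemma minkowskiReflection_apply (v : EuclideanSpace ℝ (Fin m) × ℝ) :
    minkowskiReflection u hu v = v - (2 / minkowski m u u * minkowski m u v) • u := by
  simp [minkowskiReflection, Module.reflection_apply]

lemma minkowskiReflection_involutive (v : EuclideanSpace ℝ (Fin m) × ℝ) :
    minkowskiReflection u hu (minkowskiReflection u hu v) = v :=
  Module.involutive_reflection _ v

lemma minkowskiReflection_isometry (v w : EuclideanSpace ℝ (Fin m) × ℝ) :
    minkowski m (minkowskiReflection u hu v) (minkowskiReflection u hu w) = minkowski m v w := by
  simp only [minkowskiReflection_apply, map_sub, map_smul, LinearMap.sub_apply,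
    LinearMap.smul_apply, smul_eq_mul, minkowski_symm v u]
  field_simp
  ring

lemma det_minkowskiReflection :
    LinearMap.det (minkowskiReflection u hu : (EuclideanSpace ℝ (Fin m) × ℝ) →ₗ[ℝ] _) = -1 := by
  -- A map `v ↦ v + f(v) u` has determinant `1 + f(u)`, and here `f(u) = -2`.
  have : (minkowskiReflection u hu : (EuclideanSpace ℝ (Fin m) × ℝ) →ₗ[ℝ] _)
      = LinearMap.transvection (-((2 / minkowski m u u) • minkowski m u)) u := by
    refine LinearMap.ext fun v => ?_
    simp [LinearMap.transvection.apply, minkowskiReflection_apply, sub_eq_add_neg]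
  rw [this, LinearMap.transvection.det]
  simp [div_mul_cancel₀ _ hu]
  norm_num

/-- A reflection in a timelike vector reverses time. It changes the sign of the product with `u`,
and that product is negative on forward null vectors; so the null image of `p` cannot be forward,
nor can it be zero. -/
lemma minkowskiReflection_mem {p : EuclideanSpace ℝ (Fin m) × ℝ}
    (h : minkowski m u u < 0) (h' : 0 < u.2) (hp : p ∈ stdCone m) :
    -minkowskiReflection u hu p ∈ stdCone m := by
  have h1 : minkowski m u (minkowskiReflection u hu p) = -minkowski m u p := by
    simp only [minkowskiReflection_apply, map_sub, map_smul, smul_eq_mul]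
    field_simp
    ring
  have h2 := minkowski_neg_of_timelike h h' hp.1.le hp.2
  have h3 : minkowski m (minkowskiReflection u hu p) (minkowskiReflection u hu p) = 0 := by
    rw [minkowskiReflection_isometry]; exact hp.1
  refine ⟨by simpa using h3, ?_⟩
  by_contra hneg
  simp only [Prod.snd_neg, Left.neg_pos_iff, not_lt] at hneg
  rcases hneg.lt_or_eq with hlt | heq
  · have := minkowski_neg_of_timelike h h' h3.le hlt
    linarith
  · have h4 : minkowskiReflection u hu p = 0 := by
      rw [minkowski_self, ← heq] at h3
      have h5 : ‖(minkowskiReflection u hu p).1‖ = 0 := by simpa using h3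
      exact Prod.ext (norm_eq_zero.1 h5) heq.symm
    rw [h4, map_zero] at h1
    linarith

end Reflection

lemma neg_mem_stdCone_iff {φ : (EuclideanSpace ℝ (Fin m) × ℝ) ≃ₗ[ℝ] (EuclideanSpace ℝ (Fin m) × ℝ)}
    (h : ∀ p ∈ stdCone m, φ p ∈ stdCone m) (h' : ∀ p ∈ stdCone m, φ.symm p ∈ stdCone m) :
    φ ∈ preserving (stdCone m) :=
  fun p => ⟨fun hp => by simpa using h' _ hp, h p⟩

/-- The orthochronous special Lorentz group is transitive on hyperbolic space. -/
lemma exists_lorentz_apply_eq {p q : EuclideanSpace ℝ (Fin m) × ℝ} (hp : p ∈ hyperboloid m)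
    (hq : q ∈ hyperboloid m) :
    ∃ ψ ∈ SO (minkowski m) ⊓ preserving (stdCone m), ψ p = q := by
  have hp1 : minkowski m p p = -1 := hp.1
  have hq1 : minkowski m q q = -1 := hq.1
  have hpq := minkowski_neg_of_timelike (by rw [hp1]; norm_num) hp.2
    (by rw [hq1]; norm_num) hq.2
  have hs : minkowski m (p + q) (p + q) = 2 * (minkowski m p q - 1) := by
    simp only [map_add, LinearMap.add_apply, hp1, hq1, minkowski_symm q p]
    ring
  have hp0 : minkowski m p p ≠ 0 := by rw [hp1]; norm_num
  have hs0 : minkowski m (p + q) (p + q) < 0 := by rw [hs]; linarith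
  have hst : 0 < (p + q).2 := add_pos hp.2 hq.2
  have hmem : ∀ {a b : EuclideanSpace ℝ (Fin m) × ℝ} (ha : minkowski m a a < 0)
      (hb : minkowski m b b < 0), 0 < a.2 → 0 < b.2 → ∀ v ∈ stdCone m,
      minkowskiReflection a ha.ne (minkowskiReflection b hb.ne v) ∈ stdCone m := by
    intro a b ha hb ha' hb' v hv
    have h1 := minkowskiReflection_mem ha.ne ha ha' (minkowskiReflection_mem hb.ne hb hb' hv)
    simpa using h1
  have hpn : minkowski m p p < 0 := by rw [hp1]; norm_num
  -- Reflection in `p` sends `p` to `-p`. Since `p - q` is orthogonal to `p + q`, reflection in `p +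
  -- q` sends `p` to `-q`. The composite maps `p` to `q`, has determinant `(-1)²`, and reverses time
  -- twice.
  refine ⟨(minkowskiReflection p hpn.ne).trans (minkowskiReflection (p + q) hs0.ne),
    ⟨⟨fun u v => ?_, ?_⟩, ?_⟩, ?_⟩
  · simp only [LinearEquiv.trans_apply, minkowskiReflection_isometry]
  · rw [← Units.val_inj, LinearEquiv.coe_det, ← LinearEquiv.comp_coe, LinearMap.det_comp,
      det_minkowskiReflection, det_minkowskiReflection]
    norm_num
  · refine neg_mem_stdCone_iff (hmem hs0 hpn hst hp.2) fun v hv => ?_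
    have := hmem hpn hs0 hp.2 hst v hv
    convert this using 1
    rw [LinearEquiv.symm_apply_eq, LinearEquiv.trans_apply, minkowskiReflection_involutive,
      minkowskiReflection_involutive]
  · have h1 : minkowskiReflection p hpn.ne p = -p := by
      rw [minkowskiReflection_apply, div_mul_cancel₀ _ hpn.ne]
      module
    have h2 : minkowskiReflection (p + q) hs0.ne p = -q := by
      rw [minkowskiReflection_apply]
      have : 2 / minkowski m (p + q) (p + q) * minkowski m (p + q) p = 1 := by
        rw [hs]
        simp only [map_add, LinearMap.add_apply, hp1, minkowski_symm q p]
        have : minkowski m p q - 1 ≠ 0 := by linarith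
        field_simp
        ring
      rw [this]
      module
    rw [LinearEquiv.trans_apply, h1, map_neg, h2, neg_neg]

/-- The boost with rapidity `arcosh c` in the plane of the first and the last coordinate. -/
noncomputable def boost (c t : ℝ) (h : c ^ 2 - t ^ 2 = 1) :
    (EuclideanSpace ℝ (Fin (m + 1)) × ℝ) ≃ₗ[ℝ] (EuclideanSpace ℝ (Fin (m + 1)) × ℝ) :=
  (minkowskiSplit m).trans
    ({ toFun := fun q => (c * q.1 - t * q.2.2, (q.2.1, c * q.2.2 - t * q.1))
       invFun := fun q => (c * q.1 + t * q.2.2, (q.2.1, c * q.2.2 + t * q.1))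
       map_add' := fun x y => by
        refine Prod.ext ?_ (Prod.ext rfl ?_) <;> simp <;> ring
       map_smul' := fun r x => by
        refine Prod.ext ?_ (Prod.ext rfl ?_) <;> simp <;> ring
       left_inv := fun q => by
        refine Prod.ext ?_ (Prod.ext rfl ?_) <;> simp
        · linear_combination q.1 * h
        · linear_combination q.2.2 * h
       right_inv := fun q => by
        refine Prod.ext ?_ (Prod.ext rfl ?_) <;> simp
        · linear_combination q.1 * h
        · linear_combination q.2.2 * h } :
      (ℝ × (EuclideanSpace ℝ (Fin m) × ℝ)) ≃ₗ[ℝ] ℝ × (EuclideanSpace ℝ (Fin m) × ℝ)) |>.trans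
    (minkowskiSplit m).symm

lemma minkowskiSplit_boost (c t : ℝ) (h : c ^ 2 - t ^ 2 = 1)
    (p : EuclideanSpace ℝ (Fin (m + 1)) × ℝ) :
    minkowskiSplit m (boost c t h p) = (c * p.1 0 - t * p.2,
      ((minkowskiSplit m p).2.1, c * p.2 - t * p.1 0)) := by
  rw [boost, LinearEquiv.trans_apply, LinearEquiv.trans_apply, LinearEquiv.apply_symm_apply]
  rfl

end Minkowski

end PEModel

namespace PEModel

/-! ### Boosts preserve the form and the forward cone -/

section Boost

variable {m : ℕ} {c t : ℝ} (h : c ^ 2 - t ^ 2 = 1)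

lemma boost_isometry (u v : EuclideanSpace ℝ (Fin (m + 1)) × ℝ) :
    minkowski (m + 1) (boost c t h u) (boost c t h v) = minkowski (m + 1) u v := by
  rw [minkowski_eq_split, minkowski_eq_split, minkowskiSplit_boost, minkowskiSplit_boost]
  simp only [minkowski_apply, minkowskiSplit_fst, minkowskiSplit_time]
  linear_combination (u.1 0 * v.1 0 - u.2 * v.2) * h

lemma boost_time (p : EuclideanSpace ℝ (Fin (m + 1)) × ℝ) :
    (boost c t h p).2 = c * p.2 - t * p.1 0 := by
  rw [← minkowskiSplit_time, minkowskiSplit_boost]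

lemma boost_symm_time (p : EuclideanSpace ℝ (Fin (m + 1)) × ℝ) :
    ((boost c t h).symm p).2 = c * p.2 + t * p.1 0 := by
  rfl

/-- On the forward cone `|p.1 0| ≤ p.2`, and `c² - t² = 1` with `c ≥ 0` gives `|t| < c`; hence the
term `c * p.2` decides the sign of the new time component, for the boost and for its inverse. -/
lemma boost_preserving (hc : 0 ≤ c) : boost c t h ∈ preserving (stdCone (m + 1)) := by
  have key : ∀ p ∈ stdCone (m + 1), |t * p.1 0| < c * p.2 := by
    intro p hp
    have h1 : minkowski (m + 1) p p = 0 := hp.1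
    have ht : 0 < p.2 := hp.2
    rw [minkowski_self] at h1
    have h2 : ‖p.1‖ = p.2 := (sq_eq_sq₀ (norm_nonneg _) ht.le).1 (by linarith)
    have h3 : |p.1 0| ≤ p.2 := by
      rw [← h2]; exact PiLp.norm_apply_le p.1 0
    have h4 : |t| < c := abs_lt_of_sq_lt_sq (by linarith) hc
    rw [abs_mul]
    exact (mul_le_mul_of_nonneg_left h3 (abs_nonneg _)).trans_lt (mul_lt_mul_of_pos_right h4 ht)
  refine neg_mem_stdCone_iff (fun p hp => ⟨?_, ?_⟩) (fun p hp => ⟨?_, ?_⟩)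
  · rw [boost_isometry]; exact hp.1
  · rw [boost_time]
    linarith [(abs_lt.1 (key p hp)).2]
  · rw [← boost_isometry h, LinearEquiv.apply_symm_apply]; exact hp.1
  · rw [boost_symm_time]
    linarith [(abs_lt.1 (key p hp)).1]

end Boost

/-! ### Frames adapted to a unit spacelike covector -/

namespace LorentzFrame

variable {n : ℕ} {H : LinearMap.BilinForm ℝ (EuclideanSpace ℝ (Fin (n + 3)))}

lemma form_symm (L : LorentzFrame n H) (u v : EuclideanSpace ℝ (Fin (n + 3))) :
    H u v = H v u := by
  rw [L.isometry, L.isometry, minkowski_symm]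

lemma mem_cone_iff (L : LorentzFrame n H) {p : EuclideanSpace ℝ (Fin (n + 3))} :
    p ∈ L.cone ↔ L.toEquiv p ∈ stdCone (n + 2) := by
  rw [cone, stdCone, Set.mem_ofPred_eq, Set.mem_ofPred_eq, L.isometry]

/-- The frame obtained from `L` by a Lorentz transformation. -/
noncomputable def transform (L : LorentzFrame n H)
    (Λ : (EuclideanSpace ℝ (Fin (n + 2)) × ℝ) ≃ₗ[ℝ] (EuclideanSpace ℝ (Fin (n + 2)) × ℝ))
    (hΛ : ∀ u v, minkowski (n + 2) (Λ u) (Λ v) = minkowski (n + 2) u v) : LorentzFrame n H where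
  toEquiv := L.toEquiv.trans Λ
  isometry u v := by rw [LinearEquiv.trans_apply, LinearEquiv.trans_apply, hΛ, L.isometry]

lemma transform_cone (L : LorentzFrame n H)
    {Λ : (EuclideanSpace ℝ (Fin (n + 2)) × ℝ) ≃ₗ[ℝ] (EuclideanSpace ℝ (Fin (n + 2)) × ℝ)}
    (hΛ : ∀ u v, minkowski (n + 2) (Λ u) (Λ v) = minkowski (n + 2) u v)
    (h : Λ ∈ preserving (stdCone (n + 2))) : (L.transform Λ hΛ).cone = L.cone := by
  ext p
  rw [mem_cone_iff, mem_cone_iff]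
  exact h _

/-- The frame `T` defines the same forward cone as `L`, and its first coordinate is `ξ`. -/
structure IsAdapted (L T : LorentzFrame n H)
    (ξ : Module.Dual ℝ (EuclideanSpace ℝ (Fin (n + 3)))) : Prop where
  cone_eq : T.cone = L.cone
  apply_eq : ∀ p, ξ p = (T.toEquiv p).1 0

/-- Spatial isometries, as Lorentz transformations. -/
noncomputable def spatial {m : ℕ} (R : EuclideanSpace ℝ (Fin m) ≃ₗᵢ[ℝ] EuclideanSpace ℝ (Fin m)) :
    (EuclideanSpace ℝ (Fin m) × ℝ) ≃ₗ[ℝ] (EuclideanSpace ℝ (Fin m) × ℝ) :=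
  R.toLinearEquiv.prodCongr (LinearEquiv.refl ℝ ℝ)

lemma spatial_apply {m : ℕ} (R : EuclideanSpace ℝ (Fin m) ≃ₗᵢ[ℝ] EuclideanSpace ℝ (Fin m))
    (p : EuclideanSpace ℝ (Fin m) × ℝ) : spatial R p = (R p.1, p.2) := rfl

lemma spatial_isometry {m : ℕ} (R : EuclideanSpace ℝ (Fin m) ≃ₗᵢ[ℝ] EuclideanSpace ℝ (Fin m))
    (u v : EuclideanSpace ℝ (Fin m) × ℝ) :
    minkowski m (spatial R u) (spatial R v) = minkowski m u v := by
  simp [minkowski_apply, spatial_apply]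

lemma spatial_preserving {m : ℕ}
    (R : EuclideanSpace ℝ (Fin m) ≃ₗᵢ[ℝ] EuclideanSpace ℝ (Fin m)) :
    spatial R ∈ preserving (stdCone m) := by
  intro p
  change minkowski m _ _ = 0 ∧ _ ↔ minkowski m p p = 0 ∧ _
  rw [spatial_isometry, spatial_apply]

/-- The dual vector is unit spacelike. A spatial isometry turns its spatial part onto the first
axis, a boost then removes its time component, and what remains is the first basis vector. Neither
step moves the forward cone. -/
lemma exists_isAdapted (L : LorentzFrame n H) (hH : H.Nondegenerate)
    (ξ : Module.Dual ℝ (EuclideanSpace ℝ (Fin (n + 3)))) (hξ : covectorNormSq H hH ξ = 1) :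
    ∃ T, L.IsAdapted T ξ := by
  set I := (H.toDual hH).symm ξ with hI
  have hIξ : ∀ p, ξ p = H I p := fun p => by
    rw [hI, LinearMap.BilinForm.apply_toDual_symm_apply]
  have hu : minkowski (n + 2) (L.toEquiv I) (L.toEquiv I) = 1 := by
    rw [← L.isometry]; exact hξ
  set u := L.toEquiv I
  rw [minkowski_self] at hu
  let w : EuclideanSpace ℝ (Fin (n + 2)) := ‖u.1‖ • EuclideanSpace.single 0 1
  have hw : ‖u.1‖ = ‖w‖ := by simp [w, norm_smul]
  let R : EuclideanSpace ℝ (Fin (n + 2)) ≃ₗᵢ[ℝ] EuclideanSpace ℝ (Fin (n + 2)) :=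
    (ℝ ∙ (u.1 - w))ᗮ.reflection
  have hR : R u.1 = w := Submodule.reflection_sub hw
  -- `‖u.1‖` and `u.2` serve as hyperbolic cosine and sine; the relation a boost requires of them is
  -- `⟨u, u⟩ = 1`.
  let Λ := (spatial R).trans (boost ‖u.1‖ u.2 hu)
  have hΛ : ∀ u v, minkowski (n + 2) (Λ u) (Λ v) = minkowski (n + 2) u v := fun u v => by
    simp only [Λ, LinearEquiv.trans_apply, boost_isometry, spatial_isometry]
  have hΛc : Λ ∈ preserving (stdCone (n + 2)) := fun p => by
    simp only [Λ, LinearEquiv.trans_apply]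
    rw [boost_preserving hu (norm_nonneg _), spatial_preserving]
  refine ⟨L.transform Λ hΛ, L.transform_cone hΛ hΛc, fun p => ?_⟩
  have hΛu : minkowskiSplit (n + 1) (Λ u) = (1, 0) := by
    simp only [Λ, LinearEquiv.trans_apply, spatial_apply, minkowskiSplit_boost, hR]
    refine Prod.ext ?_ (Prod.ext ?_ ?_)
    · simp only [w, PiLp.smul_apply, PiLp.single_apply, if_true, smul_eq_mul, mul_one]
      linarith
    · ext i
      change (‖u.1‖ • EuclideanSpace.single (0 : Fin (n + 2)) (1 : ℝ)) i.succ = 0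
      simp [Fin.succ_ne_zero]
    · simp only [w, PiLp.smul_apply, PiLp.single_apply, if_true, smul_eq_mul, mul_one]
      simp [mul_comm]
  rw [hIξ, L.isometry, ← hΛ, minkowski_eq_split]
  change (minkowskiSplit (n + 1) (Λ u)).1 * _ + minkowski _ (minkowskiSplit (n + 1) (Λ u)).2 _ = _
  rw [hΛu]
  simp [minkowskiSplit_fst]
  rfl

end LorentzFrame

end PEModel

namespace PEModel

namespace LorentzFrame

variable {n : ℕ} {H : LinearMap.BilinForm ℝ (EuclideanSpace ℝ (Fin (n + 3)))}
  {L T : LorentzFrame n H} {ξ : Module.Dual ℝ (EuclideanSpace ℝ (Fin (n + 3)))}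

/-! ### The isotropy group of a spacelike covector -/

/-- The coordinates of a frame, with the first one split off. -/
noncomputable def coords (T : LorentzFrame n H) :
    EuclideanSpace ℝ (Fin (n + 3)) ≃ₗ[ℝ] ℝ × (EuclideanSpace ℝ (Fin (n + 1)) × ℝ) :=
  T.toEquiv.trans (minkowskiSplit (n + 1))

lemma form_eq_coords (T : LorentzFrame n H) (u v : EuclideanSpace ℝ (Fin (n + 3))) :
    H u v = (T.coords u).1 * (T.coords v).1
      + minkowski (n + 1) (T.coords u).2 (T.coords v).2 := by
  rw [T.isometry, minkowski_eq_split]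
  rfl

lemma mem_cone_iff_coords (T : LorentzFrame n H) {p : EuclideanSpace ℝ (Fin (n + 3))} :
    p ∈ T.cone ↔ (T.coords p).1 ^ 2 + minkowski (n + 1) (T.coords p).2 (T.coords p).2 = 0
      ∧ 0 < (T.coords p).2.2 := by
  change H p p = 0 ∧ _ ↔ _
  rw [T.form_eq_coords, ← sq]
  rfl

lemma coords_symm_mem_cone_iff (T : LorentzFrame n H) (w : EuclideanSpace ℝ (Fin (n + 1)) × ℝ) :
    T.coords.symm (0, w) ∈ T.cone ↔ w ∈ stdCone (n + 1) := by
  rw [mem_cone_iff_coords, LinearEquiv.apply_symm_apply]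
  simp [stdCone]

/-- The extension of a Lorentz transformation by the identity in the first coordinate. -/
noncomputable def extend (T : LorentzFrame n H)
    (ψ : (EuclideanSpace ℝ (Fin (n + 1)) × ℝ) ≃ₗ[ℝ] (EuclideanSpace ℝ (Fin (n + 1)) × ℝ)) :
    EuclideanSpace ℝ (Fin (n + 3)) ≃ₗ[ℝ] EuclideanSpace ℝ (Fin (n + 3)) :=
  (T.coords.trans ((LinearEquiv.refl ℝ ℝ).prodCongr ψ)).trans T.coords.symm

lemma coords_extend (T : LorentzFrame n H)
    (ψ : (EuclideanSpace ℝ (Fin (n + 1)) × ℝ) ≃ₗ[ℝ] (EuclideanSpace ℝ (Fin (n + 1)) × ℝ))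
    (v : EuclideanSpace ℝ (Fin (n + 3))) :
    T.coords (T.extend ψ v) = ((T.coords v).1, ψ (T.coords v).2) := by
  simp [extend]

lemma extend_apply_symm (T : LorentzFrame n H)
    (ψ : (EuclideanSpace ℝ (Fin (n + 1)) × ℝ) ≃ₗ[ℝ] (EuclideanSpace ℝ (Fin (n + 1)) × ℝ))
    (w : ℝ × (EuclideanSpace ℝ (Fin (n + 1)) × ℝ)) :
    T.extend ψ (T.coords.symm w) = T.coords.symm (w.1, ψ w.2) := by
  apply T.coords.injective
  rw [coords_extend, LinearEquiv.apply_symm_apply, LinearEquiv.apply_symm_apply]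

lemma det_extend (T : LorentzFrame n H)
    (ψ : (EuclideanSpace ℝ (Fin (n + 1)) × ℝ) ≃ₗ[ℝ] (EuclideanSpace ℝ (Fin (n + 1)) × ℝ)) :
    LinearEquiv.det (T.extend ψ) = LinearEquiv.det ψ := by
  have h1 : T.extend ψ
      = (T.coords.symm.symm.trans ((LinearEquiv.refl ℝ ℝ).prodCongr ψ)).trans T.coords.symm := rfl
  rw [h1, LinearEquiv.det_conj, ← Units.val_inj, LinearEquiv.coe_det, LinearEquiv.coe_det]
  have h2 : ((LinearEquiv.refl ℝ ℝ).prodCongr ψ).toLinearMap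
      = LinearMap.prodMap (LinearMap.id : ℝ →ₗ[ℝ] ℝ) ψ.toLinearMap := rfl
  rw [h2, LinearMap.det_prodMap, LinearMap.det_id, one_mul]

lemma apply_eq_coords (hT : L.IsAdapted T ξ) (v : EuclideanSpace ℝ (Fin (n + 3))) :
    ξ v = (T.coords v).1 := by
  rw [hT.apply_eq]
  rfl

lemma extend_mem (hT : L.IsAdapted T ξ)
    {ψ : (EuclideanSpace ℝ (Fin (n + 1)) × ℝ) ≃ₗ[ℝ] (EuclideanSpace ℝ (Fin (n + 1)) × ℝ)}
    (hψ : ψ ∈ SO (minkowski (n + 1))) : T.extend ψ ∈ SO H ⊓ fixing ξ := by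
  refine ⟨⟨fun u v => ?_, ?_⟩, fun v => ?_⟩
  · rw [T.form_eq_coords, T.form_eq_coords u v, coords_extend, coords_extend, hψ.1]
  · rw [det_extend]; exact hψ.2
  · rw [apply_eq_coords hT, apply_eq_coords hT, coords_extend]

/-- An isometry that fixes `ξ` fixes the dual vector `(1, 0)` and preserves its orthogonal
complement `ker ξ`, so it is block diagonal in `coords`, with the identity as first block. -/
lemma exists_extend_eq (hT : L.IsAdapted T ξ)
    {φ : EuclideanSpace ℝ (Fin (n + 3)) ≃ₗ[ℝ] EuclideanSpace ℝ (Fin (n + 3))}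
    (hφ : φ ∈ SO H ⊓ fixing ξ) : ∃ ψ ∈ SO (minkowski (n + 1)), T.extend ψ = φ := by
  have key : ∀ φ ∈ SO H ⊓ fixing ξ, ∀ w : ℝ × (EuclideanSpace ℝ (Fin (n + 1)) × ℝ),
      T.coords (φ (T.coords.symm w)) = (w.1, (T.coords (φ (T.coords.symm (0, w.2)))).2) := by
    intro φ hφ w
    have hfix : φ (T.coords.symm (1, 0)) = T.coords.symm (1, 0) := by
      rw [← sub_eq_zero]
      have hξ : ∀ v, H (T.coords.symm (1, 0)) v = ξ v := fun v => by
        rw [T.form_eq_coords, LinearEquiv.apply_symm_apply, apply_eq_coords hT]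
        simp
      have hz : ∀ v, H (φ (T.coords.symm (1, 0)) - T.coords.symm (1, 0)) v = 0 := fun v => by
        obtain ⟨v, rfl⟩ := φ.surjective v
        rw [map_sub, LinearMap.sub_apply, hφ.1.1, hξ, hξ, hφ.2, sub_self]
      apply T.coords.injective
      rw [map_zero]
      set z := φ (T.coords.symm (1, 0)) - T.coords.symm (1, 0)
      have h1 := hz (T.coords.symm (1, 0))
      have h2 : ∀ w, H z (T.coords.symm (0, w)) = 0 := fun w => hz _
      simp only [T.form_eq_coords, LinearEquiv.apply_symm_apply, map_zero, mul_one, add_zero,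
        mul_zero, zero_add] at h1 h2
      -- Testing against its own spatial part and against the time axis shows that both components
      -- of `z` in `ker ξ` vanish.
      have h3 := h2 ((T.coords z).2.1, 0)
      have h4 := h2 (0, 1)
      simp only [minkowski_apply, mul_zero, sub_zero, inner_zero_right, mul_one, zero_sub,
        neg_eq_zero, inner_self_eq_zero] at h3 h4
      exact Prod.ext h1 (Prod.ext h3 h4)
    have hw : T.coords.symm w = w.1 • T.coords.symm (1, 0) + T.coords.symm (0, w.2) := by
      rw [← map_smul, ← map_add]
      congr 1
      simp
    have h0 : (T.coords (φ (T.coords.symm (0, w.2)))).1 = 0 := by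
      rw [← apply_eq_coords hT, hφ.2, apply_eq_coords hT, LinearEquiv.apply_symm_apply]
    rw [hw, map_add, map_add, map_smul, hfix, map_smul, LinearEquiv.apply_symm_apply]
    refine Prod.ext ?_ ?_
    · simp [h0]
    · simp
  -- The second diagonal block, defined for all `φ` so that the block of `φ⁻¹` is available as the
  -- inverse.
  let A : ∀ φ : EuclideanSpace ℝ (Fin (n + 3)) ≃ₗ[ℝ] EuclideanSpace ℝ (Fin (n + 3)),
      (EuclideanSpace ℝ (Fin (n + 1)) × ℝ) →ₗ[ℝ] (EuclideanSpace ℝ (Fin (n + 1)) × ℝ) := fun φ =>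
    LinearMap.snd ℝ ℝ _ ∘ₗ T.coords.toLinearMap ∘ₗ φ.toLinearMap ∘ₗ
      T.coords.symm.toLinearMap ∘ₗ LinearMap.inr ℝ ℝ _
  have hA : ∀ φ w, A φ w = (T.coords (φ (T.coords.symm (0, w)))).2 := fun _ _ => rfl
  have hcomp : ∀ φ ∈ SO H ⊓ fixing ξ, ∀ φ' ∈ SO H ⊓ fixing ξ, φ * φ' = 1 →
      A φ ∘ₗ A φ' = LinearMap.id := by
    intro φ hφ φ' hφ' h
    refine LinearMap.ext fun w => ?_
    have h1 := key φ' hφ' (0, w)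
    have h2 : T.coords.symm (0, (T.coords (φ' (T.coords.symm (0, w)))).2)
        = φ' (T.coords.symm (0, w)) := by
      rw [LinearEquiv.symm_apply_eq, h1]
    rw [LinearMap.comp_apply, hA, hA, h2, ← LinearEquiv.mul_apply, h]
    simp
  have hφ' : φ⁻¹ ∈ SO H ⊓ fixing ξ := inv_mem hφ
  let ψ : (EuclideanSpace ℝ (Fin (n + 1)) × ℝ) ≃ₗ[ℝ] (EuclideanSpace ℝ (Fin (n + 1)) × ℝ) :=
    LinearEquiv.ofLinearMap (A φ) (A φ⁻¹) (hcomp _ hφ _ hφ' (mul_inv_cancel φ))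
    (hcomp _ hφ' _ hφ (inv_mul_cancel φ))
  have hψ : ∀ w, ψ w = (T.coords (φ (T.coords.symm (0, w)))).2 := fun _ => rfl
  have hext : T.extend ψ = φ := by
    ext1 v
    obtain ⟨w, rfl⟩ := T.coords.symm.surjective v
    rw [extend_apply_symm, LinearEquiv.symm_apply_eq, key φ hφ w, hψ]
  refine ⟨ψ, ⟨fun u v => ?_, ?_⟩, hext⟩
  · have h1 := hφ.1.1 (T.coords.symm (0, u)) (T.coords.symm (0, v))
    rw [← hext, extend_apply_symm, extend_apply_symm, T.form_eq_coords, T.form_eq_coords] at h1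
    simpa using h1
  · rw [← det_extend T, hext]
    exact hφ.1.2

/-- The cone of `ker ξ` lies in the large cone, which settles one direction. Conversely, a point of
the large cone projects to a vector of `ker ξ` that is merely causal; such a vector is a nonnegative
combination of forward null vectors, so `ψ` keeps it forward. -/
lemma extend_preserving_iff (hT : L.IsAdapted T ξ)
    (ψ : (EuclideanSpace ℝ (Fin (n + 1)) × ℝ) ≃ₗ[ℝ] (EuclideanSpace ℝ (Fin (n + 1)) × ℝ))
    (hψ : ψ ∈ SO (minkowski (n + 1))) :
    T.extend ψ ∈ preserving L.cone ↔ ψ ∈ preserving (stdCone (n + 1)) := by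
  rw [← hT.cone_eq]
  constructor
  · intro h w
    have h1 := h (T.coords.symm (0, w))
    rwa [extend_apply_symm, coords_symm_mem_cone_iff, coords_symm_mem_cone_iff] at h1
  · intro h
    have key : ∀ ψ ∈ SO (minkowski (n + 1)) ⊓ preserving (stdCone (n + 1)),
        ∀ p ∈ T.cone, T.extend ψ p ∈ T.cone := by
      intro ψ hψ p hp
      rw [mem_cone_iff_coords] at hp ⊢
      rw [coords_extend, hψ.1.1]
      refine ⟨hp.1, ?_⟩
      set w := (T.coords p).2
      have hw : ‖w.1‖ ≤ w.2 := by
        have := hp.1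
        rw [minkowski_self] at this
        exact le_of_sq_le_sq (by nlinarith [sq_nonneg (T.coords p).1]) hp.2.le
      have hpos : ∀ u : EuclideanSpace ℝ (Fin (n + 1)), ‖u‖ = 1 → 0 < (ψ (u, 1)).2 := by
        intro u hu
        have : (u, (1 : ℝ)) ∈ stdCone (n + 1) := by
          refine ⟨?_, one_pos⟩
          rw [minkowski_self, hu]
          norm_num
        exact ((hψ.2 _).2 this).2
      -- If the spatial part vanishes, any unit vector serves as its direction.
      obtain ⟨u, hu, hwu⟩ : ∃ u : EuclideanSpace ℝ (Fin (n + 1)), ‖u‖ = 1 ∧ w.1 = ‖w.1‖ • u := by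
        by_cases h0 : w.1 = 0
        · exact ⟨EuclideanSpace.single 0 1, by simp, by simp [h0]⟩
        · refine ⟨‖w.1‖⁻¹ • w.1, norm_smul_inv_norm h0, ?_⟩
          rw [smul_inv_smul₀ (norm_ne_zero_iff.2 h0)]
      -- The coefficients have sum `w.2` and difference `‖w.1‖`. The first is positive and the
      -- second nonnegative.
      have hdec : w = ((w.2 + ‖w.1‖) / 2) • (u, (1 : ℝ)) + ((w.2 - ‖w.1‖) / 2) • (-u, (1 : ℝ)) := by
        refine Prod.ext ?_ ?_
        · simp only [Prod.fst_add, Prod.smul_fst]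
          nth_rewrite 1 [hwu]
          module
        · simp
          ring
      have hn := norm_nonneg w.1
      have h1 := hpos u hu
      have h2 := hpos (-u) (by rwa [norm_neg])
      change 0 < (ψ w).2
      rw [hdec, map_add, map_smul, map_smul, Prod.snd_add, Prod.smul_snd, Prod.smul_snd,
        smul_eq_mul, smul_eq_mul]
      have hp2 : 0 < w.2 := hp.2
      exact add_pos_of_pos_of_nonneg (mul_pos (by linarith) h1)
        (mul_nonneg (by linarith) h2.le)
    intro p
    refine ⟨fun hp => ?_, key ψ ⟨hψ, h⟩ p⟩
    have h1 := key ψ⁻¹ (inv_mem ⟨hψ, h⟩) _ hp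
    have h2 : T.extend ψ⁻¹ (T.extend ψ p) = p := by
      apply T.coords.injective
      rw [coords_extend, coords_extend, ← LinearEquiv.mul_apply, inv_mul_cancel]
      rfl
    rwa [h2] at h1

/-- Extension by the identity, as an isomorphism of `SO(d, 1)` onto the isotropy group. -/
noncomputable def extendEquiv (hT : L.IsAdapted T ξ) :
    ↥(SO (minkowski (n + 1))) ≃* ↥(SO H ⊓ fixing ξ) :=
  MulEquiv.ofBijective
    ({ toFun := fun ψ => ⟨T.extend ψ.1, extend_mem hT ψ.2⟩
       map_one' := by
        apply Subtype.ext
        ext1 v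
        apply T.coords.injective
        change T.coords (T.extend 1 v) = T.coords v
        rw [coords_extend]
        rfl
       map_mul' := fun ψ χ => by
        apply Subtype.ext
        ext1 v
        apply T.coords.injective
        change T.coords (T.extend (ψ.1 * χ.1) v) = T.coords (T.extend ψ.1 (T.extend χ.1 v))
        rw [coords_extend, coords_extend, coords_extend]
        rfl } : ↥(SO (minkowski (n + 1))) →* ↥(SO H ⊓ fixing ξ))
    ⟨fun ψ χ h => by
      apply Subtype.ext
      ext1 w
      have h1 : T.extend ψ.1 = T.extend χ.1 := congrArg Subtype.val h
      have h2 := congrArg (fun f : EuclideanSpace ℝ (Fin (n + 3)) ≃ₗ[ℝ] _ =>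
        T.coords (f (T.coords.symm (0, w)))) h1
      simp only [extend_apply_symm, LinearEquiv.apply_symm_apply] at h2
      exact congrArg Prod.snd h2,
    fun φ => by
      obtain ⟨ψ, hψ, h⟩ := exists_extend_eq hT φ.2
      exact ⟨⟨ψ, hψ⟩, Subtype.ext h⟩⟩

theorem isotropy_group (hT : L.IsAdapted T ξ) :
    ∃ (e : EuclideanSpace ℝ (Fin (n + 1)) × ℝ →ₗ[ℝ] EuclideanSpace ℝ (Fin (n + 3)))
        (Φ : ↥(SO H ⊓ fixing ξ) ≃* ↥(SO (minkowski (n + 1)))),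
      (∀ w w', H (e w) (e w') = minkowski (n + 1) w w') ∧
      LinearMap.range e = LinearMap.ker ξ ∧
      (∀ φ w, φ.1 (e w) = e ((Φ φ).1 w)) ∧
      ∀ φ, φ.1 ∈ preserving L.cone ↔ (Φ φ).1 ∈ preserving (stdCone (n + 1)) := by
  refine ⟨T.coords.symm.toLinearMap ∘ₗ LinearMap.inr ℝ ℝ _, (extendEquiv hT).symm,
    fun w w' => ?_, ?_, fun φ w => ?_, fun φ => ?_⟩
  · simp [T.form_eq_coords]
  · ext v
    rw [LinearMap.mem_ker, apply_eq_coords hT]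
    constructor
    · rintro ⟨w, rfl⟩
      simp
    · intro h
      exact ⟨(T.coords v).2, (LinearEquiv.symm_apply_eq _).2 (Prod.ext h.symm rfl)⟩
  · obtain ⟨ψ, rfl⟩ := (extendEquiv hT).surjective φ
    rw [MulEquiv.symm_apply_apply]
    exact extend_apply_symm T ψ.1 (0, w)
  · obtain ⟨ψ, rfl⟩ := (extendEquiv hT).surjective φ
    rw [MulEquiv.symm_apply_apply]
    exact extend_preserving_iff hT ψ.1 ψ.2

/-! ### The action of the isotropy group on the open cap -/

lemma toEquiv_lift (L : LorentzFrame n H) (x : Sph (n + 1)) :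
    L.toEquiv (L.lift x) = ((x : EuclideanSpace ℝ (Fin (n + 2))), 1) := by
  rw [lift, LinearEquiv.apply_symm_apply]

lemma lift_mem (L : LorentzFrame n H) (x : Sph (n + 1)) : L.lift x ∈ L.cone := by
  rw [mem_cone_iff, toEquiv_lift]
  refine ⟨?_, one_pos⟩
  rw [minkowski_self]
  simp

lemma proj_lift (L : LorentzFrame n H) (x : Sph (n + 1)) (h : L.lift x ∈ L.cone) :
    L.proj ⟨L.lift x, h⟩ = x := by
  apply Subtype.ext
  simp [proj, toEquiv_lift]

lemma eq_smul_lift (L : LorentzFrame n H) (p : L.cone) :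
    (p : EuclideanSpace ℝ (Fin (n + 3))) = (L.toEquiv p).2 • L.lift (L.proj p) := by
  apply L.toEquiv.injective
  rw [map_smul, toEquiv_lift]
  refine Prod.ext ?_ (by simp)
  simp only [Prod.smul_fst, proj]
  rw [smul_inv_smul₀ p.2.2.ne']

lemma proj_eq_proj_iff (L : LorentzFrame n H) (p q : L.cone) : L.proj p = L.proj q ↔
    ∃ t : ℝ, 0 < t ∧ (q : EuclideanSpace ℝ (Fin (n + 3))) = t • p := by
  have hp : 0 < (L.toEquiv p).2 := p.2.2
  have hq : 0 < (L.toEquiv q).2 := q.2.2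
  constructor
  · intro h
    refine ⟨(L.toEquiv q).2 * (L.toEquiv p).2⁻¹, mul_pos hq (inv_pos.2 hp), ?_⟩
    calc (q : EuclideanSpace ℝ (Fin (n + 3)))
        = ((L.toEquiv q).2 * (L.toEquiv p).2⁻¹) • ((L.toEquiv p).2 • L.lift (L.proj p)) := by
          rw [smul_smul, inv_mul_cancel_right₀ hp.ne', h, ← L.eq_smul_lift]
      _ = _ := by rw [← L.eq_smul_lift]
  · rintro ⟨t, ht, h⟩
    apply Subtype.ext
    simp only [proj]
    rw [h, map_smul, Prod.smul_fst, Prod.smul_snd, smul_smul, smul_eq_mul, mul_inv, mul_right_comm,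
      inv_mul_cancel₀ ht.ne', one_mul]

lemma smul_mem_cone (L : LorentzFrame n H) {p : EuclideanSpace ℝ (Fin (n + 3))}
    (hp : p ∈ L.cone) {t : ℝ} (ht : 0 < t) : t • p ∈ L.cone := by
  obtain ⟨h1, h2⟩ := hp
  refine ⟨by simp [h1], ?_⟩
  rw [map_smul, Prod.smul_snd, smul_eq_mul]
  exact mul_pos ht h2

lemma proj_smul (L : LorentzFrame n H) {p : EuclideanSpace ℝ (Fin (n + 3))}
    (hp : p ∈ L.cone) {t : ℝ} (ht : 0 < t) (h : t • p ∈ L.cone) :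
    L.proj ⟨t • p, h⟩ = L.proj ⟨p, hp⟩ :=
  ((L.proj_eq_proj_iff ⟨p, hp⟩ ⟨t • p, h⟩).2 ⟨t, ht, rfl⟩).symm

lemma exists_lift_proj_eq (L : LorentzFrame n H) {p : EuclideanSpace ℝ (Fin (n + 3))}
    (hp : p ∈ L.cone) : ∃ t : ℝ, 0 < t ∧ L.lift (L.proj ⟨p, hp⟩) = t • p := by
  have h : 0 < (L.toEquiv p).2 := hp.2
  refine ⟨(L.toEquiv p).2⁻¹, inv_pos.2 h, ?_⟩
  rw [eq_inv_smul_iff₀ h.ne']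
  exact (L.eq_smul_lift ⟨p, hp⟩).symm

lemma proj_mem_openCap_iff (L : LorentzFrame n H) {p : EuclideanSpace ℝ (Fin (n + 3))}
    (hp : p ∈ L.cone) : L.proj ⟨p, hp⟩ ∈ L.openCap ξ ↔ 0 < ξ p := by
  obtain ⟨t, ht, h⟩ := L.exists_lift_proj_eq hp
  rw [openCap, Set.mem_ofPred_eq, h, map_smul, smul_eq_mul, mul_pos_iff_of_pos_left ht]

/-- The normalised coordinates of a point in the open cap; they lie on the hyperboloid. -/
lemma coords_mem_hyperboloid (hT : L.IsAdapted T ξ) {p : EuclideanSpace ℝ (Fin (n + 3))}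
    (hp : p ∈ L.cone) (h : 0 < ξ p) : (ξ p)⁻¹ • (T.coords p).2 ∈ hyperboloid (n + 1) := by
  rw [← hT.cone_eq, mem_cone_iff_coords, ← apply_eq_coords hT] at hp
  refine ⟨?_, ?_⟩
  · have h1 : minkowski (n + 1) (T.coords p).2 (T.coords p).2 = -ξ p ^ 2 := by linarith
    simp only [map_smul, LinearMap.smul_apply, smul_eq_mul, h1]
    field_simp
  · rw [Prod.smul_snd, smul_eq_mul]
    exact mul_pos (inv_pos.2 h) hp.2

/-- The action of the orthochronous isotropy group on the open cap. -/
noncomputable abbrev capAction (L : LorentzFrame n H)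
    (ξ : Module.Dual ℝ (EuclideanSpace ℝ (Fin (n + 3)))) :
    MulAction ↥(SO H ⊓ preserving L.cone ⊓ fixing ξ) (L.openCap ξ) where
  smul φ x := ⟨L.proj ⟨φ.1 (L.lift x), (φ.2.1.2 _).2 (L.lift_mem x)⟩, by
    rw [proj_mem_openCap_iff, φ.2.2]
    exact x.2⟩
  one_smul x := by
    apply Subtype.ext
    exact L.proj_lift x _
  mul_smul φ χ x := by
    apply Subtype.ext
    change L.proj ⟨φ.1 (χ.1 (L.lift x)), _⟩ = L.proj ⟨φ.1 (L.lift (L.proj ⟨χ.1 (L.lift x), _⟩)), _⟩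
    obtain ⟨t, ht, h⟩ := L.exists_lift_proj_eq ((χ.2.1.2 _).2 (L.lift_mem x))
    refine (L.proj_eq_proj_iff _ _).2 ⟨t, ht, ?_⟩
    change φ.1 (L.lift (L.proj ⟨χ.1 (L.lift x), _⟩)) = t • φ.1 (χ.1 (L.lift x))
    rw [← map_smul, ← h]

lemma capAction_smul (L : LorentzFrame n H) (φ : ↥(SO H ⊓ preserving L.cone ⊓ fixing ξ))
    (x : L.openCap ξ) : (((L.capAction ξ).smul φ x : L.openCap ξ) : Sph (n + 1))
      = L.proj ⟨φ.1 (L.lift x), (φ.2.1.2 _).2 (L.lift_mem x)⟩ := rfl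

/-- Normalising `ξ` to `1` on each ray puts the open cap on the hyperboloid, where the orthochronous
Lorentz group is transitive; the Lorentz map found there is extended by the identity. -/
theorem isotropy_action (hT : L.IsAdapted T ξ) :
    ∃ act : MulAction ↥(SO H ⊓ preserving L.cone ⊓ fixing ξ) (L.openCap ξ),
      (∀ φ (x : L.openCap ξ) (p : L.cone), L.proj p = x →
        ∃ h : φ.1 p ∈ L.cone,
          L.proj ⟨φ.1 p, h⟩ = (act.smul φ x : Sph (n + 1))) ∧
      MulAction.IsPretransitive ↥(SO H ⊓ preserving L.cone ⊓ fixing ξ) (L.openCap ξ) := by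
  refine ⟨L.capAction ξ, fun φ x p hp => ⟨(φ.2.1.2 _).2 p.2, ?_⟩, ?_⟩
  · rw [capAction_smul, proj_eq_proj_iff]
    obtain ⟨t, ht, h⟩ := L.exists_lift_proj_eq p.2
    refine ⟨t, ht, ?_⟩
    change φ.1 (L.lift x) = t • φ.1 p
    rw [← map_smul, ← h, ← hp]

  · let _ := L.capAction ξ
    refine ⟨fun x y => ?_⟩
    have hx : 0 < ξ (L.lift x) := x.2
    have hy : 0 < ξ (L.lift y) := y.2
    obtain ⟨ψ, hψ, h⟩ := exists_lorentz_apply_eq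
      (coords_mem_hyperboloid hT (L.lift_mem x) hx) (coords_mem_hyperboloid hT (L.lift_mem y) hy)
    have hφ := extend_mem hT hψ.1
    refine ⟨⟨T.extend ψ, ⟨hφ.1, (extend_preserving_iff hT ψ hψ.1).2 hψ.2⟩, hφ.2⟩, ?_⟩
    apply Subtype.ext
    rw [← L.proj_lift y (L.lift_mem y)]
    refine (L.proj_eq_proj_iff _ _).2 ⟨ξ (L.lift y) * (ξ (L.lift x))⁻¹,
      mul_pos hy (inv_pos.2 hx), ?_⟩
    change L.lift y = _ • T.extend ψ (L.lift x)
    apply T.coords.injective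
    rw [map_smul, coords_extend, ← apply_eq_coords hT]
    refine Prod.ext ?_ ?_
    · rw [← apply_eq_coords hT, Prod.smul_fst, smul_eq_mul, inv_mul_cancel_right₀ hx.ne']
    · rw [Prod.smul_snd, mul_smul, ← map_smul ψ, h, smul_inv_smul₀ hy.ne']

end LorentzFrame

end PEModel

namespace PEModel

/-! ### Derivatives of vector-valued functions on manifolds -/

section MFDeriv

variable {E : Type*} [NormedAddCommGroup E] [NormedSpace ℝ E] {K : Type*} [TopologicalSpace K]
  {I : ModelWithCorners ℝ E K} {M : Type*} [TopologicalSpace M] [ChartedSpace K M]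
  {V : Type*} [NormedAddCommGroup V] [NormedSpace ℝ V]

lemma mvfderiv_linear [FiniteDimensional ℝ V] {W : Type*} [NormedAddCommGroup W] [NormedSpace ℝ W]
    (A : V →ₗ[ℝ] W) {f : M → V} {x : M}
    (hf : MDifferentiableAt I 𝓘(ℝ, V) f x) (v : TangentSpace I x) :
    mvfderiv I (fun y => A (f y)) x v = A (mvfderiv I f x v) := by
  have h := (LinearMap.toContinuousLinearMap A).hasFDerivAt.hasMFDerivAt.comp x hf.hasMFDerivAt
  have h2 : (fun y => A (f y)) = LinearMap.toContinuousLinearMap A ∘ f := rfl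
  rw [h2, mvfderiv, h.mfderiv]
  rfl

lemma mvfderiv_bilin [FiniteDimensional ℝ V] (H : LinearMap.BilinForm ℝ V) {f g : M → V} {x : M}
    (hf : MDifferentiableAt I 𝓘(ℝ, V) f x) (hg : MDifferentiableAt I 𝓘(ℝ, V) g x)
    (v : TangentSpace I x) :
    mvfderiv I (fun y => H (f y) (g y)) x v
      = H (mvfderiv I f x v) (g x) + H (f x) (mvfderiv I g x v) := by
  have h1 := H.toContinuousBilinearMap.hasFDerivWithinAt_of_bilinear hf.hasMFDerivAt.2
    hg.hasMFDerivAt.2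
  have hc : ContinuousAt (fun y => H (f y) (g y)) x :=
    (H.toContinuousBilinearMap.continuous₂.tendsto (f x, g x)).comp
      (hf.continuousAt.prodMk_nhds hg.continuousAt)
  have h2 : HasMFDerivAt I 𝓘(ℝ, ℝ) (fun y => H (f y) (g y)) x _ := ⟨hc, h1⟩
  rw [mvfderiv, h2.mfderiv]
  have h3 : writtenInExtChartAt I 𝓘(ℝ, V) x f (extChartAt I x x) = f x :=
    congrArg f (extChartAt_to_inv x)
  have h4 : writtenInExtChartAt I 𝓘(ℝ, V) x g (extChartAt I x x) = g x :=
    congrArg g (extChartAt_to_inv x)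
  rw [h3, h4]
  exact add_comm _ _

lemma mvfderiv_null [FiniteDimensional ℝ V] {H : LinearMap.BilinForm ℝ V}
    (hH : ∀ u v, H u v = H v u) {f : M → V} {x : M} (hf : MDifferentiableAt I 𝓘(ℝ, V) f x)
    (h0 : ∀ y, H (f y) (f y) = 0) (v : TangentSpace I x) : H (f x) (mvfderiv I f x v) = 0 := by
  have h := mvfderiv_bilin H hf hf v
  simp only [h0, mvfderiv_const] at h
  rw [hH (mvfderiv I f x v)] at h
  simp only [zero_apply] at h
  linarith

/-- Rescaling a map into the null cone rescales the induced form conformally. -/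
lemma form_mvfderiv_smul [FiniteDimensional ℝ V] {H : LinearMap.BilinForm ℝ V}
    (hH : ∀ u v, H u v = H v u) {f g : M → V} {a : M → ℝ} {x : M}
    (hf : MDifferentiableAt I 𝓘(ℝ, V) f x) (ha : MDifferentiableAt I 𝓘(ℝ, ℝ) a x)
    (h0 : ∀ y, H (f y) (f y) = 0) (hg : ∀ y, g y = a y • f y) (u v : TangentSpace I x) :
    H (mvfderiv I g x u) (mvfderiv I g x v)
      = a x ^ 2 * H (mvfderiv I f x u) (mvfderiv I f x v) := by
  have hg' : g = a • f := funext hg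
  have h1 := fun w => mvfderiv_null hH hf h0 w
  rw [hg', mvfderiv_smul ha hf]
  simp only [add_apply, smul_apply,
    ContinuousLinearMap.smulRight_apply, map_add, map_smul, LinearMap.add_apply,
    LinearMap.smul_apply, smul_eq_mul, h0, h1, hH _ (f x)]
  ring

lemma mvfderiv_comp_mfderivWithin_apply {E' : Type*} [NormedAddCommGroup E'] [NormedSpace ℝ E']
    {g : M → V} {f : E' → M} {s : Set E'} {x : E'} (hg : MDifferentiableAt I 𝓘(ℝ, V) g (f x))
    (hf : MDifferentiableWithinAt 𝓘(ℝ, E') I f s x) (hs : UniqueDiffWithinAt ℝ s x) (v : E') :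
    mvfderiv I g (f x) (mfderivWithin 𝓘(ℝ, E') I f s x v)
      = fderivWithin ℝ (fun y => g (f y)) s x v := by
  have h := mfderiv_comp_mfderivWithin x hg hf hs.uniqueMDiffWithinAt
  have h2 : (fun y => g (f y)) = g ∘ f := rfl
  rw [h2, ← mfderivWithin_eq_fderivWithin, h]
  rfl

lemma mvfderiv_comp_apply' {E' : Type*} [NormedAddCommGroup E'] [NormedSpace ℝ E']
    {K' : Type*} [TopologicalSpace K'] {J : ModelWithCorners ℝ E' K'} {N : Type*}
    [TopologicalSpace N] [ChartedSpace K' N] {g : M → V} {f : N → M} {x : N}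
    (hg : MDifferentiableAt I 𝓘(ℝ, V) g (f x))
    (hf : MDifferentiableAt J I f x) (v : TangentSpace J x) :
    mvfderiv J (fun y => g (f y)) x v = mvfderiv I g (f x) (mfderiv J I f x v) := by
  have h := mfderiv_comp x hg hf
  have h2 : (fun y => g (f y)) = g ∘ f := rfl
  rw [h2, mvfderiv, h]
  rfl

end MFDeriv

/-! ### Coordinate vector fields of the preferred charts -/

section Coord

variable {d : ℕ} {K : Type*} [TopologicalSpace K]
  {I : ModelWithCorners ℝ (EuclideanSpace ℝ (Fin d)) K}
  {M : Type*} [TopologicalSpace M] [ChartedSpace K M] [IsManifold I 1 M]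
  {V : Type*} [NormedAddCommGroup V] [NormedSpace ℝ V]

/-- The chain rule along the inverse chart, valid also at boundary points since the model range has
unique derivatives. It turns coefficients of tensors into partial derivatives. -/
lemma mvfderiv_coordVec {f : M → V} (p : M) {y : EuclideanSpace ℝ (Fin d)}
    (hy : y ∈ (extChartAt I p).target)
    (hf : MDifferentiableAt I 𝓘(ℝ, V) f ((extChartAt I p).symm y)) (i : Fin d) :
    mvfderiv I f _ (coordVec I p y i)
      = fderivWithin ℝ (fun z => f ((extChartAt I p).symm z)) (Set.range I) y
          (EuclideanSpace.single i 1) :=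
  mvfderiv_comp_mfderivWithin_apply hf (mdifferentiableWithinAt_extChartAt_symm hy)
    (I.uniqueDiffOn y (extChartAt_target_subset_range p hy)) _

lemma exists_coordVec_equiv (p : M) {y : EuclideanSpace ℝ (Fin d)}
    (hy : y ∈ (extChartAt I p).target) :
    ∃ B : EuclideanSpace ℝ (Fin d) ≃ₗ[ℝ] TangentSpace I ((extChartAt I p).symm y),
      ∀ i, coordVec I p y i = B (EuclideanSpace.single i 1) := by
  obtain ⟨A, hA⟩ := isInvertible_mfderivWithin_extChartAt_symm hy
  refine ⟨A.toLinearEquiv, fun i => ?_⟩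
  rw [coordVec, ← hA]
  rfl

lemma exists_sum_coordVec (p : M) {y : EuclideanSpace ℝ (Fin d)}
    (hy : y ∈ (extChartAt I p).target) (v : TangentSpace I ((extChartAt I p).symm y)) :
    ∃ c : Fin d → ℝ, v = ∑ i, c i • coordVec I p y i := by
  obtain ⟨B, hB⟩ := exists_coordVec_equiv p hy
  obtain ⟨w, rfl⟩ := B.surjective v
  refine ⟨fun i => (EuclideanSpace.basisFun (Fin d) ℝ).repr w i, ?_⟩
  simp only [hB, ← map_smul, ← map_sum]
  congr 1
  conv_lhs => rw [← (EuclideanSpace.basisFun (Fin d) ℝ).sum_repr w]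
  simp only [EuclideanSpace.basisFun_apply]

lemma sum_coordVec_injective (p : M) {y : EuclideanSpace ℝ (Fin d)}
    (hy : y ∈ (extChartAt I p).target) {c : Fin d → ℝ}
    (hc : ∑ i, c i • coordVec I p y i = 0) : c = 0 := by
  obtain ⟨B, hB⟩ := exists_coordVec_equiv p hy
  simp only [hB, ← map_smul, ← map_sum] at hc
  have h := B.injective (hc.trans (map_zero B).symm)
  funext j
  have := congrArg (fun w : EuclideanSpace ℝ (Fin d) => w j) h
  simpa [PiLp.single_apply, Pi.single_apply] using this

end Coord

end PEModel

namespace PEModel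

/-! ### The sphere as a submanifold of Euclidean space -/

section Sphere

variable {m : ℕ}

lemma contMDiff_sphere_coe : ContMDiff (𝓡 m) 𝓘(ℝ, EuclideanSpace ℝ (Fin (m + 1))) ∞
    ((↑) : Sph m → EuclideanSpace ℝ (Fin (m + 1))) :=
  haveI : Fact (Module.finrank ℝ (EuclideanSpace ℝ (Fin (m + 1))) = m + 1) := ⟨by simp⟩
  contMDiff_coe_sphere

lemma mvfderiv_sphere_coe_injective (x : Sph m) : Function.Injective
    (mvfderiv (𝓡 m) ((↑) : Sph m → EuclideanSpace ℝ (Fin (m + 1))) x) :=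
  haveI : Fact (Module.finrank ℝ (EuclideanSpace ℝ (Fin (m + 1))) = m + 1) := ⟨by simp⟩
  injective_mvfderiv_subtypeVal_sphere x

lemma contMDiff_sphere_mk {E : Type*} [NormedAddCommGroup E] [NormedSpace ℝ E] {K : Type*}
    [TopologicalSpace K] {I : ModelWithCorners ℝ E K} {M : Type*} [TopologicalSpace M]
    [ChartedSpace K M] [IsManifold I ∞ M] {f : M → EuclideanSpace ℝ (Fin (m + 1))}
    (hf : ContMDiff I 𝓘(ℝ, EuclideanSpace ℝ (Fin (m + 1))) ∞ f)
    (h : ∀ x, f x ∈ Metric.sphere (0 : EuclideanSpace ℝ (Fin (m + 1))) 1) :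
    ContMDiff I (𝓡 m) ∞ (fun x => (⟨f x, h x⟩ : Sph m)) :=
  haveI : Fact (Module.finrank ℝ (EuclideanSpace ℝ (Fin (m + 1))) = m + 1) := ⟨by simp⟩
  hf.codRestrict_sphere h

/-- The preferred charts are stereographic projections; hence null lifts of scales can be taken over
all of `ℝ^d`. -/
lemma extChartAt_sphere_target (x : Sph m) : (extChartAt (𝓡 m) x).target = Set.univ := by
  have : Fact (Module.finrank ℝ (EuclideanSpace ℝ (Fin (m + 1))) = m + 1) := ⟨by simp⟩
  rw [extChartAt_target]
  change _ ⁻¹' (stereographic' m (-x)).target ∩ _ = _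
  rw [stereographic'_target]
  simp

end Sphere

namespace LorentzFrame

variable {n : ℕ} {H : LinearMap.BilinForm ℝ (EuclideanSpace ℝ (Fin (n + 3)))}
  (L : LorentzFrame n H)

/-! ### Scales and the conformal class of the round metric -/

lemma lift_eq (x : Sph (n + 1)) : L.lift x
    = L.toEquiv.symm ((x : EuclideanSpace ℝ (Fin (n + 2))), 0) + L.toEquiv.symm (0, 1) := by
  rw [← map_add, lift]
  simp

lemma contMDiff_linear {E : Type*} [NormedAddCommGroup E] [NormedSpace ℝ E] {K : Type*}
    [TopologicalSpace K] {I : ModelWithCorners ℝ E K} {M : Type*} [TopologicalSpace M]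
    [ChartedSpace K M] {V W : Type*} [NormedAddCommGroup V] [NormedSpace ℝ V]
    [FiniteDimensional ℝ V] [NormedAddCommGroup W] [NormedSpace ℝ W] (A : V →ₗ[ℝ] W) {f : M → V}
    (hf : ContMDiff I 𝓘(ℝ, V) ∞ f) : ContMDiff I 𝓘(ℝ, W) ∞ (fun x => A (f x)) :=
  (LinearMap.toContinuousLinearMap A).contDiff.contMDiff.comp hf

lemma contMDiff_lift :
    ContMDiff (𝓡 (n + 1)) 𝓘(ℝ, EuclideanSpace ℝ (Fin (n + 3))) ∞ L.lift := by
  have h1 := contMDiff_linear (L.toEquiv.symm.toLinearMap ∘ₗ LinearMap.inl ℝ _ _)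
    contMDiff_sphere_coe
  have h2 := h1.add (contMDiff_const (c := L.toEquiv.symm (0, 1)))
  exact h2.congr fun x => L.lift_eq x

lemma mdifferentiableAt_lift (x : Sph (n + 1)) :
    MDifferentiableAt (𝓡 (n + 1)) 𝓘(ℝ, EuclideanSpace ℝ (Fin (n + 3))) L.lift x :=
  L.contMDiff_lift.mdifferentiableAt (by simp)

lemma mvfderiv_lift (x : Sph (n + 1)) (v : TangentSpace (𝓡 (n + 1)) x) :
    mvfderiv (𝓡 (n + 1)) L.lift x v = L.toEquiv.symm
      (mvfderiv (𝓡 (n + 1)) ((↑) : Sph (n + 1) → EuclideanSpace ℝ (Fin (n + 2))) x v, 0) := by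
  have hcoe : MDifferentiableAt (𝓡 (n + 1)) 𝓘(ℝ, EuclideanSpace ℝ (Fin (n + 2)))
      ((↑) : Sph (n + 1) → EuclideanSpace ℝ (Fin (n + 2))) x :=
    contMDiff_sphere_coe.mdifferentiableAt (by simp)
  set A := L.toEquiv.symm.toLinearMap ∘ₗ LinearMap.inl ℝ (EuclideanSpace ℝ (Fin (n + 2))) ℝ
  have h1 := mvfderiv_linear A hcoe v
  have h2 : L.lift = (fun y : Sph (n + 1) => A (y : EuclideanSpace ℝ (Fin (n + 2))))
      + fun _ => L.toEquiv.symm (0, 1) := funext L.lift_eq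
  have h3 : MDifferentiableAt (𝓡 (n + 1)) 𝓘(ℝ, EuclideanSpace ℝ (Fin (n + 3)))
      (fun y : Sph (n + 1) => A (y : EuclideanSpace ℝ (Fin (n + 2)))) x :=
    (contMDiff_linear A contMDiff_sphere_coe).mdifferentiableAt (by simp)
  rw [h2, mvfderiv_add h3 mdifferentiableAt_const, mvfderiv_const, add_zero, h1]
  rfl

/-- The last coordinate of `lift` is constant, so only the Euclidean part of the form sees its
derivative. -/
lemma form_mvfderiv_lift (x : Sph (n + 1)) (u v : TangentSpace (𝓡 (n + 1)) x) :
    H (mvfderiv (𝓡 (n + 1)) L.lift x u) (mvfderiv (𝓡 (n + 1)) L.lift x v)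
      = roundMetric (n + 1) x u v := by
  rw [mvfderiv_lift, mvfderiv_lift, L.isometry]
  simp [minkowski_apply, roundMetric]

lemma form_lift (x : Sph (n + 1)) : H (L.lift x) (L.lift x) = 0 := (L.lift_mem x).1

/-- The factor of a scale, relative to the standard one. -/
noncomputable def factor (s : Sph (n + 1) → EuclideanSpace ℝ (Fin (n + 3)))
    (x : Sph (n + 1)) : ℝ :=
  (L.toEquiv (s x)).2

namespace IsScale

variable {L} {s : Sph (n + 1) → EuclideanSpace ℝ (Fin (n + 3))} (hs : L.IsScale s)
include hs

lemma factor_pos (x : Sph (n + 1)) : 0 < L.factor s x := (hs.section_proj x).1.2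

lemma mem_cone (x : Sph (n + 1)) : s x ∈ L.cone := (hs.section_proj x).1

lemma eq_smul (x : Sph (n + 1)) : s x = L.factor s x • L.lift x := by
  obtain ⟨h, hx⟩ := hs.section_proj x
  have := L.eq_smul_lift ⟨s x, h⟩
  rwa [hx] at this

lemma contMDiff_factor : ContMDiff (𝓡 (n + 1)) 𝓘(ℝ, ℝ) ∞ (L.factor s) :=
  contMDiff_linear (LinearMap.snd ℝ _ _ ∘ₗ L.toEquiv.toLinearMap) hs.smooth

lemma mdifferentiableAt (x : Sph (n + 1)) :
    MDifferentiableAt (𝓡 (n + 1)) 𝓘(ℝ, EuclideanSpace ℝ (Fin (n + 3))) s x :=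
  hs.smooth.mdifferentiableAt (by simp)

lemma form_self (x : Sph (n + 1)) : H (s x) (s x) = 0 := (hs.mem_cone x).1

lemma scaleMetric_eq (x : Sph (n + 1)) (u v : TangentSpace (𝓡 (n + 1)) x) :
    scaleMetric H s x u v = L.factor s x ^ 2 * roundMetric (n + 1) x u v := by
  rw [← L.form_mvfderiv_lift]
  exact form_mvfderiv_smul L.form_symm (L.mdifferentiableAt_lift x)
    (hs.contMDiff_factor.mdifferentiableAt (by simp)) L.form_lift hs.eq_smul u v

lemma scaleMetric_pos (x : Sph (n + 1)) {u : TangentSpace (𝓡 (n + 1)) x} (hu : u ≠ 0) :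
    0 < scaleMetric H s x u u := by
  rw [hs.scaleMetric_eq]
  refine mul_pos (pow_pos (hs.factor_pos x) 2) (real_inner_self_pos.2 fun h => hu ?_)
  apply mvfderiv_sphere_coe_injective x
  rw [h, map_zero]

end IsScale

lemma isScale_smul_lift {f : Sph (n + 1) → ℝ} (hf : ContMDiff (𝓡 (n + 1)) 𝓘(ℝ, ℝ) ∞ f)
    (hpos : ∀ x, 0 < f x) : L.IsScale fun x => f x • L.lift x where
  smooth := hf.smul L.contMDiff_lift
  section_proj x := by
    have h := L.smul_mem_cone (L.lift_mem x) (hpos x)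
    exact ⟨h, by rw [L.proj_smul (L.lift_mem x) (hpos x), proj_lift]⟩

lemma mem_cone_or_neg_mem_cone {p : EuclideanSpace ℝ (Fin (n + 3))} (hp : p ≠ 0)
    (h : H p p = 0) : p ∈ L.cone ∨ -p ∈ L.cone := by
  rcases lt_trichotomy (L.toEquiv p).2 0 with h1 | h1 | h1
  · right
    exact ⟨by simp [h], by simpa using h1⟩
  · exfalso
    rw [L.isometry, minkowski_self, h1] at h
    have h2 : (L.toEquiv p).1 = 0 := by simpa using h
    exact hp (L.toEquiv.injective ((Prod.ext h2 h1).trans (map_zero _).symm))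
  · exact Or.inl ⟨h, h1⟩

theorem conformal_class : (∀ p, p ≠ 0 → H p p = 0 → (p ∈ L.cone ∨ -p ∈ L.cone)) ∧
      Function.Surjective L.proj ∧
      (∀ p q : L.cone, L.proj p = L.proj q ↔
        ∃ t : ℝ, 0 < t ∧ (q : EuclideanSpace ℝ (Fin (n + 3))) = t • p) ∧
      (∀ s, L.IsScale s → ∃ f : Sph (n + 1) → ℝ, ContMDiff (𝓡 (n + 1)) 𝓘(ℝ, ℝ) ∞ f ∧
        (∀ x, 0 < f x) ∧ ∀ x u v, scaleMetric H s x u v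
          = f x ^ 2 * roundMetric (n + 1) x u v) ∧
      (∀ f : Sph (n + 1) → ℝ, ContMDiff (𝓡 (n + 1)) 𝓘(ℝ, ℝ) ∞ f → (∀ x, 0 < f x) →
        ∃ s, L.IsScale s ∧ ∀ x u v, scaleMetric H s x u v
          = f x ^ 2 * roundMetric (n + 1) x u v) := by
  refine ⟨fun p hp h => L.mem_cone_or_neg_mem_cone hp h, fun x => ⟨_, L.proj_lift x (L.lift_mem x)⟩,
    L.proj_eq_proj_iff, fun s hs => ⟨L.factor s, hs.contMDiff_factor, hs.factor_pos,
      hs.scaleMetric_eq⟩, fun f hf hpos => ?_⟩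
  have hs := L.isScale_smul_lift hf hpos
  refine ⟨_, hs, fun x u v => ?_⟩
  rw [hs.scaleMetric_eq]
  simp [factor, toEquiv_lift]

/-! ### The constant section of the tractor bundle -/

/-- The action moves the base point along its ray but leaves the vector unchanged, as `t⁻¹ (t u) =
u`. A tractor therefore has exactly one representative at each point of its ray, which makes the
choice in `along` harmless. -/
lemma tractorMk_eq_iff (p : L.cone) (u v : EuclideanSpace ℝ (Fin (n + 3))) :
    L.tractorMk p u = L.tractorMk p v ↔ u = v := by
  refine ⟨fun h => ?_, fun h => by rw [h]⟩
  obtain ⟨t, ht, -, h2⟩ := Quotient.exact h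
  have : v = t⁻¹ • (t • u) := h2
  rw [this, inv_smul_smul₀ ht.ne']

lemma tractorMk_eq_of_proj_eq {p q : L.cone} (h : L.proj p = L.proj q)
    (u : EuclideanSpace ℝ (Fin (n + 3))) : L.tractorMk p u = L.tractorMk q u := by
  obtain ⟨t, ht, h2⟩ := (L.proj_eq_proj_iff p q).1 h
  exact Quotient.sound ⟨t, ht, h2, (inv_smul_smul₀ ht.ne' u).symm⟩

lemma along_eq_of_eq {s : Sph (n + 1) → EuclideanSpace ℝ (Fin (n + 3))}
    {S : Sph (n + 1) → L.TractorBundle} {x : Sph (n + 1)} {u : EuclideanSpace ℝ (Fin (n + 3))}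
    (hs : s x ∈ L.cone) (h : S x = L.tractorMk ⟨s x, hs⟩ u) : L.along s S x = u := by
  have h1 : ∃ (hs : s x ∈ L.cone) (u : EuclideanSpace ℝ (Fin (n + 3))),
    S x = L.tractorMk ⟨s x, hs⟩ u := ⟨hs, u, h⟩
  rw [along, dif_pos h1, ← L.tractorMk_eq_iff ⟨s x, hs⟩, ← h]
  exact h1.choose_spec.choose_spec.symm

/-- The class of `u` is the same at all points of a ray, and the representing field along every
scale is the constant `u`. -/
theorem existsUnique_parallel_section (u : EuclideanSpace ℝ (Fin (n + 3))) :
    ∃! S : Sph (n + 1) → L.TractorBundle,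
        (∀ p : L.cone, S (L.proj p) = L.tractorMk p u) ∧ L.IsParallelSection S := by
  let S : Sph (n + 1) → L.TractorBundle := fun x => L.tractorMk ⟨L.lift x, L.lift_mem x⟩ u
  have hS : ∀ p : L.cone, S (L.proj p) = L.tractorMk p u := fun p =>
    L.tractorMk_eq_of_proj_eq (L.proj_lift _ _) u
  have halong : ∀ s, L.IsScale s → L.along s S = fun _ => u := fun s hs => funext fun x => by
    obtain ⟨h, hx⟩ := hs.section_proj x
    refine L.along_eq_of_eq h ?_
    rw [← hS, hx]
  refine ⟨S, ⟨hS, fun x => L.proj_lift x (L.lift_mem x), fun s hs => ?_, fun s hs x v => ?_⟩, ?_⟩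
  · rw [halong s hs]
    exact contMDiff_const
  · rw [halong s hs, mvfderiv_const]
    rfl
  · rintro S' ⟨hS', -⟩
    funext x
    rw [← L.proj_lift x (L.lift_mem x), hS', hS]

end LorentzFrame

end PEModel

namespace PEModel

/-! ### The parallel triple of a scale -/

namespace LorentzFrame

variable {n : ℕ} {H : LinearMap.BilinForm ℝ (EuclideanSpace ℝ (Fin (n + 3)))}
  {L : LorentzFrame n H} {s : Sph (n + 1) → EuclideanSpace ℝ (Fin (n + 3))}

/-- The null vector `(x, -1) / 2`, which is transversal to the cone along the point `x`. -/
noncomputable def colift (L : LorentzFrame n H) (x : Sph (n + 1)) :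
    EuclideanSpace ℝ (Fin (n + 3)) :=
  (2⁻¹ : ℝ) • L.lift x - L.toEquiv.symm (0, 1)

lemma form_colift_lift (L : LorentzFrame n H) (x : Sph (n + 1)) :
    H (L.colift x) (L.lift x) = 1 := by
  rw [colift, map_sub, LinearMap.sub_apply, map_smul, LinearMap.smul_apply, form_lift, L.isometry,
    LinearEquiv.apply_symm_apply, toEquiv_lift]
  simp [minkowski_apply]

namespace IsScale

variable (hs : L.IsScale s)
include hs

lemma contDiff_chart (p : Sph (n + 1)) :
    ContDiff ℝ ∞ fun y => s ((extChartAt (𝓡 (n + 1)) p).symm y) := by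
  rw [← contDiffOn_univ, ← extChartAt_sphere_target p, ← contMDiffOn_iff_contDiffOn]
  exact hs.smooth.comp_contMDiffOn (contMDiffOn_extChartAt_symm p)

lemma mvfderiv_coordVec_eq (p : Sph (n + 1)) (y : EuclideanSpace ℝ (Fin (n + 1)))
    (i : Fin (n + 1)) : mvfderiv (𝓡 (n + 1)) s _ (coordVec (𝓡 (n + 1)) p y i)
      = dirDeriv (fun y => s ((extChartAt (𝓡 (n + 1)) p).symm y)) y i := by
  have hy : y ∈ (extChartAt (𝓡 (n + 1)) p).target := by
    rw [extChartAt_sphere_target]; trivial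
  rw [mvfderiv_coordVec p hy (hs.mdifferentiableAt _)]
  simp [dirDeriv]

lemma gram_eq (p : Sph (n + 1)) (y : EuclideanSpace ℝ (Fin (n + 1))) (i j : Fin (n + 1)) :
    gram (𝓡 (n + 1)) (scaleMetric H s) p y i j
      = H (dirDeriv (fun y => s ((extChartAt (𝓡 (n + 1)) p).symm y)) y i)
          (dirDeriv (fun y => s ((extChartAt (𝓡 (n + 1)) p).symm y)) y j) := by
  rw [← hs.mvfderiv_coordVec_eq, ← hs.mvfderiv_coordVec_eq]
  rfl

/-- A kernel vector of the Gram matrix would be a nonzero tangent vector of length zero. -/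
lemma isUnit_det_gram (p : Sph (n + 1)) (y : EuclideanSpace ℝ (Fin (n + 1))) :
    IsUnit (gram (𝓡 (n + 1)) (scaleMetric H s) p y).det := by
  have hy : y ∈ (extChartAt (𝓡 (n + 1)) p).target := by
    rw [extChartAt_sphere_target]; trivial
  rw [isUnit_iff_ne_zero, Ne, ← Matrix.exists_mulVec_eq_zero_iff]
  rintro ⟨c, hc, h⟩
  have h1 : ∑ i, c i • coordVec (𝓡 (n + 1)) p y i ≠ 0 := fun h0 =>
    hc (sum_coordVec_injective p hy h0)
  have h2 := hs.scaleMetric_pos _ h1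
  have h3 : scaleMetric H s _ (∑ i, c i • coordVec (𝓡 (n + 1)) p y i)
      (∑ i, c i • coordVec (𝓡 (n + 1)) p y i)
      = ∑ i, c i * (gram (𝓡 (n + 1)) (scaleMetric H s) p y).mulVec c i := by
    simp only [scaleMetric, map_sum, map_smul, LinearMap.sum_apply, LinearMap.smul_apply,
      smul_eq_mul, Matrix.mulVec, dotProduct, Finset.mul_sum]
    rw [Finset.sum_comm]
    refine Finset.sum_congr rfl fun i _ => Finset.sum_congr rfl fun j _ => ?_
    rw [hs.gram_eq, ← hs.mvfderiv_coordVec_eq, ← hs.mvfderiv_coordVec_eq]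
    ring
  rw [h3, h] at h2
  simp at h2

lemma exists_isNullLift (p : Sph (n + 1)) : ∃ Y, IsNullLift H Set.univ
    (gram (𝓡 (n + 1)) (scaleMetric H s) p) (fun y => s ((extChartAt (𝓡 (n + 1)) p).symm y)) Y := by
  have hZ : ContMDiff (𝓡 (n + 1)) 𝓘(ℝ, EuclideanSpace ℝ (Fin (n + 3))) ∞
      fun x => (L.factor s x)⁻¹ • L.colift x := by
    refine ContMDiff.smul (hs.contMDiff_factor.inv₀ fun x => (hs.factor_pos x).ne') ?_
    exact (contMDiff_linear ((2⁻¹ : ℝ) • LinearMap.id) L.contMDiff_lift).sub contMDiff_const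
  refine PEModel.exists_isNullLift
    (Z := fun y => (L.factor s ((extChartAt (𝓡 (n + 1)) p).symm y))⁻¹ •
      L.colift ((extChartAt (𝓡 (n + 1)) p).symm y))
    L.form_symm (by simp) isOpen_univ (hs.contDiff_chart p).contDiffOn ?_
    (fun y _ => hs.form_self _) (fun y _ => ?_) (fun y _ => hs.gram_eq p y)
    (fun y _ => hs.isUnit_det_gram p y)
  · rw [← extChartAt_sphere_target p, ← contMDiffOn_iff_contDiffOn]
    exact hZ.comp_contMDiffOn (contMDiffOn_extChartAt_symm p)
  · have h := (hs.factor_pos ((extChartAt (𝓡 (n + 1)) p).symm y)).ne'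
    rw [hs.eq_smul ((extChartAt (𝓡 (n + 1)) p).symm y)]
    simp only [map_smul, LinearMap.smul_apply, form_colift_lift, smul_eq_mul, mul_one]
    exact mul_inv_cancel₀ h

/-- Each chart carries a null lift of the scale. Uniqueness glues their complementary fields to a
global smooth `Y`, and the equations of the triple are the structure equations evaluated on `ξ`. -/
theorem parallelTriple (hn : 2 ≤ n) (ξ : Module.Dual ℝ (EuclideanSpace ℝ (Fin (n + 3)))) :
    ∃ Y : Sph (n + 1) → EuclideanSpace ℝ (Fin (n + 3)),
        (∀ x, H (Y x) (Y x) = 0 ∧ H (Y x) (s x) = 1 ∧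
          ∀ v, H (Y x) (mvfderiv (𝓡 (n + 1)) s x v) = 0) ∧
        IsParallelTriple (𝓡 (n + 1)) (scaleMetric H s)
          (fun x => ξ (s x)) (fun x v => ξ (mvfderiv (𝓡 (n + 1)) s x v)) (fun x => ξ (Y x)) := by
  choose Yc hYc using hs.exists_isNullLift
  -- The value at `x` is taken from the chart at `x` itself; `hYchart` shows that every other chart
  -- gives the same value.
  let Y : Sph (n + 1) → EuclideanSpace ℝ (Fin (n + 3)) := fun x =>
    Yc x (extChartAt (𝓡 (n + 1)) x x)
  have hnormal : ∀ (p : Sph (n + 1)) (y : EuclideanSpace ℝ (Fin (n + 1)))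
      (v : TangentSpace (𝓡 (n + 1)) ((extChartAt (𝓡 (n + 1)) p).symm y)),
      H (Yc p y) (mvfderiv (𝓡 (n + 1)) s _ v) = 0 := fun p y v => by
    have hy : y ∈ (extChartAt (𝓡 (n + 1)) p).target := by
      rw [extChartAt_sphere_target]; trivial
    obtain ⟨c, rfl⟩ := exists_sum_coordVec p hy v
    simp only [map_sum, map_smul, hs.mvfderiv_coordVec_eq, (hYc p).normal y trivial, smul_zero,
      Finset.sum_const_zero]
  have hY : ∀ x, H (Y x) (Y x) = 0 ∧ H (Y x) (s x) = 1 ∧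
      ∀ v, H (Y x) (mvfderiv (𝓡 (n + 1)) s x v) = 0 := fun x => by
    refine ⟨(hYc x).null' _ trivial, ?_, ?_⟩
    · have := (hYc x).pairing (extChartAt (𝓡 (n + 1)) x x) trivial
      rwa [extChartAt_to_inv] at this
    · have := hnormal x (extChartAt (𝓡 (n + 1)) x x)
      rwa [extChartAt_to_inv] at this
  have hYchart : ∀ p y, Y ((extChartAt (𝓡 (n + 1)) p).symm y) = Yc p y := fun p y => by
    obtain ⟨h1, h2, h3⟩ := hY ((extChartAt (𝓡 (n + 1)) p).symm y)
    refine (hYc p).eq_normal trivial h1 h2 fun i => ?_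
    rw [← hs.mvfderiv_coordVec_eq]
    exact h3 _
  have hYsmooth : ContMDiff (𝓡 (n + 1)) 𝓘(ℝ, EuclideanSpace ℝ (Fin (n + 3))) ∞ Y := fun p => by
    have h1 : ContMDiff 𝓘(ℝ, EuclideanSpace ℝ (Fin (n + 1)))
        𝓘(ℝ, EuclideanSpace ℝ (Fin (n + 3))) ∞ (Yc p) :=
      (contDiffOn_univ.1 (hYc p).smooth').contMDiff
    refine (h1.contMDiffAt.comp p (contMDiffAt_extChartAt (I := 𝓡 (n + 1)))).congr_of_eventuallyEq ?_
    filter_upwards [extChartAt_source_mem_nhds (I := 𝓡 (n + 1)) p] with x hx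
    rw [Function.comp_apply, ← hYchart, (extChartAt (𝓡 (n + 1)) p).left_inv hx]
  have hdiff : ∀ p y i, DifferentiableAt ℝ (fun z =>
      dirDeriv (fun y => s ((extChartAt (𝓡 (n + 1)) p).symm y)) z i) y := fun p y i =>
    (hYc p).diff_dirDeriv trivial i
  have hrange : Set.univ ⊆ Set.range (𝓡 (n + 1)) := by simp
  refine ⟨Y, hY, contMDiff_linear ξ hs.smooth, contMDiff_linear ξ hYsmooth, fun p v => ?_,
    fun p a b => ?_, fun p a => ?_⟩
  · rw [mvfderiv_linear ξ (hs.mdifferentiableAt p), sub_self]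
  -- The arithmetic side goal is `3 ≤ n + 1`.
  · have h := (hYc p).middle_eq (y := extChartAt (𝓡 (n + 1)) p p) trivial hrange (by omega) ξ a b
    rw [pd_eq_dirDeriv isOpen_univ hrange
      (fun y _ => by rw [hs.mvfderiv_coordVec_eq]) trivial, dirDeriv_linear ξ (hdiff p _ b)]
    simp only [hs.mvfderiv_coordVec_eq]
    simpa only [extChartAt_to_inv] using h
  · have h := (hYc p).bottom_eq (y := extChartAt (𝓡 (n + 1)) p p) trivial hrange (by omega) ξ a
    rw [pd_eq_dirDeriv isOpen_univ hrange
      (fun y _ => by rw [hYchart]) trivial, dirDeriv_linear ξ ((hYc p).diff' trivial)]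
    simp only [hs.mvfderiv_coordVec_eq]
    exact h

end IsScale

end LorentzFrame

end PEModel

namespace PEModel

/-! ### The null cone as a paraboloid -/

/-- The splitting of the last coordinate off Euclidean space. -/
noncomputable def euclideanSplit (m : ℕ) : EuclideanSpace ℝ (Fin (m + 1)) ≃ₗ[ℝ]
    EuclideanSpace ℝ (Fin m) × ℝ where
  toFun p := (WithLp.toLp 2 fun i => p i.castSucc, p (Fin.last m))
  invFun q := WithLp.toLp 2 (Fin.snoc q.1 q.2)
  map_add' _ _ := rfl
  map_smul' _ _ := rfl
  left_inv p := by
    ext i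
    refine Fin.lastCases ?_ (fun j => ?_) i <;> simp
  right_inv q := by
    refine Prod.ext ?_ (by simp)
    ext i
    simp

lemma inner_eq_euclideanSplit {m : ℕ} (u v : EuclideanSpace ℝ (Fin (m + 1))) : inner ℝ u v
    = inner ℝ (euclideanSplit m u).1 (euclideanSplit m v).1
      + (euclideanSplit m u).2 * (euclideanSplit m v).2 := by
  simp only [PiLp.inner_apply, Fin.sum_univ_castSucc, RCLike.inner_apply, conj_trivial]
  rw [mul_comm (v (Fin.last m))]
  rfl

namespace LorentzFrame

variable {n : ℕ} {H : LinearMap.BilinForm ℝ (EuclideanSpace ℝ (Fin (n + 3)))}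

/-- The coordinates of a Lorentz frame, with the last two singled out. -/
noncomputable def flat (T : LorentzFrame n H) :
    EuclideanSpace ℝ (Fin (n + 3)) ≃ₗ[ℝ] (EuclideanSpace ℝ (Fin (n + 1)) × ℝ) × ℝ :=
  T.toEquiv.trans ((euclideanSplit (n + 1)).prodCongr (LinearEquiv.refl ℝ ℝ))

variable (T : LorentzFrame n H)

lemma form_eq_flat (u v : EuclideanSpace ℝ (Fin (n + 3))) :
    H u v = inner ℝ (T.flat u).1.1 (T.flat v).1.1 + (T.flat u).1.2 * (T.flat v).1.2
      - (T.flat u).2 * (T.flat v).2 := by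
  rw [T.isometry, minkowski_apply, inner_eq_euclideanSplit]
  rfl

lemma flat_zero (p : EuclideanSpace ℝ (Fin (n + 3))) :
    (T.flat p).1.1 0 = (T.toEquiv p).1 0 := rfl

lemma flat_time (p : EuclideanSpace ℝ (Fin (n + 3))) : (T.flat p).2 = (T.toEquiv p).2 := rfl

/-- The section of the null cone over `ℝ^d` on which `denom` is `1`. -/
noncomputable def nullParam (y : EuclideanSpace ℝ (Fin (n + 1))) : EuclideanSpace ℝ (Fin (n + 3)) :=
  T.flat.symm ((y, (1 - inner ℝ y y) / 2), (1 + inner ℝ y y) / 2)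

lemma flat_nullParam (y : EuclideanSpace ℝ (Fin (n + 1))) :
    T.flat (T.nullParam y) = ((y, (1 - inner ℝ y y) / 2), (1 + inner ℝ y y) / 2) :=
  T.flat.apply_symm_apply _

/-- The denominator of the stereographic projection. -/
noncomputable def denom : EuclideanSpace ℝ (Fin (n + 3)) →ₗ[ℝ] ℝ :=
  (LinearMap.snd ℝ _ _ ∘ₗ LinearMap.fst ℝ _ _ + LinearMap.snd ℝ _ _) ∘ₗ T.flat.toLinearMap

lemma denom_apply (p : EuclideanSpace ℝ (Fin (n + 3))) :
    T.denom p = (T.flat p).1.2 + (T.flat p).2 := rfl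

/-- The numerator of the stereographic projection. -/
noncomputable def numer : EuclideanSpace ℝ (Fin (n + 3)) →ₗ[ℝ] EuclideanSpace ℝ (Fin (n + 1)) :=
  (LinearMap.fst ℝ _ _ ∘ₗ LinearMap.fst ℝ _ _) ∘ₗ T.flat.toLinearMap

lemma numer_apply (p : EuclideanSpace ℝ (Fin (n + 3))) : T.numer p = (T.flat p).1.1 := rfl

/-- Stereographic projection, as a function on the null cone. -/
noncomputable def stereo (p : EuclideanSpace ℝ (Fin (n + 3))) : EuclideanSpace ℝ (Fin (n + 1)) :=
  (T.denom p)⁻¹ • T.numer p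

lemma denom_nullParam (y : EuclideanSpace ℝ (Fin (n + 1))) : T.denom (T.nullParam y) = 1 := by
  rw [denom_apply, flat_nullParam]
  ring

lemma stereo_nullParam (y : EuclideanSpace ℝ (Fin (n + 1))) : T.stereo (T.nullParam y) = y := by
  rw [stereo, denom_nullParam, numer_apply, flat_nullParam, inv_one, one_smul]

lemma form_nullParam (y : EuclideanSpace ℝ (Fin (n + 1))) :
    H (T.nullParam y) (T.nullParam y) = 0 := by
  rw [T.form_eq_flat, flat_nullParam]
  ring

lemma nullParam_mem (y : EuclideanSpace ℝ (Fin (n + 1))) : T.nullParam y ∈ T.cone := by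
  refine ⟨T.form_nullParam y, ?_⟩
  rw [← flat_time, flat_nullParam]
  have := real_inner_self_nonneg (x := y)
  positivity

lemma denom_nonneg {p : EuclideanSpace ℝ (Fin (n + 3))} (hp : p ∈ T.cone) : 0 ≤ T.denom p := by
  obtain ⟨h1, h2⟩ := hp
  rw [← flat_time] at h2
  rw [form_eq_flat] at h1
  have := real_inner_self_nonneg (x := (T.flat p).1.1)
  rw [denom_apply]
  nlinarith

lemma stereo_smul {t : ℝ} (ht : t ≠ 0) (p : EuclideanSpace ℝ (Fin (n + 3))) :
    T.stereo (t • p) = T.stereo p := by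
  rw [stereo, stereo, map_smul, map_smul, smul_smul, smul_eq_mul, mul_inv_rev, mul_assoc,
    inv_mul_cancel₀ ht, mul_one]

/-- With `z` the first block of coordinates and `a`, `t` the last two, the cone is `|z|² = (t - a)(t
+ a)`. Dividing by `t + a` makes the last two coordinates `(1 ∓ |y|²)/2`. -/
lemma nullParam_stereo {p : EuclideanSpace ℝ (Fin (n + 3))} (hp : p ∈ T.cone)
    (h : T.denom p ≠ 0) : T.nullParam (T.stereo p) = (T.denom p)⁻¹ • p := by
  apply T.flat.injective
  rw [flat_nullParam, map_smul]
  have h1 : H p p = 0 := hp.1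
  rw [form_eq_flat] at h1
  have h2 : inner ℝ (T.stereo p) (T.stereo p)
      = (T.denom p)⁻¹ ^ 2 * inner ℝ (T.flat p).1.1 (T.flat p).1.1 := by
    rw [stereo, real_inner_smul_left, real_inner_smul_right, numer_apply]
    ring
  have h3 : inner ℝ (T.flat p).1.1 (T.flat p).1.1 = T.denom p * ((T.flat p).2 - (T.flat p).1.2) := by
    rw [denom_apply]
    linear_combination h1
  rw [h2, h3]
  refine Prod.ext (Prod.ext rfl ?_) ?_
  · change _ = (T.denom p)⁻¹ * (T.flat p).1.2
    field_simp
    rw [denom_apply]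
    ring
  · change _ = (T.denom p)⁻¹ * (T.flat p).2
    field_simp
    rw [denom_apply]
    ring

lemma nullParam_eq (y : EuclideanSpace ℝ (Fin (n + 1))) : T.nullParam y
    = T.flat.symm ((y, 0), 0) + (inner ℝ y y) • T.flat.symm ((0, -(1 / 2)), 1 / 2)
      + T.flat.symm ((0, 1 / 2), 1 / 2) := by
  rw [← map_smul, ← map_add, ← map_add, nullParam]
  congr 1
  refine Prod.ext (Prod.ext ?_ ?_) ?_
  · simp
  · simp only [Prod.fst_add, Prod.snd_add, Prod.smul_fst, Prod.smul_snd, smul_eq_mul]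
    ring
  · simp only [Prod.snd_add, Prod.smul_snd, smul_eq_mul]
    ring

lemma contDiff_nullParam : ContDiff ℝ ∞ T.nullParam := by
  have h0 : T.nullParam = fun y => T.flat.symm ((y, 0), 0)
      + (inner ℝ y y) • T.flat.symm ((0, -(1 / 2)), 1 / 2)
      + T.flat.symm ((0, 1 / 2), 1 / 2) := funext T.nullParam_eq
  have h1 : ContDiff ℝ ∞ fun y : EuclideanSpace ℝ (Fin (n + 1)) => T.flat.symm ((y, 0), 0) :=
    (LinearMap.toContinuousLinearMap (T.flat.symm.toLinearMap ∘ₗ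
      (LinearMap.inl ℝ _ _ ∘ₗ LinearMap.inl ℝ _ _))).contDiff
  rw [h0]
  exact (h1.add ((contDiff_id.inner ℝ contDiff_id).smul contDiff_const)).add contDiff_const

lemma dirDeriv_nullParam (y : EuclideanSpace ℝ (Fin (n + 1))) (i : Fin (n + 1)) :
    T.flat (dirDeriv T.nullParam y i) = ((EuclideanSpace.single i 1, -y i), y i) := by
  have h1 := (LinearMap.toContinuousLinearMap (T.flat.symm.toLinearMap ∘ₗ
      (LinearMap.inl ℝ (EuclideanSpace ℝ (Fin (n + 1)) × ℝ) ℝ ∘ₗ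
        LinearMap.inl ℝ _ _))).hasFDerivAt (x := y)
  have h2 := (((hasFDerivAt_id y).inner ℝ (hasFDerivAt_id y)).smul_const
    (T.flat.symm ((0, -(1 / 2)), 1 / 2)))
  have h3 := (h1.add h2).add_const (T.flat.symm ((0, 1 / 2), 1 / 2))
  have h4 : HasFDerivAt T.nullParam _ y := h3.congr_of_eventuallyEq
    (Filter.Eventually.of_forall T.nullParam_eq)
  rw [dirDeriv, h4.fderiv]
  simp only [add_apply, map_add]
  have h5 : ∀ w : EuclideanSpace ℝ (Fin (n + 1)), (LinearMap.toContinuousLinearMap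
      (T.flat.symm.toLinearMap ∘ₗ (LinearMap.inl ℝ (EuclideanSpace ℝ (Fin (n + 1)) × ℝ) ℝ ∘ₗ
        LinearMap.inl ℝ _ _))) w = T.flat.symm ((w, 0), 0) := fun _ => rfl
  rw [h5]
  simp only [ContinuousLinearMap.smulRight_apply, ContinuousLinearMap.comp_apply,
    map_smul, LinearEquiv.apply_symm_apply]
  have h6 : (fderivInnerCLM ℝ (id y, id y)) (((ContinuousLinearMap.id ℝ
      (EuclideanSpace ℝ (Fin (n + 1)))).prod (ContinuousLinearMap.id ℝ _))
        (EuclideanSpace.single i 1)) = 2 * y i := by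
    simp [fderivInnerCLM_apply, EuclideanSpace.inner_single_right, EuclideanSpace.inner_single_left]
    ring
  rw [h6]
  refine Prod.ext (Prod.ext ?_ ?_) ?_
  · simp
  · change 0 + 2 * y i * -(1 / 2) = -y i
    ring
  · change 0 + 2 * y i * (1 / 2) = y i
    ring

/-- The last two components of the derivatives contribute `yᵢ yⱼ - yᵢ yⱼ`, so the paraboloid carries
the flat metric. -/
lemma form_dirDeriv_nullParam (y : EuclideanSpace ℝ (Fin (n + 1))) (i j : Fin (n + 1)) :
    H (dirDeriv T.nullParam y i) (dirDeriv T.nullParam y j) = if i = j then 1 else 0 := by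
  rw [T.form_eq_flat, dirDeriv_nullParam, dirDeriv_nullParam]
  simp [EuclideanSpace.inner_single_left, PiLp.single_apply]

lemma contDiffOn_stereo : ContDiffOn ℝ ∞ T.stereo {p | T.denom p ≠ 0} :=
  ((LinearMap.toContinuousLinearMap T.denom).contDiff.contDiffOn.inv fun _ h => h).smul
    (LinearMap.toContinuousLinearMap T.numer).contDiff.contDiffOn

lemma contMDiffOn_stereo_lift (L : LorentzFrame n H) :
    ContMDiffOn (𝓡 (n + 1)) 𝓘(ℝ, EuclideanSpace ℝ (Fin (n + 1))) ∞
      (fun x => T.stereo (L.lift x)) {x | T.denom (L.lift x) ≠ 0} :=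
  T.contDiffOn_stereo.contMDiffOn.comp L.contMDiff_lift.contMDiffOn fun _ h => h

namespace IsAdapted

variable {T} {L : LorentzFrame n H} {ξ : Module.Dual ℝ (EuclideanSpace ℝ (Fin (n + 3)))}

/-- This is the use of an adapted frame: stereographic projection displays the cap as the half-space
`0 ≤ y 0`. -/
lemma apply_nullParam (hT : L.IsAdapted T ξ) (y : EuclideanSpace ℝ (Fin (n + 1))) :
    ξ (T.nullParam y) = y 0 := by
  rw [hT.apply_eq, ← flat_zero, flat_nullParam]

lemma stereo_zero (hT : L.IsAdapted T ξ) (p : EuclideanSpace ℝ (Fin (n + 3))) :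
    T.stereo p 0 = (T.denom p)⁻¹ * ξ p := by
  rw [hT.apply_eq]
  rfl

lemma nullParam_mem (hT : L.IsAdapted T ξ) (y : EuclideanSpace ℝ (Fin (n + 1))) :
    T.nullParam y ∈ L.cone := hT.cone_eq ▸ T.nullParam_mem y

/-- Inverse stereographic projection. -/
noncomputable def unstereo (hT : L.IsAdapted T ξ) (y : EuclideanSpace ℝ (Fin (n + 1))) :
    Sph (n + 1) :=
  L.proj ⟨T.nullParam y, hT.nullParam_mem y⟩

variable (hT : L.IsAdapted T ξ)
include hT

lemma exists_lift_unstereo (y : EuclideanSpace ℝ (Fin (n + 1))) :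
    ∃ t : ℝ, 0 < t ∧ L.lift (hT.unstereo y) = t • T.nullParam y :=
  L.exists_lift_proj_eq (hT.nullParam_mem y)

lemma denom_lift_nonneg (x : Sph (n + 1)) : 0 ≤ T.denom (L.lift x) :=
  T.denom_nonneg (hT.cone_eq ▸ L.lift_mem x)

lemma stereo_unstereo (y : EuclideanSpace ℝ (Fin (n + 1))) :
    T.stereo (L.lift (hT.unstereo y)) = y := by
  obtain ⟨t, ht, h⟩ := hT.exists_lift_unstereo y
  rw [h, T.stereo_smul ht.ne', stereo_nullParam]

lemma denom_unstereo (y : EuclideanSpace ℝ (Fin (n + 1))) :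
    T.denom (L.lift (hT.unstereo y)) ≠ 0 := by
  obtain ⟨t, ht, h⟩ := hT.exists_lift_unstereo y
  rw [h, map_smul, denom_nullParam]
  simpa using ht.ne'

lemma unstereo_stereo {x : Sph (n + 1)} (h : T.denom (L.lift x) ≠ 0) :
    hT.unstereo (T.stereo (L.lift x)) = x := by
  have h0 : T.nullParam (T.stereo (L.lift x)) ∈ L.cone := hT.nullParam_mem _
  have h1 := T.nullParam_stereo (hT.cone_eq ▸ L.lift_mem x) h
  exact ((L.proj_eq_proj_iff ⟨_, L.lift_mem x⟩ ⟨_, h0⟩).2 ⟨(T.denom (L.lift x))⁻¹,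
    inv_pos.2 ((hT.denom_lift_nonneg x).lt_of_ne' h), h1⟩).symm.trans (L.proj_lift x _)

lemma unstereo_mem_cap {y : EuclideanSpace ℝ (Fin (n + 1))} (hy : 0 ≤ y 0) :
    hT.unstereo y ∈ L.cap ξ := by
  obtain ⟨t, ht, h⟩ := hT.exists_lift_unstereo y
  rw [cap, Set.mem_ofPred_eq, h, map_smul, hT.apply_nullParam]
  exact mul_nonneg ht.le hy

lemma stereo_nonneg {x : Sph (n + 1)} (hx : x ∈ L.cap ξ) : 0 ≤ T.stereo (L.lift x) 0 := by
  rw [hT.stereo_zero]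
  exact mul_nonneg (inv_nonneg.2 (hT.denom_lift_nonneg x)) hx

lemma contMDiff_unstereo :
    ContMDiff 𝓘(ℝ, EuclideanSpace ℝ (Fin (n + 1))) (𝓡 (n + 1)) ∞ hT.unstereo := by
  refine contMDiff_sphere_mk ?_ _
  have h1 := contMDiff_linear (LinearMap.fst ℝ _ _ ∘ₗ L.toEquiv.toLinearMap)
    T.contDiff_nullParam.contMDiff
  have h2 := contMDiff_linear (LinearMap.snd ℝ _ _ ∘ₗ L.toEquiv.toLinearMap)
    T.contDiff_nullParam.contMDiff
  exact (h2.inv₀ fun y => (hT.nullParam_mem y).2.ne').smul h1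

end IsAdapted

end LorentzFrame

end PEModel

namespace PEModel

/-- The reflection of Euclidean space in the last coordinate. -/
noncomputable def lastReflection (m : ℕ) :
    EuclideanSpace ℝ (Fin (m + 1)) ≃ₗᵢ[ℝ] EuclideanSpace ℝ (Fin (m + 1)) :=
  LinearIsometryEquiv.piLpCongrRight 2 fun i =>
    if i = Fin.last m then LinearIsometryEquiv.neg ℝ else LinearIsometryEquiv.refl ℝ ℝ

lemma lastReflection_last {m : ℕ} (p : EuclideanSpace ℝ (Fin (m + 1))) :
    lastReflection m p (Fin.last m) = -p (Fin.last m) := by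
  simp [lastReflection]

lemma lastReflection_of_ne {m : ℕ} (p : EuclideanSpace ℝ (Fin (m + 1))) {i : Fin (m + 1)}
    (hi : i ≠ Fin.last m) : lastReflection m p i = p i := by
  simp [lastReflection, hi]

namespace LorentzFrame

variable {n : ℕ} {H : LinearMap.BilinForm ℝ (EuclideanSpace ℝ (Fin (n + 3)))}
  {L T : LorentzFrame n H} {ξ : Module.Dual ℝ (EuclideanSpace ℝ (Fin (n + 3)))}

/-! ### The cap as a manifold with boundary -/

/-- One stereographic projection misses a point of the cap. Reflecting the last spatial coordinate
moves the missing point to the opposite pole and, since that is not the first coordinate, leaves `ξ`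
alone. -/
lemma IsAdapted.reflect (hT : L.IsAdapted T ξ) :
    L.IsAdapted (T.transform _ (spatial_isometry (lastReflection (n + 1)))) ξ where
  cone_eq := (T.transform_cone _ (spatial_preserving _)).trans hT.cone_eq
  apply_eq p := by
    rw [hT.apply_eq]
    exact (lastReflection_of_ne _ (by simp [Fin.ext_iff])).symm

lemma denom_reflect (p : EuclideanSpace ℝ (Fin (n + 3))) :
    (T.transform _ (spatial_isometry (lastReflection (n + 1)))).denom p
      = -(T.flat p).1.2 + (T.flat p).2 := by
  rw [denom_apply]
  congr 1
  exact lastReflection_last _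

lemma IsAdapted.exists_denom_ne_zero (hT : L.IsAdapted T ξ) (x : Sph (n + 1)) :
    ∃ T', L.IsAdapted T' ξ ∧ T'.denom (L.lift x) ≠ 0 := by
  by_cases h : T.denom (L.lift x) = 0
  · refine ⟨_, hT.reflect, ?_⟩
    have h1 : L.lift x ∈ T.cone := hT.cone_eq ▸ L.lift_mem x
    have h2 : 0 < (T.flat (L.lift x)).2 := h1.2
    rw [denom_apply] at h
    rw [denom_reflect]
    intro h3
    linarith
  · exact ⟨T, hT, h⟩

/-- Stereographic projection as a chart of the cap. -/
noncomputable def IsAdapted.capChart (hT : L.IsAdapted T ξ) :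
    OpenPartialHomeomorph (L.cap ξ) (EuclideanHalfSpace (n + 1)) where
  toFun x := ⟨T.stereo (L.lift x), hT.stereo_nonneg x.2⟩
  invFun y := ⟨hT.unstereo y.1, hT.unstereo_mem_cap y.2⟩
  source := {x | T.denom (L.lift x) ≠ 0}
  target := Set.univ
  map_source' _ _ := trivial
  map_target' y _ := hT.denom_unstereo y.1
  left_inv' _ h := Subtype.ext (hT.unstereo_stereo h)
  right_inv' y _ := Subtype.ext (hT.stereo_unstereo y.1)
  open_source := by
    have h : Continuous fun x : L.cap ξ => T.denom (L.lift x) :=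
      (LinearMap.continuous_of_finiteDimensional _).comp
        (L.contMDiff_lift.continuous.comp continuous_subtype_val)
    exact isOpen_ne_fun h continuous_const
  open_target := isOpen_univ
  continuousOn_toFun := by
    refine Topology.IsInducing.subtypeVal.continuousOn_iff.2 ?_
    exact (T.contMDiffOn_stereo_lift L).continuousOn.comp
      continuous_subtype_val.continuousOn fun _ h => h
  continuousOn_invFun := by
    refine Topology.IsInducing.subtypeVal.continuousOn_iff.2 ?_
    exact (hT.contMDiff_unstereo.continuous.comp continuous_subtype_val).continuousOn

section Cap

-- Existence of an adapted frame is passed as a `Fact` so that the manifold structure of the cap can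
-- be an instance.
variable [hT : Fact (∃ T, L.IsAdapted T ξ)]

variable (L ξ) in
lemma exists_chart (x : L.cap ξ) :
    ∃ T', L.IsAdapted T' ξ ∧ T'.denom (L.lift (x : Sph (n + 1))) ≠ 0 :=
  hT.out.choose_spec.exists_denom_ne_zero x

/-- The frame whose stereographic projection is the preferred chart of the cap. -/
noncomputable def chartFrame (x : L.cap ξ) : LorentzFrame n H := (exists_chart L ξ x).choose

lemma isAdapted_chartFrame (x : L.cap ξ) : L.IsAdapted (chartFrame x) ξ :=
  (exists_chart L ξ x).choose_spec.1

lemma denom_chartFrame (x : L.cap ξ) : (chartFrame x).denom (L.lift (x : Sph (n + 1))) ≠ 0 :=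
  (exists_chart L ξ x).choose_spec.2

/-- The charts are homeomorphisms for the subspace topology of the cap. All adapted frames are
admitted in the atlas. -/
noncomputable instance : ChartedSpace (EuclideanHalfSpace (n + 1)) (L.cap ξ) where
  atlas := {e | ∃ (T : LorentzFrame n H) (hT : L.IsAdapted T ξ), e = hT.capChart}
  chartAt x := (isAdapted_chartFrame x).capChart
  mem_chart_source := denom_chartFrame
  chart_mem_atlas x := ⟨_, isAdapted_chartFrame x, rfl⟩

lemma halfSpace_symm_apply {m : ℕ} {y : EuclideanSpace ℝ (Fin (m + 1))}
    (hy : y ∈ Set.range (𝓡∂ (m + 1))) : ((𝓡∂ (m + 1)).symm y).1 = y :=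
  (𝓡∂ (m + 1)).right_inv hy

/-- A transition map is the restriction of `T'.stereo ∘ T.nullParam`, which is smooth on a set not
confined to the half-space, so smoothness up to the boundary is immediate. -/
instance : IsManifold (𝓡∂ (n + 1)) ∞ (L.cap ξ) := by
  refine isManifold_of_contDiffOn _ _ _ ?_
  rintro _ _ ⟨T, hT, rfl⟩ ⟨T', hT', rfl⟩
  have h1 : ContDiffOn ℝ ∞ (fun y => T'.stereo (T.nullParam y)) {y | T'.denom (T.nullParam y) ≠ 0} :=
    T'.contDiffOn_stereo.comp T.contDiff_nullParam.contDiffOn fun _ h => h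
  refine (h1.mono ?_).congr ?_
  · rintro y ⟨⟨-, hy⟩, hy0⟩
    have h2 : T'.denom (L.lift (hT.unstereo ((𝓡∂ (n + 1)).symm y).1)) ≠ 0 := hy
    rw [halfSpace_symm_apply hy0] at h2
    obtain ⟨t, ht, h3⟩ := hT.exists_lift_unstereo y
    rw [h3, map_smul, smul_eq_mul] at h2
    exact right_ne_zero_of_mul h2
  · rintro y ⟨-, hy0⟩
    change T'.stereo (L.lift (hT.unstereo ((𝓡∂ (n + 1)).symm y).1)) = _
    rw [halfSpace_symm_apply hy0]
    obtain ⟨t, ht, h3⟩ := hT.exists_lift_unstereo y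
    rw [h3, T'.stereo_smul ht.ne']

instance : IsManifold (𝓡∂ (n + 1)) 1 (L.cap ξ) := IsManifold.of_le (n := ∞) (by simp)

lemma extChartAt_cap_target (p : L.cap ξ) :
    (extChartAt (𝓡∂ (n + 1)) p).target = Set.range (𝓡∂ (n + 1)) := by
  rw [extChartAt_target]
  exact Set.univ_inter _

lemma extChartAt_cap_symm (p : L.cap ξ) {y : EuclideanSpace ℝ (Fin (n + 1))}
    (hy : y ∈ Set.range (𝓡∂ (n + 1))) :
    (((extChartAt (𝓡∂ (n + 1)) p).symm y : L.cap ξ) : Sph (n + 1))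
      = (isAdapted_chartFrame p).unstereo y := by
  change (isAdapted_chartFrame p).unstereo ((𝓡∂ (n + 1)).symm y).1 = _
  rw [halfSpace_symm_apply hy]

lemma contMDiff_cap_coe :
    ContMDiff (𝓡∂ (n + 1)) (𝓡 (n + 1)) ∞ ((↑) : L.cap ξ → Sph (n + 1)) := fun p => by
  have h := (isAdapted_chartFrame p).contMDiff_unstereo.contMDiffAt.comp p
    (contMDiffAt_extChartAt (I := 𝓡∂ (n + 1)) (n := ∞) (x := p))
  refine h.congr_of_eventuallyEq ?_
  filter_upwards [extChartAt_source_mem_nhds (I := 𝓡∂ (n + 1)) p] with x hx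
  rw [Function.comp_apply, ← extChartAt_cap_symm p (extChartAt_target_subset_range p
    ((extChartAt (𝓡∂ (n + 1)) p).map_source hx)), (extChartAt (𝓡∂ (n + 1)) p).left_inv hx]

/-- The chart at `p` factors through the inclusion, and its derivative is invertible. -/
lemma mfderiv_cap_coe_injective (p : L.cap ξ) : Function.Injective
    (mfderiv (𝓡∂ (n + 1)) (𝓡 (n + 1)) ((↑) : L.cap ξ → Sph (n + 1)) p) := by
  have h1 : MDifferentiableAt (𝓡 (n + 1)) 𝓘(ℝ, EuclideanSpace ℝ (Fin (n + 1)))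
      (fun x => (chartFrame p).stereo (L.lift x)) (p : Sph (n + 1)) := by
    refine (((chartFrame p).contMDiffOn_stereo_lift L).contMDiffAt (IsOpen.mem_nhds ?_ (denom_chartFrame p))
      ).mdifferentiableAt (by simp)
    have h : Continuous fun x : Sph (n + 1) => (chartFrame p).denom (L.lift x) :=
      (LinearMap.continuous_of_finiteDimensional _).comp L.contMDiff_lift.continuous
    exact isOpen_ne_fun h continuous_const
  have h2 := mfderiv_comp (I := 𝓡∂ (n + 1)) p h1
    (contMDiff_cap_coe.mdifferentiableAt (by simp))
  have h3 : Function.Injective (mfderiv (𝓡∂ (n + 1)) 𝓘(ℝ, EuclideanSpace ℝ (Fin (n + 1)))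
      (extChartAt (𝓡∂ (n + 1)) p) p) :=
    (isInvertible_mfderiv_extChartAt (mem_extChartAt_source p)).injective
  have h4 : (extChartAt (𝓡∂ (n + 1)) p : L.cap ξ → EuclideanSpace ℝ (Fin (n + 1)))
    = (fun x => (chartFrame p).stereo (L.lift x)) ∘ ((↑) : L.cap ξ → Sph (n + 1)) := rfl
  rw [h4, h2] at h3
  exact Function.Injective.of_comp h3

lemma extChartAt_cap_zero (p : L.cap ξ) :
    extChartAt (𝓡∂ (n + 1)) p p 0 = ((chartFrame p).denom (L.lift (p : Sph (n + 1))))⁻¹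
      * ξ (L.lift (p : Sph (n + 1))) :=
  (isAdapted_chartFrame p).stereo_zero _

/-- The chart coordinate `0` is a positive multiple of `ξ` on the ray, so its sign is that of `σ`;
the same holds for the interior. -/
lemma mem_boundary_cap_iff (p : L.cap ξ) :
    p ∈ (𝓡∂ (n + 1)).boundary (L.cap ξ) ↔ (p : Sph (n + 1)) ∈ L.zeroSet ξ := by
  rw [ModelWithCorners.boundary, Set.mem_ofPred_eq, ModelWithCorners.IsBoundaryPoint,
    frontier_range_modelWithCornersEuclideanHalfSpace, Set.mem_ofPred_eq, extChartAt_cap_zero,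
    zeroSet, Set.mem_ofPred_eq, eq_comm, mul_eq_zero, inv_eq_zero]
  exact or_iff_right (denom_chartFrame p)

lemma mem_interior_cap_iff (p : L.cap ξ) :
    p ∈ (𝓡∂ (n + 1)).interior (L.cap ξ) ↔ (p : Sph (n + 1)) ∈ L.openCap ξ := by
  rw [ModelWithCorners.interior, Set.mem_ofPred_eq, ModelWithCorners.IsInteriorPoint,
    interior_range_modelWithCornersEuclideanHalfSpace, Set.mem_ofPred_eq, extChartAt_cap_zero,
    openCap, Set.mem_ofPred_eq]
  exact mul_pos_iff_of_pos_left (inv_pos.2 (((isAdapted_chartFrame p).denom_lift_nonneg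
    p).lt_of_ne' (denom_chartFrame p)))

lemma image_boundary_cap :
    ((↑) : L.cap ξ → Sph (n + 1)) '' (𝓡∂ (n + 1)).boundary (L.cap ξ) = L.zeroSet ξ := by
  ext x
  constructor
  · rintro ⟨p, hp, rfl⟩
    exact (mem_boundary_cap_iff p).1 hp
  · intro hx
    exact ⟨⟨x, le_of_eq (Eq.symm hx)⟩, (mem_boundary_cap_iff _).2 hx, rfl⟩

lemma image_interior_cap :
    ((↑) : L.cap ξ → Sph (n + 1)) '' (𝓡∂ (n + 1)).interior (L.cap ξ) = L.openCap ξ := by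
  ext x
  constructor
  · rintro ⟨p, hp, rfl⟩
    exact (mem_interior_cap_iff p).1 hp
  · intro hx
    have h : 0 < ξ (L.lift x) := hx
    exact ⟨⟨x, h.le⟩, (mem_interior_cap_iff _).2 hx, rfl⟩

end Cap

end LorentzFrame

end PEModel

namespace PEModel

/-! ### The Riemannian metric induced by a map into a space with a bilinear form -/

/-- By compactness `b` has a positive minimum on the unit sphere, so by homogeneity its unit ball is
bounded. Riemannian metrics on bundles require this. -/
lemma isVonNBounded_of_pos {E : Type*} [NormedAddCommGroup E] [NormedSpace ℝ E]
    [FiniteDimensional ℝ E] (b : E →L[ℝ] E →L[ℝ] ℝ) (hb : ∀ v, v ≠ 0 → 0 < b v v) :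
    Bornology.IsVonNBounded ℝ {v : E | b v v < 1} := by
  rw [NormedSpace.isVonNBounded_iff, isBounded_iff_forall_norm_le]
  have hcont : Continuous fun v : E => b v v := by fun_prop
  rcases (Metric.sphere (0 : E) 1).eq_empty_or_nonempty with h | h
  · refine ⟨0, fun v _ => ?_⟩
    by_contra! hv
    have h1 : ‖v‖⁻¹ • v ∈ Metric.sphere (0 : E) 1 := by
      rw [mem_sphere_zero_iff_norm, norm_smul, norm_inv, norm_norm, inv_mul_cancel₀ hv.ne']
    rw [h] at h1
    exact h1
  · obtain ⟨w, hw, hmin⟩ := (isCompact_sphere (0 : E) 1).exists_isMinOn h hcont.continuousOn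
    have hw0 : w ≠ 0 := by
      rintro rfl
      simp at hw
    have hc := hb w hw0
    -- The estimate gives `‖v‖² ≤ (b w w)⁻¹`; the linear bound follows from `2‖v‖ ≤ 1 + ‖v‖²`.
    refine ⟨1 + (b w w)⁻¹, fun v hv => ?_⟩
    by_cases hv0 : v = 0
    · rw [hv0, norm_zero]
      positivity
    have hn := norm_pos_iff.2 hv0
    have h1 : ‖v‖⁻¹ • v ∈ Metric.sphere (0 : E) 1 := by
      rw [mem_sphere_zero_iff_norm, norm_smul, norm_inv, norm_norm, inv_mul_cancel₀ hn.ne']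
    have h2 : b w w ≤ ‖v‖⁻¹ * (‖v‖⁻¹ * b v v) := by
      have := hmin h1
      simpa using this
    have h3 : ‖v‖ ^ 2 * b w w ≤ b v v := by
      calc ‖v‖ ^ 2 * b w w ≤ ‖v‖ ^ 2 * (‖v‖⁻¹ * (‖v‖⁻¹ * b v v)) := by gcongr
        _ = b v v := by field_simp
    have h4 : ‖v‖ ^ 2 ≤ (b w w)⁻¹ := by
      rw [inv_eq_one_div, le_div_iff₀ hc]
      exact h3.trans (le_of_lt hv)
    nlinarith [sq_nonneg (‖v‖ - 1)]

section Induced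

variable {E : Type*} [NormedAddCommGroup E] [NormedSpace ℝ E] {K : Type*}
  [TopologicalSpace K] {I : ModelWithCorners ℝ E K} {M : Type*} [TopologicalSpace M]
  [ChartedSpace K M] {V : Type*} [NormedAddCommGroup V] [NormedSpace ℝ V] [FiniteDimensional ℝ V]

variable (I) in
/-- The bilinear form that a map into a space with a bilinear form induces on tangent spaces. -/
noncomputable def inducedForm (B : LinearMap.BilinForm ℝ V) (f : M → V) (p : M) :
    TangentSpace I p →L[ℝ] TangentSpace I p →L[ℝ] ℝ :=
  (B.toContinuousBilinearMap.bilinearComp (mvfderiv I f p : E →L[ℝ] V) (mvfderiv I f p : E →L[ℝ] V) :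
    E →L[ℝ] E →L[ℝ] ℝ)

lemma inducedForm_apply (B : LinearMap.BilinForm ℝ V) (f : M → V) (p : M)
    (u v : TangentSpace I p) :
    inducedForm I B f p u v = B (mvfderiv I f p u) (mvfderiv I f p v) := rfl

/-- In trivialisations the form is `B(D·, D·)` with `D` the local expression of the derivative of
`f`, which is smooth; the dependence on `D` is quadratic. -/
lemma contMDiff_inducedForm [IsManifold I ∞ M] (B : LinearMap.BilinForm ℝ V) {f : M → V}
    (hf : ContMDiff I 𝓘(ℝ, V) ∞ f) :
    ContMDiff I (I.prod 𝓘(ℝ, E →L[ℝ] E →L[ℝ] ℝ)) ∞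
      (fun p => Bundle.TotalSpace.mk' (E →L[ℝ] E →L[ℝ] ℝ)
        (E := fun p : M => TangentSpace I p →L[ℝ] TangentSpace I p →L[ℝ] ℝ) p
        (inducedForm I B f p)) := by
  intro x₀
  rw [contMDiffAt_hom_bundle]
  refine ⟨contMDiffAt_id, ?_⟩
  have h1 := (hf x₀).mfderiv_const (m := ∞) (by simp)
  have h2 : ContDiff ℝ ∞ fun D : E →L[ℝ] V => B.toContinuousBilinearMap.bilinearComp D D := by
    -- `bilinearComp` unfolded into compositions and flips, whose smoothness can be derived
    -- automatically.
    have h3 : ContDiff ℝ ∞ fun D : E →L[ℝ] V =>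
      ContinuousLinearMap.flipₗᵢ ℝ E E ℝ
        ((ContinuousLinearMap.flipₗᵢ ℝ E V ℝ (B.toContinuousBilinearMap ∘L D)) ∘L D) := by
      fun_prop
    exact h3
  refine (h2.contMDiff.contMDiffAt.comp x₀ h1).congr_of_eventuallyEq ?_
  filter_upwards [(trivializationAt E (TangentSpace I) x₀).open_baseSet.mem_nhds
    (FiberBundle.mem_baseSet_trivializationAt' x₀)] with x hx
  ext v w
  have h5 : ∀ v, inTangentCoordinates I 𝓘(ℝ, V) id f (mfderiv I 𝓘(ℝ, V) f) x₀ x v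
      = mvfderiv I f x ((trivializationAt E (TangentSpace I) x₀).symm x v) := fun v => by
    change ContinuousLinearMap.inCoordinates E (TangentSpace I) V (TangentSpace 𝓘(ℝ, V)) x₀ x
      (f x₀) (f x) (mfderiv I 𝓘(ℝ, V) f x) v = _
    rw [ContinuousLinearMap.inCoordinates,
      TangentBundle.continuousLinearMapAt_model_space]
    exact congrArg (mvfderiv I f x) (Bundle.Trivialization.symmL_apply _ hx v)
  rw [inCoordinates_apply_eq₂ hx hx (by trivial), inducedForm_apply, ← h5, ← h5]
  simp

end Induced

/-! ### The metric of a scale on the cap -/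

namespace LorentzFrame

variable {n : ℕ} {H : LinearMap.BilinForm ℝ (EuclideanSpace ℝ (Fin (n + 3)))}
  {L : LorentzFrame n H} {s : Sph (n + 1) → EuclideanSpace ℝ (Fin (n + 3))}
  {ξ : Module.Dual ℝ (EuclideanSpace ℝ (Fin (n + 3)))} [hT : Fact (∃ T, L.IsAdapted T ξ)]

namespace IsScale

variable (hs : L.IsScale s)
include hs

lemma contMDiff_cap : ContMDiff (𝓡∂ (n + 1)) 𝓘(ℝ, EuclideanSpace ℝ (Fin (n + 3))) ∞
    fun q : L.cap ξ => s q :=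
  hs.smooth.comp contMDiff_cap_coe

lemma mvfderiv_cap (p : L.cap ξ) (v : TangentSpace (𝓡∂ (n + 1)) p) :
    mvfderiv (𝓡∂ (n + 1)) (fun q : L.cap ξ => s q) p v = mvfderiv (𝓡 (n + 1)) s p
      (mfderiv (𝓡∂ (n + 1)) (𝓡 (n + 1)) ((↑) : L.cap ξ → Sph (n + 1)) p v) :=
  mvfderiv_comp_apply' (hs.mdifferentiableAt _) (contMDiff_cap_coe.mdifferentiableAt (by simp)) v

lemma inducedForm_cap (p : L.cap ξ) (u v : TangentSpace (𝓡∂ (n + 1)) p) :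
    inducedForm (𝓡∂ (n + 1)) H (fun q : L.cap ξ => s q) p u v = scaleMetric H s p
      (mfderiv (𝓡∂ (n + 1)) (𝓡 (n + 1)) ((↑) : L.cap ξ → Sph (n + 1)) p u)
      (mfderiv (𝓡∂ (n + 1)) (𝓡 (n + 1)) ((↑) : L.cap ξ → Sph (n + 1)) p v) := by
  rw [inducedForm_apply, hs.mvfderiv_cap, hs.mvfderiv_cap]
  rfl

lemma inducedForm_cap_pos (p : L.cap ξ) (v : TangentSpace (𝓡∂ (n + 1)) p) (hv : v ≠ 0) :
    0 < inducedForm (𝓡∂ (n + 1)) H (fun q : L.cap ξ => s q) p v v := by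
  rw [hs.inducedForm_cap]
  refine hs.scaleMetric_pos _ fun h => hv (mfderiv_cap_coe_injective p ?_)
  rw [h, map_zero]

/-- The restriction to the cap of the metric of a scale. -/
noncomputable def capMetric : Bundle.ContMDiffRiemannianMetric (𝓡∂ (n + 1)) ∞
    (EuclideanSpace ℝ (Fin (n + 1))) (fun p : L.cap ξ => TangentSpace (𝓡∂ (n + 1)) p) where
  inner p := inducedForm (𝓡∂ (n + 1)) H (fun q : L.cap ξ => s q) p
  symm _ _ _ := L.form_symm _ _
  pos p v hv := hs.inducedForm_cap_pos p v hv
  isVonNBounded p := isVonNBounded_of_pos (E := EuclideanSpace ℝ (Fin (n + 1))) _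
    (hs.inducedForm_cap_pos p)
  contMDiff := contMDiff_inducedForm H hs.contMDiff_cap

end IsScale

end LorentzFrame

end PEModel

namespace PEModel

namespace LorentzFrame

variable {n : ℕ} {H : LinearMap.BilinForm ℝ (EuclideanSpace ℝ (Fin (n + 3)))}
  {L T : LorentzFrame n H} {ξ : Module.Dual ℝ (EuclideanSpace ℝ (Fin (n + 3)))}

/-! ### The half-space model of the metric on the interior of the cap -/

lemma dirDeriv_coord {d : ℕ} (y : EuclideanSpace ℝ (Fin d)) (i k : Fin d) :
    dirDeriv (fun z => z k) y i = if i = k then 1 else 0 := by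
  have h := (EuclideanSpace.proj k : EuclideanSpace ℝ (Fin d) →L[ℝ] ℝ).hasFDerivAt (x := y)
  have h2 : HasFDerivAt (fun z : EuclideanSpace ℝ (Fin d) => z k) _ y := h
  rw [dirDeriv, h2.fderiv]
  simp [PiLp.single_apply, eq_comm]

lemma form_nullParam_dirDeriv (y : EuclideanSpace ℝ (Fin (n + 1))) (i : Fin (n + 1)) :
    H (T.nullParam y) (dirDeriv T.nullParam y i) = 0 := by
  rw [T.form_eq_flat, dirDeriv_nullParam, flat_nullParam]
  simp only [EuclideanSpace.inner_single_right, conj_trivial]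
  ring

/-- The rescalings of the null parametrization induce metrics conformal to the flat one. -/
lemma form_dirDeriv_smul_nullParam {a : EuclideanSpace ℝ (Fin (n + 1)) → ℝ}
    {y : EuclideanSpace ℝ (Fin (n + 1))} (ha : DifferentiableAt ℝ a y) (i j : Fin (n + 1)) :
    H (dirDeriv (fun z => a z • T.nullParam z) y i) (dirDeriv (fun z => a z • T.nullParam z) y j)
      = a y ^ 2 * if i = j then 1 else 0 := by
  have hd := T.contDiff_nullParam.differentiable (by simp) y
  rw [dirDeriv_smul ha hd, dirDeriv_smul ha hd]
  simp only [map_add, map_smul, LinearMap.add_apply, LinearMap.smul_apply, smul_eq_mul,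
    form_nullParam, form_nullParam_dirDeriv, form_dirDeriv_nullParam,
    T.form_symm _ (T.nullParam y)]
  ring

lemma isOpen_halfSpace : IsOpen {y : EuclideanSpace ℝ (Fin (n + 1)) | 0 < y 0} :=
  isOpen_lt continuous_const (by fun_prop)

lemma halfSpace_subset_range :
    {y : EuclideanSpace ℝ (Fin (n + 1)) | 0 < y 0} ⊆ Set.range (𝓡∂ (n + 1)) := by
  rw [range_modelWithCornersEuclideanHalfSpace]
  intro y hy
  have h : 0 < y 0 := hy
  exact h.le

variable (T) in
/-- The section of the null cone on which `ξ` is `1`. -/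
noncomputable def horoParam (y : EuclideanSpace ℝ (Fin (n + 1))) :
    EuclideanSpace ℝ (Fin (n + 3)) :=
  (y 0)⁻¹ • T.nullParam y

variable (T) in
/-- The vector dual to the covector `ξ` to which the frame is adapted. -/
noncomputable def dualVector : EuclideanSpace ℝ (Fin (n + 3)) :=
  T.flat.symm ((EuclideanSpace.single 0 1, 0), 0)

lemma IsAdapted.form_dualVector (hT : L.IsAdapted T ξ) (v : EuclideanSpace ℝ (Fin (n + 3))) :
    H T.dualVector v = ξ v := by
  rw [T.form_eq_flat, dualVector, LinearEquiv.apply_symm_apply, hT.apply_eq, ← flat_zero]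
  simp [EuclideanSpace.inner_single_left]

lemma form_dualVector_self : H T.dualVector T.dualVector = 1 := by
  rw [T.form_eq_flat, dualVector, LinearEquiv.apply_symm_apply]
  simp

lemma contDiffOn_inv_coord :
    ContDiffOn ℝ ∞ (fun y : EuclideanSpace ℝ (Fin (n + 1)) => (y 0)⁻¹) {y | 0 < y 0} := by
  refine ContDiffOn.inv ?_ fun y hy => (ne_of_gt hy)
  exact (EuclideanSpace.proj 0 : EuclideanSpace ℝ (Fin (n + 1)) →L[ℝ] ℝ).contDiff.contDiffOn

lemma contDiffOn_horoParam : ContDiffOn ℝ ∞ T.horoParam {y | 0 < y 0} :=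
  contDiffOn_inv_coord.smul T.contDiff_nullParam.contDiffOn

lemma IsAdapted.apply_horoParam (hT : L.IsAdapted T ξ) {y : EuclideanSpace ℝ (Fin (n + 1))}
    (hy : 0 < y 0) : ξ (T.horoParam y) = 1 := by
  rw [horoParam, map_smul, hT.apply_nullParam, smul_eq_mul, inv_mul_cancel₀ hy.ne']

lemma dirDeriv_horoParam {y : EuclideanSpace ℝ (Fin (n + 1))} (hy : 0 < y 0) (i j : Fin (n + 1)) :
    H (dirDeriv T.horoParam y i) (dirDeriv T.horoParam y j)
      = (y 0 ^ 2)⁻¹ * if i = j then 1 else 0 := by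
  rw [← inv_pow]
  exact form_dirDeriv_smul_nullParam (differentiableAt_of_contDiffOn isOpen_halfSpace
    contDiffOn_inv_coord hy) i j

/-- The half-space model: the null lift of the hyperbolic metric. -/
lemma IsAdapted.isNullLift_horoParam (hT : L.IsAdapted T ξ)
    {G : EuclideanSpace ℝ (Fin (n + 1)) → Matrix (Fin (n + 1)) (Fin (n + 1)) ℝ}
    (hG : ∀ y, 0 < y 0 → ∀ i j, G y i j = (y 0 ^ 2)⁻¹ * if i = j then 1 else 0) :
    IsNullLift H {y | 0 < y 0} G T.horoParam
      (fun y => T.dualVector - (2⁻¹ : ℝ) • T.horoParam y) where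
  symm := T.form_symm
  finrank := by simp
  isOpen := isOpen_halfSpace
  smooth := contDiffOn_horoParam
  smooth' := contDiffOn_const.sub (contDiffOn_horoParam.const_smul _)
  null y _ := by
    simp [horoParam, form_nullParam]
  -- With `I` the dual vector, `H(I,I) = H(I,F) = 1` and `H(F,F) = 0`, so the square of `I - F/2` is
  -- `1 - 1 + 0`.
  null' y hy := by
    have h1 : H (T.horoParam y) (T.horoParam y) = 0 := by simp [horoParam, form_nullParam]
    have h2 : ξ T.dualVector = 1 := by rw [← hT.form_dualVector, form_dualVector_self]
    simp only [map_sub, map_smul, LinearMap.sub_apply, LinearMap.smul_apply, smul_eq_mul,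
      T.form_symm (T.horoParam y), h1, h2, hT.form_dualVector, hT.apply_horoParam hy]
    norm_num
  pairing y hy := by
    have h1 : H (T.horoParam y) (T.horoParam y) = 0 := by simp [horoParam, form_nullParam]
    simp only [map_sub, map_smul, LinearMap.sub_apply, LinearMap.smul_apply, smul_eq_mul, h1,
      hT.form_dualVector, hT.apply_horoParam hy]
    norm_num
  -- Both `ξ(F) = 1` and `H(F,F) = 0` are constant, so `∂ᵢF` is orthogonal to the dual vector and to
  -- `F`.
  normal y hy i := by
    have hd := differentiableAt_of_contDiffOn isOpen_halfSpace
      (contDiffOn_horoParam (T := T)) hy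
    have h1 := dirDeriv_bilin H hd hd i
    have h2 : ∀ z : EuclideanSpace ℝ (Fin (n + 1)), H (T.horoParam z) (T.horoParam z) = 0 := by
      simp [horoParam, form_nullParam]
    simp only [h2, dirDeriv_const] at h1
    rw [T.form_symm (dirDeriv T.horoParam y i)] at h1
    have h3 := dirDeriv_linear ξ hd i
    rw [dirDeriv_congr isOpen_halfSpace (fun z hz => hT.apply_horoParam hz) hy,
      dirDeriv_const] at h3
    simp only [map_sub, map_smul, LinearMap.sub_apply, LinearMap.smul_apply, smul_eq_mul,
      hT.form_dualVector, ← h3]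
    linarith
  metric y hy i j := by rw [hG y hy, dirDeriv_horoParam hy]
  isUnit_det y hy := by
    have h1 : G y = (y 0 ^ 2)⁻¹ • (1 : Matrix (Fin (n + 1)) (Fin (n + 1)) ℝ) := by
      ext i j
      rw [hG y hy, Matrix.smul_apply, Matrix.one_apply, smul_eq_mul]
    have h2 : (0 : ℝ) < y 0 := hy
    rw [h1, Matrix.det_smul, Matrix.det_one, mul_one, isUnit_iff_ne_zero]
    positivity

/-- The dual vector is constant, hence `∂Y = -∂F/2`. This is the step by which the parallel tractor
produces an Einstein metric. -/
lemma IsAdapted.secondForm_horoParam (hT : L.IsAdapted T ξ)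
    {G : EuclideanSpace ℝ (Fin (n + 1)) → Matrix (Fin (n + 1)) (Fin (n + 1)) ℝ}
    (hG : ∀ y, 0 < y 0 → ∀ i j, G y i j = (y 0 ^ 2)⁻¹ * if i = j then 1 else 0)
    {y : EuclideanSpace ℝ (Fin (n + 1))} (hy : 0 < y 0) (i j : Fin (n + 1)) :
    (hT.isNullLift_horoParam hG).secondForm y i j = -(1 / 2) * G y i j := by
  have hd := differentiableAt_of_contDiffOn isOpen_halfSpace (contDiffOn_horoParam (T := T)) hy
  rw [(hT.isNullLift_horoParam hG).secondForm_eq hy, dirDeriv_sub (by fun_prop)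
    (by fun_prop), dirDeriv_const, dirDeriv_smul (a := fun _ => (2⁻¹ : ℝ)) (by fun_prop) hd,
    dirDeriv_const, (hT.isNullLift_horoParam hG).metric y hy]
  simp

/-! ### The Poincaré–Einstein structure of the cap -/

section Cap

variable [hT : Fact (∃ T, L.IsAdapted T ξ)] {s : Sph (n + 1) → EuclideanSpace ℝ (Fin (n + 3))}

/-- The scale `s`, relative to the null parametrization of a chart of the cap. -/
noncomputable def chartFactor (s : Sph (n + 1) → EuclideanSpace ℝ (Fin (n + 3))) (p : L.cap ξ)
    (y : EuclideanSpace ℝ (Fin (n + 1))) : ℝ :=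
  (chartFrame p).denom (s ((isAdapted_chartFrame p).unstereo y))

lemma extChartAt_cap_pos {p : L.cap ξ} (hp : p ∈ (𝓡∂ (n + 1)).interior (L.cap ξ)) :
    0 < extChartAt (𝓡∂ (n + 1)) p p 0 := by
  rw [ModelWithCorners.interior, Set.mem_ofPred_eq, ModelWithCorners.IsInteriorPoint,
    interior_range_modelWithCornersEuclideanHalfSpace] at hp
  exact hp

namespace IsScale

variable (hs : L.IsScale s) (p : L.cap ξ)
include hs

lemma apply_unstereo (y : EuclideanSpace ℝ (Fin (n + 1))) :
    s ((isAdapted_chartFrame p).unstereo y) = chartFactor s p y • (chartFrame p).nullParam y := by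
  obtain ⟨t, ht, h⟩ := (isAdapted_chartFrame p).exists_lift_unstereo y
  have h1 := hs.eq_smul ((isAdapted_chartFrame p).unstereo y)
  rw [h, smul_smul] at h1
  rw [chartFactor, h1, map_smul, denom_nullParam, smul_eq_mul, mul_one]

lemma chartFactor_pos (y : EuclideanSpace ℝ (Fin (n + 1))) : 0 < chartFactor s p y := by
  obtain ⟨t, ht, h⟩ := (isAdapted_chartFrame p).exists_lift_unstereo y
  have h1 := hs.eq_smul ((isAdapted_chartFrame p).unstereo y)
  rw [h, smul_smul] at h1
  rw [chartFactor, h1, map_smul, denom_nullParam, smul_eq_mul, mul_one]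
  exact mul_pos (hs.factor_pos _) ht

lemma contDiff_chartFactor : ContDiff ℝ ∞ (chartFactor s p) :=
  contMDiff_iff_contDiff.1 (contMDiff_linear (chartFrame p).denom
    (hs.smooth.comp (isAdapted_chartFrame p).contMDiff_unstereo))

/-- In the chart the scale extends smoothly across the boundary, so derivatives within the
half-space are unrestricted ones, also at boundary points. -/
lemma mvfderiv_cap_coordVec {y : EuclideanSpace ℝ (Fin (n + 1))}
    (hy : y ∈ Set.range (𝓡∂ (n + 1))) (i : Fin (n + 1)) :
    mvfderiv (𝓡∂ (n + 1)) (fun q : L.cap ξ => s q) _ (coordVec (𝓡∂ (n + 1)) p y i)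
      = dirDeriv (fun z => chartFactor s p z • (chartFrame p).nullParam z) y i := by
  have hd : DifferentiableAt ℝ (fun z => chartFactor s p z • (chartFrame p).nullParam z) y :=
    ((hs.contDiff_chartFactor p).smul (chartFrame p).contDiff_nullParam).differentiable (by simp) y
  rw [mvfderiv_coordVec p (by rwa [extChartAt_cap_target])
    (hs.contMDiff_cap.mdifferentiableAt (by simp)), dirDeriv,
    ← hd.fderivWithin ((𝓡∂ (n + 1)).uniqueDiffOn y hy)]
  refine congrFun (congrArg _ (fderivWithin_congr' (fun z hz => ?_) hy)) _
  rw [extChartAt_cap_symm p hz, hs.apply_unstereo]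

lemma capMetric_coordVec {y : EuclideanSpace ℝ (Fin (n + 1))}
    (hy : y ∈ Set.range (𝓡∂ (n + 1))) (i j : Fin (n + 1)) :
    hs.capMetric.inner _ (coordVec (𝓡∂ (n + 1)) p y i) (coordVec (𝓡∂ (n + 1)) p y j)
      = chartFactor s p y ^ 2 * if i = j then 1 else 0 := by
  rw [← form_dirDeriv_smul_nullParam (T := chartFrame p)
    ((hs.contDiff_chartFactor p).differentiable (by simp) y), ← hs.mvfderiv_cap_coordVec p hy,
    ← hs.mvfderiv_cap_coordVec p hy]
  rfl

/-- In the chart `σ` is `a(y) * y 0` with `a` the chart factor; where `y 0 = 0`, the term with `∂a`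
disappears. -/
lemma mvfderiv_apply_coordVec {y : EuclideanSpace ℝ (Fin (n + 1))}
    (hy : y ∈ Set.range (𝓡∂ (n + 1))) (hy0 : y 0 = 0) (i : Fin (n + 1)) :
    mvfderiv (𝓡∂ (n + 1)) (fun q : L.cap ξ => ξ (s q)) _ (coordVec (𝓡∂ (n + 1)) p y i)
      = chartFactor s p y * if i = 0 then 1 else 0 := by
  have ha := (hs.contDiff_chartFactor p).differentiable (by simp) y
  rw [mvfderiv_linear ξ (hs.contMDiff_cap.mdifferentiableAt (by simp)),
    hs.mvfderiv_cap_coordVec p hy, ← dirDeriv_linear ξ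
      (f := fun z => chartFactor s p z • (chartFrame p).nullParam z) (ha.smul ((chartFrame p).contDiff_nullParam.differentiable (by simp) y))]
  simp only [map_smul, (isAdapted_chartFrame p).apply_nullParam]
  rw [dirDeriv_smul ha (by fun_prop), dirDeriv_coord, hy0, smul_zero, zero_add, smul_eq_mul]

/-- The metric is `a² |dy|²` and `σ = a * y 0`, so the scale cancels and the half-space metric
remains. -/
lemma gram_rescaled {y : EuclideanSpace ℝ (Fin (n + 1))} (hy : 0 < y 0) (i j : Fin (n + 1)) :
    gram (𝓡∂ (n + 1)) (rescaled hs.capMetric fun q : L.cap ξ => ξ (s q)) p y i j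
      = (y 0 ^ 2)⁻¹ * if i = j then 1 else 0 := by
  have hr := halfSpace_subset_range hy
  have h1 : ξ (s ((extChartAt (𝓡∂ (n + 1)) p).symm y : L.cap ξ)) = chartFactor s p y * y 0 := by
    rw [extChartAt_cap_symm p hr, hs.apply_unstereo, map_smul,
      (isAdapted_chartFrame p).apply_nullParam, smul_eq_mul]
  change (ξ (s ((extChartAt (𝓡∂ (n + 1)) p).symm y : L.cap ξ)) ^ 2)⁻¹
    * hs.capMetric.inner _ (coordVec (𝓡∂ (n + 1)) p y i) (coordVec (𝓡∂ (n + 1)) p y j) = _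
  rw [hs.capMetric_coordVec p hr, h1]
  have := (hs.chartFactor_pos p y).ne'
  field_simp

lemma exists_gradient (hp : p ∈ (𝓡∂ (n + 1)).boundary (L.cap ξ)) :
    ∃ w : TangentSpace (𝓡∂ (n + 1)) p,
    (∀ v, hs.capMetric.inner p w v = mvfderiv (𝓡∂ (n + 1)) (fun q : L.cap ξ => ξ (s q)) p v) ∧
      mvfderiv (𝓡∂ (n + 1)) (fun q : L.cap ξ => ξ (s q)) p w = 1 := by
  -- The coordinate fields live over the inverse chart's value at `y`, which equals `p` only
  -- propositionally. So the claim is proved for general `y` and transported at the end.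
  have key : ∀ y ∈ Set.range (𝓡∂ (n + 1)), y 0 = 0 →
      ∃ w : TangentSpace (𝓡∂ (n + 1)) ((extChartAt (𝓡∂ (n + 1)) p).symm y),
      (∀ v, hs.capMetric.inner _ w v
        = mvfderiv (𝓡∂ (n + 1)) (fun q : L.cap ξ => ξ (s q)) _ v) ∧
      mvfderiv (𝓡∂ (n + 1)) (fun q : L.cap ξ => ξ (s q)) _ w = 1 := by
    intro y hy hy0
    have hpos := (hs.chartFactor_pos p y).ne'
    -- For `g = a² |dy|²` and `dσ = a dy⁰` the gradient is `a⁻² a ∂₀ = a⁻¹ ∂₀`.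
    refine ⟨(chartFactor s p y)⁻¹ • coordVec (𝓡∂ (n + 1)) p y 0, fun v => ?_, ?_⟩
    · obtain ⟨c, rfl⟩ := exists_sum_coordVec p (by rwa [extChartAt_cap_target]) v
      simp only [map_sum, map_smul, smul_apply, hs.mvfderiv_apply_coordVec p hy hy0,
        hs.capMetric_coordVec p hy, smul_eq_mul]
      refine Finset.sum_congr rfl fun i _ => ?_
      simp only [eq_comm (a := (0 : Fin (n + 1)))]
      field_simp
    · rw [map_smul, hs.mvfderiv_apply_coordVec p hy hy0, if_pos rfl, mul_one, smul_eq_mul,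
        inv_mul_cancel₀ hpos]
  have h0 : extChartAt (𝓡∂ (n + 1)) p p 0 = 0 := by
    have h1 : ξ (L.lift (p : Sph (n + 1))) = 0 := (mem_boundary_cap_iff p).1 hp
    rw [extChartAt_cap_zero, h1, mul_zero]
  have h := key (extChartAt (𝓡∂ (n + 1)) p p)
    (extChartAt_target_subset_range p (mem_extChartAt_target p)) h0
  rwa [extChartAt_to_inv] at h

theorem hasConstantCurvatureAt (hp : p ∈ (𝓡∂ (n + 1)).interior (L.cap ξ)) :
    HasConstantCurvatureAt (𝓡∂ (n + 1))
      (rescaled hs.capMetric fun q : L.cap ξ => ξ (s q)) (-1) p := by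
  have hG := fun y hy i j => hs.gram_rescaled p (y := y) hy i j
  exact ((isAdapted_chartFrame p).isNullLift_horoParam hG).constantCurvature
    (extChartAt_cap_pos hp) halfSpace_subset_range
    ((isAdapted_chartFrame p).secondForm_horoParam hG (extChartAt_cap_pos hp))

theorem isPoincareEinstein : IsPoincareEinstein hs.capMetric fun q : L.cap ξ => ξ (s q) where
  compact := by
    refine isCompact_iff_compactSpace.1 (IsClosed.isCompact ?_)
    exact isClosed_le continuous_const ((LinearMap.continuous_of_finiteDimensional ξ).comp
      L.contMDiff_lift.continuous)
  hausdorff := inferInstance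
  smooth := contMDiff_linear ξ hs.contMDiff_cap
  nonneg q := by
    have h : 0 ≤ ξ (L.lift (q : Sph (n + 1))) := q.2
    rw [hs.eq_smul, map_smul]
    exact mul_nonneg (hs.factor_pos _).le h
  zero_iff q := by
    rw [mem_boundary_cap_iff, hs.eq_smul, map_smul, smul_eq_mul, mul_eq_zero]
    exact or_iff_right (hs.factor_pos _).ne'
  deriv_ne q hq h := by
    obtain ⟨w, -, hw⟩ := hs.exists_gradient q hq
    rw [h] at hw
    exact zero_ne_one hw
  unit_deriv q hq := hs.exists_gradient q hq
  einstein q hq a b := by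
    have hG := fun y hy i j => hs.gram_rescaled q (y := y) hy i j
    have h := ((isAdapted_chartFrame q).isNullLift_horoParam hG).einstein
      (extChartAt_cap_pos hq) halfSpace_subset_range
      ((isAdapted_chartFrame q).secondForm_horoParam hG (extChartAt_cap_pos hq)) a b
    rw [h]
    push_cast
    ring

end IsScale

end Cap

end LorentzFrame

end PEModel

namespace PEModel

namespace LorentzFrame

variable {n : ℕ} {H : LinearMap.BilinForm ℝ (EuclideanSpace ℝ (Fin (n + 3)))}
  {L T : LorentzFrame n H} {ξ : Module.Dual ℝ (EuclideanSpace ℝ (Fin (n + 3)))}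

/-! ### The isometry with the hyperboloid -/

lemma isOpen_openCap : IsOpen (L.openCap ξ) :=
  isOpen_lt continuous_const ((LinearMap.continuous_of_finiteDimensional ξ).comp
    L.contMDiff_lift.continuous)

/-- The point of the ray over `x` on which `ξ` is `1`. -/
noncomputable def horoLift (L : LorentzFrame n H)
    (ξ : Module.Dual ℝ (EuclideanSpace ℝ (Fin (n + 3)))) (x : Sph (n + 1)) :
    EuclideanSpace ℝ (Fin (n + 3)) :=
  (ξ (L.lift x))⁻¹ • L.lift x

lemma apply_horoLift {x : Sph (n + 1)} (hx : x ∈ L.openCap ξ) : ξ (L.horoLift ξ x) = 1 := by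
  have h : 0 < ξ (L.lift x) := hx
  rw [horoLift, map_smul, smul_eq_mul, inv_mul_cancel₀ h.ne']

lemma horoLift_mem {x : Sph (n + 1)} (hx : x ∈ L.openCap ξ) : L.horoLift ξ x ∈ L.cone :=
  L.smul_mem_cone (L.lift_mem x) (inv_pos.2 hx)

lemma proj_horoLift {x : Sph (n + 1)} (hx : x ∈ L.openCap ξ) :
    L.proj ⟨L.horoLift ξ x, horoLift_mem hx⟩ = x :=
  (L.proj_smul (L.lift_mem x) (inv_pos.2 hx) _).trans (L.proj_lift x _)

lemma horoLift_proj {p : EuclideanSpace ℝ (Fin (n + 3))} (hp : p ∈ L.cone) (h : ξ p = 1) :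
    L.horoLift ξ (L.proj ⟨p, hp⟩) = p := by
  obtain ⟨t, ht, h1⟩ := L.exists_lift_proj_eq hp
  rw [horoLift, h1, map_smul, h, smul_eq_mul, mul_one, inv_smul_smul₀ ht.ne']

lemma IsScale.horoLift_eq {s : Sph (n + 1) → EuclideanSpace ℝ (Fin (n + 3))} (hs : L.IsScale s)
    (x : Sph (n + 1)) : L.horoLift ξ x = (ξ (s x))⁻¹ • s x := by
  have h := (hs.factor_pos x).ne'
  rw [hs.eq_smul x, map_smul, smul_smul, smul_eq_mul, mul_inv_rev, mul_assoc, inv_mul_cancel₀ h,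
    mul_one, horoLift]

lemma contMDiffOn_horoLift : ContMDiffOn (𝓡 (n + 1)) 𝓘(ℝ, EuclideanSpace ℝ (Fin (n + 3))) ∞
    (L.horoLift ξ) (L.openCap ξ) := by
  have h : ContMDiff (𝓡 (n + 1)) 𝓘(ℝ, ℝ) ∞ fun x => ξ (L.lift x) :=
    contMDiff_linear ξ L.contMDiff_lift
  exact (h.contMDiffOn.inv₀ fun x hx => (ne_of_gt hx)).smul L.contMDiff_lift.contMDiffOn

lemma mdifferentiableAt_horoLift {x : Sph (n + 1)} (hx : x ∈ L.openCap ξ) :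
    MDifferentiableAt (𝓡 (n + 1)) 𝓘(ℝ, EuclideanSpace ℝ (Fin (n + 3))) (L.horoLift ξ) x :=
  (contMDiffOn_horoLift.contMDiffAt (isOpen_openCap.mem_nhds hx)).mdifferentiableAt (by simp)

lemma apply_mvfderiv_horoLift {x : Sph (n + 1)} (hx : x ∈ L.openCap ξ)
    (v : TangentSpace (𝓡 (n + 1)) x) : ξ (mvfderiv (𝓡 (n + 1)) (L.horoLift ξ) x v) = 0 := by
  have h1 : (fun y => ξ (L.horoLift ξ y)) =ᶠ[nhds x] fun _ => (1 : ℝ) :=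
    Filter.eventually_of_mem (isOpen_openCap.mem_nhds hx) fun y hy => apply_horoLift hy
  rw [← mvfderiv_linear ξ (mdifferentiableAt_horoLift hx), mvfderiv, h1.mfderiv_eq,
    mfderiv_const]
  rfl

/-- On the section `ξ = 1` the cone equation in adapted coordinates is `1 + ⟨w, w⟩ = 0`. The first
coordinate is constant there, so dropping it preserves the induced metric, and the section is `σ⁻¹
s` for any scale. -/
theorem IsAdapted.exists_hyperboloid_isometry (hT : L.IsAdapted T ξ) :
    ∃ Ψ : Sph (n + 1) → EuclideanSpace ℝ (Fin (n + 1)) × ℝ,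
      ContMDiffOn (𝓡 (n + 1)) 𝓘(ℝ, EuclideanSpace ℝ (Fin (n + 1)) × ℝ) ∞ Ψ (L.openCap ξ) ∧
      Set.BijOn Ψ (L.openCap ξ) (hyperboloid (n + 1)) ∧
      ∀ s, L.IsScale s → ∀ x ∈ L.openCap ξ, ∀ u v,
        minkowski (n + 1) (mvfderiv (𝓡 (n + 1)) Ψ x u) (mvfderiv (𝓡 (n + 1)) Ψ x v)
          = (ξ (s x) ^ 2)⁻¹ * scaleMetric H s x u v := by
  set A : EuclideanSpace ℝ (Fin (n + 3)) →ₗ[ℝ] EuclideanSpace ℝ (Fin (n + 1)) × ℝ :=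
    LinearMap.snd ℝ _ _ ∘ₗ T.coords.toLinearMap with hA
  have hcoords : ∀ p, T.coords p = (ξ p, A p) := fun p =>
    Prod.ext (apply_eq_coords hT p).symm rfl
  refine ⟨fun x => A (L.horoLift ξ x), ?_, ⟨fun x hx => ?_, fun x hx y hy h => ?_, fun w hw => ?_⟩,
    fun s hs x hx u v => ?_⟩
  · exact (LinearMap.toContinuousLinearMap A).contDiff.contMDiff.comp_contMDiffOn
      contMDiffOn_horoLift
  · have h := coords_mem_hyperboloid hT (horoLift_mem hx)
      (by rw [apply_horoLift hx]; exact one_pos)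
    rwa [apply_horoLift hx, inv_one, one_smul] at h
  · have h1 : L.horoLift ξ x = L.horoLift ξ y := by
      apply T.coords.injective
      rw [hcoords, hcoords, apply_horoLift hx, apply_horoLift hy]
      exact congrArg _ h
    have h2 := proj_horoLift hx
    have h3 := proj_horoLift hy
    rw [← h2, ← h3]
    simp only [h1]
  -- The preimage of `w` is the ray through `(1, w)`.
  · have h0 : T.coords.symm (1, w) ∈ L.cone := by
      rw [← hT.cone_eq, mem_cone_iff_coords, LinearEquiv.apply_symm_apply]
      have h1 : minkowski (n + 1) w w = -1 := hw.1
      exact ⟨by rw [h1]; norm_num, hw.2⟩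
    have h1 : ξ (T.coords.symm (1, w)) = 1 := by
      rw [apply_eq_coords hT, LinearEquiv.apply_symm_apply]
    refine ⟨L.proj ⟨_, h0⟩, (L.proj_mem_openCap_iff h0).2 (by rw [h1]; exact one_pos), ?_⟩
    change A (L.horoLift ξ (L.proj ⟨_, h0⟩)) = w
    rw [horoLift_proj h0 h1, hA, LinearMap.comp_apply, LinearEquiv.coe_coe,
      LinearEquiv.apply_symm_apply]
    rfl
  · have hd := mdifferentiableAt_horoLift hx
    rw [mvfderiv_linear A hd, mvfderiv_linear A hd]
    have hpos : ξ (s x) ≠ 0 := by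
      rw [hs.eq_smul, map_smul]
      exact (mul_pos (hs.factor_pos x) hx).ne'
    have ha : MDifferentiableAt (𝓡 (n + 1)) 𝓘(ℝ, ℝ) (fun y => (ξ (s y))⁻¹) x :=
      ((contMDiff_linear ξ hs.smooth).contMDiffAt.inv₀ hpos).mdifferentiableAt (by simp)
    have h := form_mvfderiv_smul L.form_symm (hs.mdifferentiableAt x) ha hs.form_self
      (hs.horoLift_eq (ξ := ξ)) u v
    rw [T.form_eq_coords, hcoords, hcoords, apply_mvfderiv_horoLift hx, zero_mul, zero_add] at h
    rw [← inv_pow]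
    exact h

/-! ### The conformal diffeomorphism onto a hemisphere -/

/-- The conformal transformation of the sphere between two frames with the same cone. -/
noncomputable def changeFrame (L T : LorentzFrame n H) (h : T.cone = L.cone) (x : Sph (n + 1)) :
    Sph (n + 1) :=
  T.proj ⟨L.lift x, h ▸ L.lift_mem x⟩

lemma exists_lift_changeFrame (h : T.cone = L.cone) (x : Sph (n + 1)) :
    ∃ t : ℝ, 0 < t ∧ T.lift (changeFrame L T h x) = t • L.lift x :=
  T.exists_lift_proj_eq _

lemma changeFrame_changeFrame (h : T.cone = L.cone) (h' : L.cone = T.cone) (x : Sph (n + 1)) :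
    changeFrame T L h' (changeFrame L T h x) = x := by
  obtain ⟨t, ht, h1⟩ := exists_lift_changeFrame h x
  exact ((L.proj_eq_proj_iff ⟨_, L.lift_mem x⟩ ⟨_, h' ▸ T.lift_mem _⟩).2 ⟨t, ht, h1⟩).symm.trans
    (L.proj_lift x _)

lemma contMDiff_changeFrame (h : T.cone = L.cone) :
    ContMDiff (𝓡 (n + 1)) (𝓡 (n + 1)) ∞ (changeFrame L T h) := by
  refine contMDiff_sphere_mk ?_ _
  have h1 := contMDiff_linear (LinearMap.fst ℝ _ _ ∘ₗ T.toEquiv.toLinearMap) L.contMDiff_lift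
  have h2 := contMDiff_linear (LinearMap.snd ℝ _ _ ∘ₗ T.toEquiv.toLinearMap) L.contMDiff_lift
  have h3 : ∀ x, L.lift x ∈ T.cone := fun x => h ▸ L.lift_mem x
  exact (h2.inv₀ fun x => (h3 x).2.ne').smul h1

/-- `changeFrame` as a diffeomorphism. -/
noncomputable def changeFrameDiffeo (L T : LorentzFrame n H) (h : T.cone = L.cone) :
    Sph (n + 1) ≃ₘ⟮𝓡 (n + 1), 𝓡 (n + 1)⟯ Sph (n + 1) where
  toFun := changeFrame L T h
  invFun := changeFrame T L h.symm
  left_inv := changeFrame_changeFrame h h.symm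
  right_inv := changeFrame_changeFrame h.symm h
  contMDiff_toFun := contMDiff_changeFrame h
  contMDiff_invFun := contMDiff_changeFrame h.symm

lemma IsAdapted.exists_changeFrame_zero (hT : L.IsAdapted T ξ) (x : Sph (n + 1)) :
    ∃ t : ℝ, 0 < t ∧ (changeFrame L T hT.cone_eq x : EuclideanSpace ℝ (Fin (n + 2))) 0
      = t * ξ (L.lift x) := by
  obtain ⟨t, ht, h⟩ := exists_lift_changeFrame hT.cone_eq x
  refine ⟨t, ht, ?_⟩
  rw [← smul_eq_mul, ← map_smul, ← h, hT.apply_eq, toEquiv_lift]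

lemma IsScale.lift_changeFrame {s : Sph (n + 1) → EuclideanSpace ℝ (Fin (n + 3))}
    (hs : L.IsScale s) (h : T.cone = L.cone) (x : Sph (n + 1)) :
    T.lift (changeFrame L T h x) = (T.toEquiv (s x)).2⁻¹ • s x := by
  obtain ⟨t, ht, h1⟩ := exists_lift_changeFrame h x
  have hf := (hs.factor_pos x).ne'
  have h2 : T.lift (changeFrame L T h x) = (t * (L.factor s x)⁻¹) • s x := by
    rw [h1, hs.eq_smul x, smul_smul, mul_assoc, inv_mul_cancel₀ hf, mul_one]
  have h3 := congrArg (fun p => (T.toEquiv p).2) h2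
  simp only [toEquiv_lift, map_smul, Prod.smul_snd, smul_eq_mul] at h3
  rw [h2, eq_inv_of_mul_eq_one_left h3.symm]

/-- Two frames with the same cone give two identifications of its rays with the sphere. Their
comparison `φ` is conformal because `T.lift ∘ φ` is a positive multiple of the scale `s`, and the
first coordinate of the new sphere has the sign of `ξ`. -/
theorem IsAdapted.exists_conformal_diffeo (hT : L.IsAdapted T ξ) :
    ∃ φ : Sph (n + 1) ≃ₘ⟮𝓡 (n + 1), 𝓡 (n + 1)⟯ Sph (n + 1),
      (∀ x, x ∈ L.openCap ξ ↔ 0 < (φ x : EuclideanSpace ℝ (Fin (n + 2))) 0) ∧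
      (∀ x, x ∈ L.zeroSet ξ ↔ (φ x : EuclideanSpace ℝ (Fin (n + 2))) 0 = 0) ∧
      ∀ s, L.IsScale s → ∃ f : Sph (n + 1) → ℝ, ContMDiff (𝓡 (n + 1)) 𝓘(ℝ, ℝ) ∞ f ∧
        (∀ x, 0 < f x) ∧ ∀ x u v,
          roundMetric (n + 1) (φ x) (mfderiv (𝓡 (n + 1)) (𝓡 (n + 1)) φ x u)
              (mfderiv (𝓡 (n + 1)) (𝓡 (n + 1)) φ x v)
            = f x ^ 2 * scaleMetric H s x u v := by
  refine ⟨changeFrameDiffeo L T hT.cone_eq, fun x => ?_, fun x => ?_, fun s hs => ?_⟩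
  · obtain ⟨t, ht, h⟩ := hT.exists_changeFrame_zero x
    change 0 < ξ (L.lift x) ↔
      0 < (changeFrame L T hT.cone_eq x : EuclideanSpace ℝ (Fin (n + 2))) 0
    rw [h, mul_pos_iff_of_pos_left ht]
  · obtain ⟨t, ht, h⟩ := hT.exists_changeFrame_zero x
    change ξ (L.lift x) = 0 ↔
      (changeFrame L T hT.cone_eq x : EuclideanSpace ℝ (Fin (n + 2))) 0 = 0
    rw [h, mul_eq_zero]
    exact (or_iff_right ht.ne').symm
  · have hpos : ∀ x, 0 < (T.toEquiv (s x)).2 := fun x =>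
      (hT.cone_eq ▸ hs.mem_cone x : s x ∈ T.cone).2
    have hf : ContMDiff (𝓡 (n + 1)) 𝓘(ℝ, ℝ) ∞ fun x => (T.toEquiv (s x)).2⁻¹ :=
      (contMDiff_linear (LinearMap.snd ℝ _ _ ∘ₗ T.toEquiv.toLinearMap) hs.smooth).inv₀
        fun x => (hpos x).ne'
    refine ⟨_, hf, fun x => inv_pos.2 (hpos x), fun x u v => ?_⟩
    have h1 : ∀ w : TangentSpace (𝓡 (n + 1)) x,
        mvfderiv (𝓡 (n + 1)) (fun y => T.lift (changeFrame L T hT.cone_eq y)) x w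
          = mvfderiv (𝓡 (n + 1)) T.lift (changeFrame L T hT.cone_eq x)
            (mfderiv (𝓡 (n + 1)) (𝓡 (n + 1)) (changeFrame L T hT.cone_eq) x w) := fun w =>
      mvfderiv_comp_apply' (T.mdifferentiableAt_lift _)
        ((contMDiff_changeFrame hT.cone_eq).mdifferentiableAt (by simp)) w
    have h2 := form_mvfderiv_smul L.form_symm (hs.mdifferentiableAt x)
      (hf.mdifferentiableAt (by simp)) hs.form_self (hs.lift_changeFrame hT.cone_eq) u v
    rw [h1, h1, T.form_mvfderiv_lift] at h2
    exact h2

end LorentzFrame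

end PEModel
theorem mainTheorem7 (n : ℕ) (hn : 2 ≤ n)
    (H : LinearMap.BilinForm ℝ (EuclideanSpace ℝ (Fin (n + 3)))) (hH : H.Nondegenerate)
    (L : PEModel.LorentzFrame n H)
    (ξ : Module.Dual ℝ (EuclideanSpace ℝ (Fin (n + 3))))
    (hξ : PEModel.covectorNormSq H hH ξ = 1) :
    -- (1) the projectivised null cone is the sphere, with the conformal class of the round metric
    ((∀ p, p ≠ 0 → H p p = 0 → (p ∈ L.cone ∨ -p ∈ L.cone)) ∧
      Function.Surjective L.proj ∧
      (∀ p q : L.cone, L.proj p = L.proj q ↔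
        ∃ t : ℝ, 0 < t ∧ (q : EuclideanSpace ℝ (Fin (n + 3))) = t • p) ∧
      (∀ s, L.IsScale s → ∃ f : PEModel.Sph (n + 1) → ℝ, ContMDiff (𝓡 (n + 1)) 𝓘(ℝ, ℝ) ∞ f ∧
        (∀ x, 0 < f x) ∧ ∀ x u v, PEModel.LorentzFrame.scaleMetric H s x u v
          = f x ^ 2 * PEModel.roundMetric (n + 1) x u v) ∧
      (∀ f : PEModel.Sph (n + 1) → ℝ, ContMDiff (𝓡 (n + 1)) 𝓘(ℝ, ℝ) ∞ f → (∀ x, 0 < f x) →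
        ∃ s, L.IsScale s ∧ ∀ x u v, PEModel.LorentzFrame.scaleMetric H s x u v
          = f x ^ 2 * PEModel.roundMetric (n + 1) x u v)) ∧
    -- (2) the constant section descends to a parallel section of the tractor bundle, which is
    -- represented in each scale by a parallel triple (with `Y` the null field dual to `X = s`)
    ((∃! S : PEModel.Sph (n + 1) → L.TractorBundle,
        (∀ p : L.cone, S (L.proj p) = L.tractorMk p ((H.toDual hH).symm ξ)) ∧
        L.IsParallelSection S) ∧
      (∀ s, L.IsScale s → ∃ Y : PEModel.Sph (n + 1) → EuclideanSpace ℝ (Fin (n + 3)),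
        (∀ x, H (Y x) (Y x) = 0 ∧ H (Y x) (s x) = 1 ∧
          ∀ v, H (Y x) (mvfderiv (𝓡 (n + 1)) s x v) = 0) ∧
        PEModel.IsParallelTriple (𝓡 (n + 1)) (PEModel.LorentzFrame.scaleMetric H s)
          (fun x => ξ (s x)) (fun x v => ξ (mvfderiv (𝓡 (n + 1)) s x v)) (fun x => ξ (Y x)))) ∧
    -- (3) the cap is a Poincaré–Einstein space, with a metric of curvature `-1` in the interior
    (∃ (cs : ChartedSpace (EuclideanHalfSpace (n + 1)) (L.cap ξ))
        (_ : IsManifold (𝓡∂ (n + 1)) ∞ (L.cap ξ)),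
      ContMDiff (𝓡∂ (n + 1)) (𝓡 (n + 1)) ∞ ((↑) : L.cap ξ → PEModel.Sph (n + 1)) ∧
      (∀ p, Function.Injective
        (mfderiv (𝓡∂ (n + 1)) (𝓡 (n + 1)) ((↑) : L.cap ξ → PEModel.Sph (n + 1)) p)) ∧
      (((↑) : L.cap ξ → PEModel.Sph (n + 1)) '' (𝓡∂ (n + 1)).boundary (L.cap ξ)
        = L.zeroSet ξ) ∧
      (((↑) : L.cap ξ → PEModel.Sph (n + 1)) '' (𝓡∂ (n + 1)).interior (L.cap ξ)
        = L.openCap ξ) ∧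
      ∀ s, L.IsScale s →
        ∃ g : Bundle.ContMDiffRiemannianMetric (𝓡∂ (n + 1)) ∞ (EuclideanSpace ℝ (Fin (n + 1)))
            (fun p : L.cap ξ => TangentSpace (𝓡∂ (n + 1)) p),
          (∀ p u v, g.inner p u v = PEModel.LorentzFrame.scaleMetric H s p
            (mfderiv (𝓡∂ (n + 1)) (𝓡 (n + 1)) ((↑) : L.cap ξ → PEModel.Sph (n + 1)) p u)
            (mfderiv (𝓡∂ (n + 1)) (𝓡 (n + 1)) ((↑) : L.cap ξ → PEModel.Sph (n + 1)) p v)) ∧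
          PEModel.IsPoincareEinstein g (fun p => ξ (s p)) ∧
          ∀ p ∈ (𝓡∂ (n + 1)).interior (L.cap ξ), PEModel.HasConstantCurvatureAt (𝓡∂ (n + 1))
            (PEModel.rescaled g (fun p => ξ (s p))) (-1) p) ∧
    -- the interior with the metric `σ⁻² g` is globally isometric to hyperbolic space
    (∃ Ψ : PEModel.Sph (n + 1) → EuclideanSpace ℝ (Fin (n + 1)) × ℝ,
      ContMDiffOn (𝓡 (n + 1)) 𝓘(ℝ, EuclideanSpace ℝ (Fin (n + 1)) × ℝ) ∞ Ψ (L.openCap ξ) ∧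
      Set.BijOn Ψ (L.openCap ξ) (PEModel.hyperboloid (n + 1)) ∧
      ∀ s, L.IsScale s → ∀ x ∈ L.openCap ξ, ∀ u v,
        PEModel.minkowski (n + 1) (mvfderiv (𝓡 (n + 1)) Ψ x u) (mvfderiv (𝓡 (n + 1)) Ψ x v)
          = (ξ (s x) ^ 2)⁻¹ * PEModel.LorentzFrame.scaleMetric H s x u v) ∧
    -- up to a conformal diffeomorphism of the sphere, the cap is a hemisphere and its boundary
    -- is the equator
    (∃ φ : PEModel.Sph (n + 1) ≃ₘ⟮𝓡 (n + 1), 𝓡 (n + 1)⟯ PEModel.Sph (n + 1),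
      (∀ x, x ∈ L.openCap ξ ↔ 0 < (φ x : EuclideanSpace ℝ (Fin (n + 2))) 0) ∧
      (∀ x, x ∈ L.zeroSet ξ ↔ (φ x : EuclideanSpace ℝ (Fin (n + 2))) 0 = 0) ∧
      ∀ s, L.IsScale s → ∃ f : PEModel.Sph (n + 1) → ℝ, ContMDiff (𝓡 (n + 1)) 𝓘(ℝ, ℝ) ∞ f ∧
        (∀ x, 0 < f x) ∧ ∀ x u v,
          PEModel.roundMetric (n + 1) (φ x) (mfderiv (𝓡 (n + 1)) (𝓡 (n + 1)) φ x u)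
              (mfderiv (𝓡 (n + 1)) (𝓡 (n + 1)) φ x v)
            = f x ^ 2 * PEModel.LorentzFrame.scaleMetric H s x u v) ∧
    -- (4) restriction to the kernel of `ξ` identifies the isotropy group with `SO(d, 1)`
    (∃ (e : EuclideanSpace ℝ (Fin (n + 1)) × ℝ →ₗ[ℝ] EuclideanSpace ℝ (Fin (n + 3)))
        (Φ : ↥(PEModel.SO H ⊓ PEModel.fixing ξ) ≃* ↥(PEModel.SO (PEModel.minkowski (n + 1)))),
      (∀ w w', H (e w) (e w') = PEModel.minkowski (n + 1) w w') ∧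
      LinearMap.range e = LinearMap.ker ξ ∧
      (∀ φ w, φ.1 (e w) = e ((Φ φ).1 w)) ∧
      ∀ φ, φ.1 ∈ PEModel.preserving L.cone ↔
        (Φ φ).1 ∈ PEModel.preserving (PEModel.stdCone (n + 1))) ∧
    -- and its elements which preserve the forward cone act transitively on the interior
    (∃ act : MulAction ↥(PEModel.SO H ⊓ PEModel.preserving L.cone ⊓ PEModel.fixing ξ)
        (L.openCap ξ),
      (∀ φ (x : L.openCap ξ) (p : L.cone), L.proj p = x →
        ∃ h : φ.1 p ∈ L.cone,
          L.proj ⟨φ.1 p, h⟩ = (act.smul φ x : PEModel.Sph (n + 1))) ∧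
      MulAction.IsPretransitive ↥(PEModel.SO H ⊓ PEModel.preserving L.cone ⊓ PEModel.fixing ξ)
        (L.openCap ξ)) := by
  obtain ⟨T, hT⟩ := L.exists_isAdapted hH ξ hξ
  have : Fact (∃ T, L.IsAdapted T ξ) := ⟨T, hT⟩
  exact ⟨L.conformal_class, ⟨L.existsUnique_parallel_section _, fun s hs => hs.parallelTriple hn ξ⟩,
    ⟨inferInstance, inferInstance, PEModel.LorentzFrame.contMDiff_cap_coe,
      PEModel.LorentzFrame.mfderiv_cap_coe_injective, PEModel.LorentzFrame.image_boundary_cap,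
      PEModel.LorentzFrame.image_interior_cap, fun s hs => ⟨hs.capMetric, hs.inducedForm_cap,
        hs.isPoincareEinstein, fun p hp => hs.hasConstantCurvatureAt p hp⟩⟩,
    hT.exists_hyperboloid_isometry, hT.exists_conformal_diffeo,
    PEModel.LorentzFrame.isotropy_group hT, PEModel.LorentzFrame.isotropy_action hT⟩
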